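/- Work over $\mathbb{C}$, let $n\ge 1$ and let $p,l\ge 0$ be integers with $p+l=n+3$. Let $\mathcal{H}$ be the set of rational normal curves in $\mathbb{P}^n$, i.e. the images of $\mathbb{P}^1$ under embeddings given by a basis of $H^0(\mathbb{P}^1,\mathcal{O}(n))$. Let $\mathcal{D}=G(n-2,\mathbb{P}^n)^l\times(\mathbb{P}^n)^p$ (with its Zariski topology) be the space of data $\delta=(\Lambda_1,\dots,\Lambda_l,P_1,\dots,P_p)$ consisting of $l$ codimension two linear spaces (for $n=1$, the empty space) and $p$ points. A curve $\mathcal{C}\in\mathcal{H}$ satisfies $\delta$ if $P_j\in\mathcal{C}$ for $1\le j\le p$ and the scheme $\Lambda_i\cap\mathcal{C}$ has degree $n-1$ for $1\le i\le l$. The space $\Lambda_i$ is called $(n-1)$-secant to $\mathcal{C}$ if $\Lambda_i\cap\mathcal{C}$ is a set of $n-1$ distinct points. Let $$\Sigma=\{(\mathcal{C},\delta)\in\mathcal{H}\times\mathcal{D} : \mathcal{C}\text{ satisfies }\delta\},$$ and let $\phi:\Sigma\to\mathcal{D}$ be the projection. Suppose that there is a datum $\delta=(\Lambda_1,\dots,\Lambda_l,P_1,\dots,P_p)\in\mathcal{D}$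 such that $\phi^{-1}(\delta)$ is finite and nonempty. Then $\phi$ is dominant, i.e. $\phi(\Sigma)$ is Zariski dense in $\mathcal{D}$. Moreover, if for some curve $\mathcal{C}$ with $(\mathcal{C},\delta)\in\phi^{-1}(\delta)$ all the spaces $\Lambda_1,\dots,\Lambda_l$ are $(n-1)$-secant to $\mathcal{C}$, then the same holds for the generic datum: there is a nonempty Zariski open set $U\subseteq\mathcal{D}$ such that, for every $\delta'=(\Lambda'_1,\dots,\Lambda'_l,P'_1,\dots,P'_p)\in U$, the fiber $\phi^{-1}(\delta')$ is nonempty and, for every curve $\mathcal{C}'$ satisfying $\delta'$, all the spaces $\Lambda'_1,\dots,\Lambda'_l$ are $(n-1)$-secant to $\mathcal{C}'$. -/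

import Mathlib

open scoped LinearAlgebra.Projectivization

noncomputable section

namespace RatNormal

/-- Complex projective `n`-space `ℙⁿ`, the lines through the origin of `ℂⁿ⁺¹`. -/
abbrev ProjSpace (n : ℕ) : Type := ℙ ℂ (Fin (n + 1) → ℂ)

/-- `G(n-2, ℙⁿ)`: the linear subspaces of `ℂⁿ⁺¹` of codimension two. (Mathlib's Grassmannian
is indexed by the rank of the quotient.) For `n = 1` its only element is `0`, that is, the empty
linear space. -/
abbrev CodimTwo (n : ℕ) : Type := Module.Grassmannian ℂ (Fin (n + 1) → ℂ) 2

/-- The point `P` lies on the linear space `Λ`. -/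
def Lies {n : ℕ} (P : ProjSpace n) (Λ : CodimTwo n) : Prop :=
  P.submodule ≤ Λ.toSubmodule

/-- `H⁰(ℙ¹, 𝒪(n))`: the binary forms of degree `n`. -/
abbrev BinaryForm (n : ℕ) : Submodule ℂ (MvPolynomial (Fin 2) ℂ) :=
  MvPolynomial.homogeneousSubmodule (Fin 2) ℂ n

/-- The image of the morphism `ℙ¹ → ℙⁿ`, `u ↦ [f₀(u) : … : fₙ(u)]`, given by a basis
`f₀, …, fₙ` of the complete linear system `H⁰(ℙ¹, 𝒪(n))`. -/
def veroneseImage {n : ℕ} (f : Module.Basis (Fin (n + 1)) ℂ (BinaryForm n)) :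
    Set (ProjSpace n) :=
  {P | ∃ u : Fin 2 → ℂ, u ≠ 0 ∧
    P.submodule = Submodule.span ℂ {fun i => MvPolynomial.eval u (f i : MvPolynomial (Fin 2) ℂ)}}

/-- The set `ℋ` of rational normal curves in `ℙⁿ`: the linearly normal embeddings of `ℙ¹` of
degree `n`, i.e. by a complete linear system `|𝒪(n)|`. The curves are reduced, so each is
recorded by its set of points. -/
def RNC (n : ℕ) : Type :=
  {C : Set (ProjSpace n) //
    ∃ f : Module.Basis (Fin (n + 1)) ℂ (BinaryForm n), C = veroneseImage f}

/-- The ideal of a set of points of `ℙⁿ`: the polynomials vanishing on the affine cone over it. -/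
def curveIdeal {n : ℕ} (C : Set (ProjSpace n)) : Ideal (MvPolynomial (Fin (n + 1)) ℂ) :=
  MvPolynomial.vanishingIdeal ℂ
    {v : Fin (n + 1) → ℂ | ∀ h : v ≠ 0, Projectivization.mk ℂ v h ∈ C}

/-- The ideal of a linear space, generated by two independent linear forms. -/
def spaceIdeal {n : ℕ} (Λ : CodimTwo n) : Ideal (MvPolynomial (Fin (n + 1)) ℂ) :=
  MvPolynomial.vanishingIdeal ℂ (Λ.toSubmodule : Set (Fin (n + 1) → ℂ))

/-- The Hilbert function of `S ⧸ I` for `S = ℂ[x₀, …, xₙ]` and a homogeneous ideal `I`: the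
dimension of the degree `d` part of `S ⧸ I`. -/
def hilbertFun {n : ℕ} (I : Ideal (MvPolynomial (Fin (n + 1)) ℂ)) (d : ℕ) : ℕ :=
  Module.finrank ℂ
    ((MvPolynomial.homogeneousSubmodule (Fin (n + 1)) ℂ d).map
      (Ideal.Quotient.mkₐ ℂ I).toLinearMap)

/-- The scheme-theoretic intersection `Λ ∩ C` is finite of degree `e`: its Hilbert polynomial
is the constant `e`. -/
def MeetsInDegree {n : ℕ} (C : RNC n) (Λ : CodimTwo n) (e : ℕ) : Prop :=
  ∀ᶠ d in Filter.atTop, hilbertFun (curveIdeal C.1 ⊔ spaceIdeal Λ) d = e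

/-- `Λ` is `(n-1)`-secant to `C`: the set `Λ ∩ C` consists of `n - 1` distinct points. -/
def IsSecant {n : ℕ} (C : RNC n) (Λ : CodimTwo n) : Prop :=
  {P : ProjSpace n | P ∈ C.1 ∧ Lies P Λ}.encard = ((n - 1 : ℕ) : ℕ∞)

/-- The data space `𝒟 = G(n-2, ℙⁿ)ˡ × (ℙⁿ)ᵖ`. -/
@[ext]
structure Datum (n p l : ℕ) where
  space : Fin l → CodimTwo n
  point : Fin p → ProjSpace n

/-- Indices of the coordinates of a datum: for each linear space the coefficients of two linear
forms cutting it out, and for each point its homogeneous coordinates. -/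
abbrev CoordIdx (n p l : ℕ) : Type :=
  (Fin l × Fin 2 × Fin (n + 1)) ⊕ (Fin p × Fin (n + 1))

/-- `x` is a system of coordinates of the datum `δ`: `Λᵢ` is the common zero locus of the linear
forms with coefficients `x (inl (i, 0, ·))` and `x (inl (i, 1, ·))`, which are then linearly
independent, and `x (inr (j, ·))` are homogeneous coordinates of `Pⱼ`. -/
def IsCoord {n p l : ℕ} (x : CoordIdx n p l → ℂ) (δ : Datum n p l) : Prop :=
  (∀ i, ∀ v : Fin (n + 1) → ℂ, v ∈ (δ.space i).toSubmodule ↔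
    ∀ k : Fin 2, ∑ m, x (Sum.inl (i, k, m)) * v m = 0) ∧
  (∀ j, (δ.point j).submodule = Submodule.span ℂ {fun m => x (Sum.inr (j, m))})

/-- A set of data is Zariski closed if it is defined by polynomial equations in the coordinates
of a datum. -/
def IsZariskiClosed {n p l : ℕ} (Z : Set (Datum n p l)) : Prop :=
  ∃ S : Set (MvPolynomial (CoordIdx n p l) ℂ), ∀ (δ : Datum n p l) (x : CoordIdx n p l → ℂ),
    IsCoord x δ → (δ ∈ Z ↔ ∀ F ∈ S, MvPolynomial.eval x F = 0)

/-- The Zariski topology of the product variety `𝒟`: the quotient topology from the Zariski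
open set of all coordinate systems of data in affine space. (On `ℙⁿ` this is the usual
description by homogeneous coordinates; on the Grassmannian, a quotient of the space of pairs of
independent linear forms by `GL₂`, it is the topology given by Plücker coordinates.) -/
instance zariskiTopology (n p l : ℕ) : TopologicalSpace (Datum n p l) :=
  TopologicalSpace.ofClosed {Z | IsZariskiClosed Z}
    ⟨{1}, fun δ x _ => by simp⟩
    (by
      intro A hA
      refine ⟨{F | ∃ Z, ∃ h : Z ∈ A, F ∈ (hA h).choose}, fun δ x hx => ?_⟩
      constructor
      · rintro hδ F ⟨Z, hZ, hF⟩
        exact ((hA hZ).choose_spec δ x hx).1 (hδ Z hZ) F hF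
      · intro hF Z hZ
        exact ((hA hZ).choose_spec δ x hx).2 fun F hFZ => hF F ⟨Z, hZ, hFZ⟩)
    (by
      rintro Z ⟨S, hS⟩ W ⟨T, hT⟩
      refine ⟨{H | ∃ F ∈ S, ∃ G ∈ T, H = F * G}, fun δ x hx => ?_⟩
      rw [Set.mem_union, hS δ x hx, hT δ x hx]
      constructor
      · rintro (h | h) H ⟨F, hF, G, hG, rfl⟩
        · simp [h F hF]
        · simp [h G hG]
      · intro h
        by_contra! hc
        obtain ⟨⟨F, hF, hF0⟩, ⟨G, hG, hG0⟩⟩ := hc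
        have := h (F * G) ⟨F, hF, G, hG, rfl⟩
        rw [map_mul] at this
        exact (mul_ne_zero hF0 hG0) this)

/-- The curve `C` satisfies the datum `δ = (Λ₁, …, Λₗ, P₁, …, Pₚ)`: it passes through every `Pⱼ`
and every `Λᵢ ∩ C` has degree `n - 1`. -/
def Satisfies {n p l : ℕ} (C : RNC n) (δ : Datum n p l) : Prop :=
  (∀ j, δ.point j ∈ C.1) ∧ ∀ i, MeetsInDegree C (δ.space i) (n - 1)

/-- The incidence correspondence `Σ ⊆ ℋ × 𝒟`. -/
def Incidence (n p l : ℕ) : Type :=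
  {x : RNC n × Datum n p l // Satisfies x.1 x.2}

/-- The projection `φ : Σ → 𝒟`. -/
def dataProj (n p l : ℕ) : Incidence n p l → Datum n p l := fun x => x.1.2

end RatNormal

end

/-! A rational normal curve is `curveSet A`: the image of the map sending `u` to the vector of
degree `n` monomials in `u` followed by an invertible matrix `A`, which is unique up to linear
substitutions in `u`. A linear space of codimension two cuts out on it a pencil of binary forms of
degree `n`, and the degree of the intersection is the degree of the greatest common divisor of that
pencil. Degree `n - 1` therefore means a product of `n - 1` linear forms times a pencil of linear
forms (`eventually_hilbertFun_eq_iff`). Curves with coordinates of a datum they satisfy are thus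
parametrized by polynomials on an affine space (`paramCoord`): the entries of `A`, a vector of ℂ²
for each point, and the roots and moving linear forms for each space.

Fixing four entries of `A` removes the substitutions up to finitely many, and fixing one coordinate
of each root removes its scaling. By `p + l = n + 3` the remaining slice has the dimension of the
space of coordinates (`card_sliceSlot`). If one fibre of `φ` is finite and nonempty, the polynomial
map on a slice has an isolated point in a fibre (`finite_slice_fiber`). Its components are then
algebraically independent (`algebraicIndependent_of_finite_fiber`), so it attains every value off
some hypersurface (`exists_preimage_of_algebraicIndependent`). This gives density.

For secancy, two roots of one base locus coincide only on a hypersurface of the slice. By equality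
of dimensions its image lies in a proper hypersurface (`exists_eval_eq_zero_of_eval_eq_zero`),
whether or not the map is dominant. A curve may need any of finitely many slices, so the product of
the corresponding equations is taken. Off the two resulting hypersurfaces a datum is satisfied by
some curve, and its spaces are secant to every curve satisfying it. -/

open MvPolynomial

namespace RatNormal

/-! ### Polynomial maps between affine spaces of equal dimension. -/

section PolynomialMaps

variable {k : Type*} [Field k] {σ τ : Type*}

/-- The translation of affine space by `a`, as an automorphism of the polynomial ring. -/
noncomputable def translateEquiv (a : σ → k) : MvPolynomial σ k ≃ₐ[k] MvPolynomial σ k :=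
  AlgEquiv.ofAlgHom (aeval fun s => X s + C (a s)) (aeval fun s => X s - C (a s))
    (by ext s; simp) (by ext s; simp)

theorem eval_translateEquiv (a x : σ → k) (f : MvPolynomial σ k) :
    eval x (translateEquiv a f) = eval (x + a) f := by
  have : (aeval x).comp (translateEquiv a).toAlgHom = aeval (x + a) := by
    ext s; simp [translateEquiv]
  simpa [aeval_eq_eval] using DFunLike.congr_fun this f

/-- Every point of affine space has height the number of coordinates. -/
theorem height_ker_eval [IsAlgClosed k] [Finite σ] (x : σ → k) :
    (RingHom.ker (eval x)).height = Nat.card σ := by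
  have hdim : ringKrullDim (MvPolynomial σ k) = Nat.card σ := by
    rw [ringKrullDim_of_isNoetherianRing]; simp
  have : FiniteRingKrullDim (MvPolynomial σ k) := by
    rw [finiteRingKrullDim_iff_ne_bot_and_top, hdim]
    exact ⟨by simp, fun h => ENat.natCast_ne_top (Nat.card σ) (WithBot.coe_injective h)⟩
  -- Some maximal ideal has height equal to the Krull dimension. By the Nullstellensatz it is the
  -- ideal of a point `y`, and a translation moves `y` to `x`.
  obtain ⟨P, hP, hht⟩ := Ideal.exists_isMaximal_height (R := MvPolynomial σ k)
  obtain ⟨y, rfl⟩ := eq_vanishingIdeal_singleton_of_isMaximal k hP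
  rw [hdim] at hht
  have : RingHom.ker (eval x) =
      (vanishingIdeal k {y}).comap (translateEquiv (x - y)).toRingEquiv := by
    ext f
    rw [RingHom.mem_ker, Ideal.mem_comap, mem_vanishingIdeal_singleton_iff, aeval_eq_eval]
    erw [eval_translateEquiv]
    simp
  rw [this, RingEquiv.height_comap]
  exact_mod_cast hht

/-- A prime ideal of a polynomial ring whose zero locus has only finitely many points off a
hypersurface not containing it, one of them `x`, is the ideal of `x`. -/
theorem eq_ker_eval_of_finite [IsAlgClosed k] [Finite σ] (x : σ → k)
    (b : MvPolynomial σ k) (hb : eval x b ≠ 0)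
    (P : Ideal (MvPolynomial σ k)) [hP : P.IsPrime] (hPx : P ≤ RingHom.ker (eval x))
    (hfin : {z : σ → k | eval z b ≠ 0 ∧ ∀ f ∈ P, eval z f = 0}.Finite) :
    P = RingHom.ker (eval x) := by
  classical
  by_contra hne
  have hsep : ∀ z : σ → k, (∀ f ∈ P, eval z f = 0) → ∃ f, eval z f = 0 ∧ f ∉ P := by
    intro z hz
    by_contra! hc
    have hPz : P = RingHom.ker (eval z) := le_antisymm (fun f hf => hz f hf) fun f hf => hc f hf
    have hmax : P.IsMaximal := by
      rw [hPz]; exact RingHom.ker_isMaximal_of_surjective _ fun c => ⟨C c, by simp⟩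
    exact hne (hmax.eq_of_le (RingHom.ker_ne_top _) hPx)
  choose! F hF using hsep
  -- This product vanishes on the whole zero locus of `P`: `b` handles all but finitely many points,
  -- `F z` the point `z`. Since `P` is prime, the Nullstellensatz puts it in `P`.
  have hmem : b * ∏ z ∈ hfin.toFinset, F z ∈ P := by
    refine (IsPrime.vanishingIdeal_zeroLocus (K := k) P).le (mem_vanishingIdeal_iff.2 ?_)
    intro z hz
    rw [mem_zeroLocus_iff] at hz
    simp only [aeval_eq_eval] at hz ⊢
    by_cases hbz : eval z b = 0
    · simp [hbz]
    · rw [map_mul, map_prod, Finset.prod_eq_zero (i := z), mul_zero]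
      · simpa using ⟨hbz, hz⟩
      · exact (hF z hz).1
  rcases hP.mem_or_mem hmem with h | h
  · exact hb (hPx h)
  · rw [hP.prod_mem_iff] at h
    obtain ⟨z, hz, hzP⟩ := h
    rw [Set.Finite.mem_toFinset] at hz
    exact (hF z hz.2).2 hzP

/-- A polynomial map between affine spaces of the same dimension with a point isolated in its
fiber has algebraically independent components. -/
theorem algebraicIndependent_of_finite_fiber [IsAlgClosed k] [Finite σ] [Finite τ]
    (hcard : Nat.card τ = Nat.card σ) (ψ : τ → MvPolynomial σ k) (b : MvPolynomial σ k)
    (x : σ → k) (hb : eval x b ≠ 0)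
    (hfin : {z : σ → k | eval z b ≠ 0 ∧ ∀ t, eval z (ψ t) = eval x (ψ t)}.Finite) :
    AlgebraicIndependent k ψ := by
  classical
  let A := Algebra.adjoin k (Set.range ψ)
  let ψA : τ → A := fun t => ⟨ψ t, Algebra.subset_adjoin ⟨t, rfl⟩⟩
  have : Algebra.FiniteType k A :=
    A.fg_iff_finiteType.1 ⟨(Set.finite_range ψ).toFinset, by simp [A]⟩
  -- Noether normalization of the algebra generated by the components. If `s` were less than the
  -- number of components, the `s` equations `z` would already isolate `x`, against Krull's height
  -- theorem. Otherwise the components generate an algebra of transcendence degree at least their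
  -- number.
  obtain ⟨s, g, hginj, hgint⟩ := exists_integral_inj_algHom_of_fg k A
  have htop : Algebra.adjoin k (Set.range ψA) = ⊤ := by
    apply Subalgebra.map_injective (f := A.val) Subtype.val_injective
    rw [AlgHom.map_adjoin, ← Set.range_comp, Algebra.map_top, Subalgebra.range_val]
    rfl
  rcases lt_or_ge s (Nat.card τ) with hs | hs
  · exfalso
    let y : Fin s → MvPolynomial σ k := fun j => (g (X j) : A)
    let z : Fin s → MvPolynomial σ k := fun j => y j - C (eval x (y j))
    have hmin : RingHom.ker (eval x) ∈ (Ideal.span (Set.range z)).minimalPrimes := by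
      refine ⟨⟨RingHom.ker_isPrime _, ?_⟩, ?_⟩
      · rw [Ideal.span_le]
        rintro _ ⟨j, rfl⟩
        simp [z]
      · rintro P ⟨hP, hzP⟩ hPx
        refine (eq_ker_eval_of_finite x b hb P hPx (hfin.subset ?_)).ge
        rintro w ⟨hbw, hw⟩
        refine ⟨hbw, fun t => ?_⟩
        suffices hmem : ψ t - C (eval x (ψ t)) ∈ P by
          simpa [sub_eq_zero] using hw _ hmem
        by_contra hnot
        let PA : Ideal A := P.comap A.val
        let mA : Ideal A := (RingHom.ker (eval x)).comap A.val
        have hle : PA ≤ mA := Ideal.comap_mono hPx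
        let a : A := ψA t - algebraMap k A (eval x (ψ t))
        let : Algebra (MvPolynomial (Fin s) k) A := g.toRingHom.toAlgebra
        -- Incomparability: `PA` and `mA` contract to the same ideal of the Noether normalization,
        -- namely that of the values of `y` at `x`, so they cannot be strictly nested. Hence `P`
        -- contains every `ψ t - ψ t (x)`.
        have hlt := Ideal.comap_lt_comap_of_integral_mem_sdiff
          (R := MvPolynomial (Fin s) k) (I := PA) (J := mA) hle (x := a)
          ⟨by simp [a, mA, ψA], by
            simpa [a, PA, ψA, Ideal.mem_comap, MvPolynomial.algebraMap_eq] using hnot⟩ (hgint a)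
        refine hlt.not_ge ?_
        intro f hf
        have hf' : eval x (g f : MvPolynomial σ k) = 0 := hf
        change (g f : MvPolynomial σ k) ∈ P
        have h1 : (g f : MvPolynomial σ k) = aeval y f := by
          have : A.val.comp g = aeval y := by ext j; simp [y]
          simpa using DFunLike.congr_fun this f
        have h2 : (Ideal.Quotient.mkₐ k P).comp (aeval y) =
            (Algebra.ofId k _).comp (aeval fun j => eval x (y j)) := by
          ext j
          simp only [AlgHom.comp_apply, aeval_X, Ideal.Quotient.mkₐ_eq_mk]
          have : Ideal.Quotient.mk P (y j) = Ideal.Quotient.mk P (C (eval x (y j))) :=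
            Ideal.Quotient.eq.2 (hzP (Ideal.subset_span ⟨j, rfl⟩))
          rw [this]; rfl
        have h3 : eval x (aeval y f) = aeval (fun j => eval x (y j)) f := by
          have : (aeval x : MvPolynomial σ k →ₐ[k] k).comp (aeval y) =
              aeval fun j => eval x (y j) := by
            ext j; simp [aeval_eq_eval]
          simpa [aeval_eq_eval] using DFunLike.congr_fun this f
        have h4 := DFunLike.congr_fun h2 f
        rw [AlgHom.comp_apply, AlgHom.comp_apply, ← h3, ← h1, hf', map_zero] at h4
        exact Ideal.Quotient.eq_zero_iff_mem.1 h4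
    have hle := Ideal.height_le_card_of_mem_minimalPrimes_span (Set.finite_range z) hmin
    rw [height_ker_eval, ← hcard] at hle
    have h1 : (Set.range z).ncard ≤ s := by
      rw [← Set.image_univ]
      exact (Set.ncard_image_le Set.finite_univ).trans (by simp [Set.ncard_univ])
    have : Nat.card τ ≤ (Set.range z).ncard := by exact_mod_cast hle
    omega
  · have : Algebra.IsAlgebraic (Algebra.adjoin k (Set.range ψA)) A :=
      ⟨fun a => isAlgebraic_algebraMap (⟨a, by rw [htop]; trivial⟩ :
        Algebra.adjoin k (Set.range ψA))⟩
    have hind : AlgebraicIndependent k (fun j => g (X j)) := by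
      have h : aeval (fun j => g (X j)) = g := by ext j; simp
      unfold AlgebraicIndependent
      rw [h]; exact hginj
    have hle := hind.lift_cardinalMk_le_trdeg
    have hbasis := Algebra.IsAlgebraic.isTranscendenceBasis_of_lift_le_trdeg_of_finite k ψA (by
      refine le_trans ?_ (Cardinal.lift_le.2 (by simpa using hle))
      have := Fintype.ofFinite τ
      simpa using hs)
    exact hbasis.1.map' (f := A.val) Subtype.val_injective

theorem isAlgebraic_of_card_eq [Finite σ] [Finite τ] (hcard : Nat.card τ = Nat.card σ)
    {ψ : τ → MvPolynomial σ k} (hψ : AlgebraicIndependent k ψ) :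
    letI := (aeval ψ : MvPolynomial τ k →ₐ[k] MvPolynomial σ k).toRingHom.toAlgebra
    Algebra.IsAlgebraic (MvPolynomial τ k) (MvPolynomial σ k) := by
  let := (aeval ψ : MvPolynomial τ k →ₐ[k] MvPolynomial σ k).toRingHom.toAlgebra
  have hb : IsTranscendenceBasis k ψ := hψ.isTranscendenceBasis_of_lift_trdeg_le_of_finite (by
    have := Fintype.ofFinite σ
    have := Fintype.ofFinite τ
    simp only [Nat.card_eq_fintype_card] at hcard
    rw [trdeg_of_isDomain]
    simp [hcard])
  have halg := hb.isAlgebraic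
  constructor
  intro f
  obtain ⟨p, hp, hpf⟩ := halg.1 f
  let e : MvPolynomial τ k ≃ₐ[k] Algebra.adjoin k (Set.range ψ) := hψ.aevalEquiv
  refine ⟨p.map e.symm.toRingHom, ?_, ?_⟩
  · rwa [Ne, Polynomial.map_eq_zero_iff (f := e.symm.toRingHom) e.symm.injective]
  · rw [Polynomial.aeval_def, Polynomial.eval₂_map, ← hpf, Polynomial.aeval_def]
    congr 1
    ext1 a
    obtain ⟨c, rfl⟩ := e.surjective a
    change aeval ψ (e.symm (e c)) = ((e c : Algebra.adjoin k (Set.range ψ)) : MvPolynomial σ k)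
    simp [e]

/-- As `f` is algebraic over the subalgebra generated by `ψ`, it divides the nonzero constant term
of a suitable relation. -/
theorem exists_dvd_aeval [Finite σ] [Finite τ] (hcard : Nat.card τ = Nat.card σ)
    {ψ : τ → MvPolynomial σ k} (hψ : AlgebraicIndependent k ψ) {f : MvPolynomial σ k} (hf : f ≠ 0) :
    ∃ a : MvPolynomial τ k, a ≠ 0 ∧ f ∣ aeval ψ a := by
  let := (aeval ψ : MvPolynomial τ k →ₐ[k] MvPolynomial σ k).toRingHom.toAlgebra
  have halg := isAlgebraic_of_card_eq hcard hψ
  exact (halg.1 f).exists_nonzero_dvd (mem_nonZeroDivisors_of_ne_zero hf)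

theorem eval_aeval_eq {ψ : τ → MvPolynomial σ k} (z : σ → k) (a : MvPolynomial τ k) :
    eval z (aeval ψ a) = eval (fun t => eval z (ψ t)) a := by
  have : (aeval z : MvPolynomial σ k →ₐ[k] k).comp (aeval ψ) = aeval fun t => eval z (ψ t) := by
    ext j; simp [aeval_eq_eval]
  simpa [aeval_eq_eval] using DFunLike.congr_fun this a

/-- The image of a hypersurface under a polynomial map between affine spaces of the same
dimension is not dense. -/
theorem exists_eval_eq_zero_of_eval_eq_zero [Finite σ] [Finite τ]
    (hcard : Nat.card τ = Nat.card σ) (ψ : τ → MvPolynomial σ k) {f : MvPolynomial σ k}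
    (hf : f ≠ 0) : ∃ a : MvPolynomial τ k, a ≠ 0 ∧
      ∀ z : σ → k, eval z f = 0 → eval (fun t => eval z (ψ t)) a = 0 := by
  by_cases hψ : AlgebraicIndependent k ψ
  -- In the independent case a multiple of `f` comes from the target. In the dependent case below, a
  -- relation among the components contains the whole image.
  · obtain ⟨a, ha, c, hc⟩ := exists_dvd_aeval hcard hψ hf
    refine ⟨a, ha, fun z hz => ?_⟩
    rw [← eval_aeval_eq, hc, map_mul, hz, zero_mul]
  · rw [algebraicIndependent_iff] at hψ
    push Not at hψ
    obtain ⟨a, ha, ha0⟩ := hψ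
    refine ⟨a, ha0, fun z _ => ?_⟩
    rw [← eval_aeval_eq, ha, map_zero]

/-- A dominant polynomial map between affine spaces of the same dimension, restricted to the
complement of a hypersurface, attains every value off some hypersurface. -/
theorem exists_preimage_of_algebraicIndependent [IsAlgClosed k] [Finite σ] [Finite τ]
    (hcard : Nat.card τ = Nat.card σ) {ψ : τ → MvPolynomial σ k} (hψ : AlgebraicIndependent k ψ)
    {b : MvPolynomial σ k} (hb : b ≠ 0) : ∃ a : MvPolynomial τ k, a ≠ 0 ∧
      ∀ y : τ → k, eval y a ≠ 0 → ∃ z : σ → k, (∀ t, eval z (ψ t) = y t) ∧ eval z b ≠ 0 := by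
  classical
  let := (aeval ψ : MvPolynomial τ k →ₐ[k] MvPolynomial σ k).toRingHom.toAlgebra
  have halg := isAlgebraic_of_card_eq hcard hψ
  have hmap : ∀ c, algebraMap (MvPolynomial τ k) (MvPolynomial σ k) c = aeval ψ c := fun _ => rfl
  -- Off `a₁` no preimage can lie on `b = 0`. Off `a₂`, a common denominator of the variables, the
  -- map is integral, so lying over produces preimages.
  obtain ⟨a₁, ha₁, hdvd⟩ := exists_dvd_aeval hcard hψ hb
  have := Fintype.ofFinite σ
  obtain ⟨a₂, ha₂, hint⟩ := Algebra.IsAlgebraic.exists_integral_multiples (MvPolynomial τ k)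
    (Finset.univ.image (X : σ → MvPolynomial σ k))
  have hint' : ∀ s, IsIntegral (MvPolynomial τ k) (aeval ψ a₂ * X s : MvPolynomial σ k) := by
    intro s
    have := hint (X s) (by simp)
    rwa [Algebra.smul_def, hmap] at this
  have hclear : ∀ f : MvPolynomial σ k, ∃ d : ℕ,
      IsIntegral (MvPolynomial τ k) (aeval ψ a₂ ^ d * f) := by
    have hA : ∀ c : MvPolynomial τ k, IsIntegral (MvPolynomial τ k) (aeval ψ c) :=
      fun c => isIntegral_algebraMap (A := MvPolynomial σ k) (x := c)
    have hmono : ∀ (f : MvPolynomial σ k) (d e : ℕ), d ≤ e →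
        IsIntegral (MvPolynomial τ k) (aeval ψ a₂ ^ d * f) →
        IsIntegral (MvPolynomial τ k) (aeval ψ a₂ ^ e * f) := by
      intro f d e hde h
      obtain ⟨m, rfl⟩ := Nat.exists_eq_add_of_le hde
      rw [pow_add, mul_comm (_ ^ d), mul_assoc]
      exact ((hA a₂).pow m).mul h
    intro f
    induction f using MvPolynomial.induction_on with
    | C c =>
      refine ⟨0, ?_⟩
      have := hA (C c)
      simpa [MvPolynomial.algebraMap_eq] using this
    | add f g hf hg =>
      obtain ⟨d, hd⟩ := hf
      obtain ⟨e, he⟩ := hg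
      refine ⟨max d e, ?_⟩
      rw [mul_add]
      exact (hmono f d _ (le_max_left _ _) hd).add (hmono g e _ (le_max_right _ _) he)
    | mul_X f s hf =>
      obtain ⟨d, hd⟩ := hf
      refine ⟨d + 1, ?_⟩
      have := hd.mul (hint' s)
      rwa [show aeval ψ a₂ ^ d * f * (aeval ψ a₂ * X s) = aeval ψ a₂ ^ (d + 1) * (f * X s) by ring]
        at this
  refine ⟨a₁ * a₂, mul_ne_zero ha₁ ha₂, fun y hy => ?_⟩
  rw [map_mul] at hy
  have hy₁ := left_ne_zero_of_mul hy
  have hy₂ := right_ne_zero_of_mul hy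
  let B := integralClosure (MvPolynomial τ k) (MvPolynomial σ k)
  let m : Ideal (MvPolynomial τ k) := RingHom.ker (eval y)
  have hm : m.IsMaximal := RingHom.ker_isMaximal_of_surjective _ fun c => ⟨C c, by simp⟩
  obtain ⟨Q, hQ, hQm⟩ := Ideal.exists_ideal_over_maximal_of_isIntegral (S := B) m (by
    intro f hf
    have h1 : aeval ψ f = 0 := congrArg Subtype.val hf
    have h2 : f = 0 := hψ (by rw [h1, map_zero])
    rw [h2]; exact m.zero_mem)
  have hnot : ∀ N : ℕ,
      aeval ψ a₂ ^ N ∉ m.map (algebraMap (MvPolynomial τ k) (MvPolynomial σ k)) := by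
    intro N hN
    -- Only the integral closure `B` has a prime `Q` over `m`. High powers of `a₂` carry the
    -- extension of `m` to the full polynomial ring into `Q`. A power of `a₂` in that extension
    -- would therefore give a power of `a₂` in `m`, against `a₂(y) ≠ 0`.
    have key : ∀ f ∈ m.map (algebraMap (MvPolynomial τ k) (MvPolynomial σ k)),
        ∃ d : ℕ, ∀ e, d ≤ e → ∃ q ∈ Q, (q : MvPolynomial σ k) = aeval ψ a₂ ^ e * f := by
      intro f hf
      refine Submodule.span_induction ?_ ?_ ?_ ?_ hf
      · rintro _ ⟨c, hc, rfl⟩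
        refine ⟨0, fun e _ => ⟨algebraMap _ B (a₂ ^ e * c), ?_, ?_⟩⟩
        · have : a₂ ^ e * c ∈ Q.comap (algebraMap (MvPolynomial τ k) B) := by
            rw [hQm]; exact m.mul_mem_left _ hc
          exact this
        · change aeval ψ (a₂ ^ e * c) = _
          simp [hmap]
      · exact ⟨0, fun e _ => ⟨0, Q.zero_mem, by simp⟩⟩
      · rintro f g _ _ ⟨d, hd⟩ ⟨d', hd'⟩
        refine ⟨max d d', fun e he => ?_⟩
        obtain ⟨q, hq, hqe⟩ := hd e (le_trans (le_max_left _ _) he)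
        obtain ⟨q', hq', hqe'⟩ := hd' e (le_trans (le_max_right _ _) he)
        exact ⟨q + q', Q.add_mem hq hq', by rw [mul_add, ← hqe, ← hqe']; rfl⟩
      · rintro r f _ ⟨d, hd⟩
        obtain ⟨d', hd'⟩ := hclear r
        refine ⟨d + d', fun e he => ?_⟩
        obtain ⟨q, hq, hqe⟩ := hd (e - d') (by omega)
        refine ⟨⟨_, hd'⟩ * q, Q.mul_mem_left _ hq, ?_⟩
        change (aeval ψ a₂ ^ d' * r) * (q : MvPolynomial σ k) = _
        rw [hqe, smul_eq_mul]
        obtain ⟨c, rfl⟩ : ∃ c, e = d' + c := ⟨e - d', by omega⟩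
        rw [Nat.add_sub_cancel_left, pow_add]
        ring
    obtain ⟨d, hd⟩ := key _ hN
    obtain ⟨q, hq, hqd⟩ := hd d le_rfl
    have hq' : q = algebraMap (MvPolynomial τ k) B (a₂ ^ (d + N)) := by
      apply Subtype.ext
      rw [hqd]
      change _ = aeval ψ (a₂ ^ (d + N))
      rw [map_pow, pow_add]
    have : a₂ ^ (d + N) ∈ Q.comap (algebraMap (MvPolynomial τ k) B) := by
      rw [Ideal.mem_comap, ← hq']; exact hq
    rw [hQm, RingHom.mem_ker, map_pow] at this
    exact hy₂ (eq_zero_of_pow_eq_zero this)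
  have hrad : aeval ψ a₂ ∉ vanishingIdeal k (zeroLocus k
      (m.map (algebraMap (MvPolynomial τ k) (MvPolynomial σ k)))) := by
    rw [vanishingIdeal_zeroLocus_eq_radical]
    rintro ⟨N, hN⟩
    exact hnot N hN
  rw [mem_vanishingIdeal_iff] at hrad
  push Not at hrad
  obtain ⟨z, hz, -⟩ := hrad
  have hzy : ∀ t, eval z (ψ t) = y t := by
    intro t
    have := hz (aeval ψ (X t - C (y t))) (Ideal.mem_map_of_mem _ (by simp [m]))
    simpa [aeval_eq_eval, sub_eq_zero] using this
  refine ⟨z, hzy, fun h0 => hy₁ ?_⟩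
  obtain ⟨c, hc⟩ := hdvd
  have := eval_aeval_eq (ψ := ψ) z a₁
  rw [hc, map_mul, h0, zero_mul] at this
  rw [funext hzy] at this
  exact this.symm

end PolynomialMaps

/-! ### Restriction to coordinate slices. -/

section Slices

variable {k : Type*} {σ τ : Type*} (S : Set σ) (t : σ → k)

open scoped Classical in
/-- The point of the slice `{z | ∀ s ∈ S, z s = t s}` with the given remaining coordinates. -/
noncomputable def sliceExtend (z : {s // s ∉ S} → k) (s : σ) : k :=
  if h : s ∈ S then t s else z ⟨s, h⟩

theorem sliceExtend_mem (z : {s // s ∉ S} → k) {s : σ} (hs : s ∈ S) :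
    sliceExtend S t z s = t s := by
  simp [sliceExtend, hs]

theorem sliceExtend_restrict {x : σ → k} (hx : ∀ s ∈ S, x s = t s) :
    sliceExtend S t (fun s => x s) = x := by
  ext s
  by_cases h : s ∈ S <;> simp [sliceExtend, h, hx]

theorem sliceExtend_injective : Function.Injective (sliceExtend S t) := by
  intro z w h
  ext s
  have := congrFun h s
  simpa [sliceExtend, s.2] using this

variable [Field k]

open scoped Classical in
/-- The restriction of polynomials to the slice `{z | ∀ s ∈ S, z s = t s}`. -/
noncomputable def sliceHom : MvPolynomial σ k →ₐ[k] MvPolynomial {s // s ∉ S} k :=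
  aeval fun s => if h : s ∈ S then C (t s) else X ⟨s, h⟩

theorem eval_sliceHom (z : {s // s ∉ S} → k) (f : MvPolynomial σ k) :
    eval z (sliceHom S t f) = eval (sliceExtend S t z) f := by
  have : (aeval z : MvPolynomial _ k →ₐ[k] k).comp (sliceHom S t) = aeval (sliceExtend S t z) := by
    ext s
    by_cases h : s ∈ S <;> simp [sliceHom, sliceExtend, h, aeval_eq_eval]
  simpa [aeval_eq_eval] using DFunLike.congr_fun this f

theorem card_slice {σ : Type*} (S : Set σ) [Finite σ] {N : ℕ} (h : Nat.card S + N = Nat.card σ) :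
    N = Nat.card {s // s ∉ S} := by
  have h1 : S.ncard + Sᶜ.ncard = Nat.card σ := Set.ncard_add_ncard_compl S
  have h2 : Nat.card {s // s ∉ S} = Sᶜ.ncard := rfl
  have h3 : Nat.card S = S.ncard := rfl
  omega

variable {S t}

theorem exists_preimage_in_slice [IsAlgClosed k] [Finite σ] [Finite τ]
    (hcard : Nat.card S + Nat.card τ = Nat.card σ) (ψ : τ → MvPolynomial σ k)
    (b : MvPolynomial σ k) (x : σ → k) (hx : ∀ s ∈ S, x s = t s) (hb : eval x b ≠ 0)
    (hfin : {z : σ → k | (∀ s ∈ S, z s = t s) ∧ eval z b ≠ 0 ∧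
      ∀ i, eval z (ψ i) = eval x (ψ i)}.Finite) :
    ∃ a : MvPolynomial τ k, a ≠ 0 ∧ ∀ y : τ → k, eval y a ≠ 0 →
      ∃ z : σ → k, (∀ s ∈ S, z s = t s) ∧ (∀ i, eval z (ψ i) = y i) ∧ eval z b ≠ 0 := by
  have hcard' := card_slice S hcard
  have hb' : eval (fun s : {s // s ∉ S} => x s) (sliceHom S t b) ≠ 0 := by
    rwa [eval_sliceHom, sliceExtend_restrict S t hx]
  have hind : AlgebraicIndependent k fun i => sliceHom S t (ψ i) := by
    refine algebraicIndependent_of_finite_fiber hcard' _ (sliceHom S t b)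
      (fun s => x s) hb' ?_
    refine Set.Finite.of_finite_image (f := sliceExtend S t) (hfin.subset ?_)
      (sliceExtend_injective S t).injOn
    rintro _ ⟨z, ⟨hz1, hz2⟩, rfl⟩
    simp only [eval_sliceHom, sliceExtend_restrict S t hx] at hz1 hz2
    exact ⟨fun s hs => sliceExtend_mem S t z hs, hz1, hz2⟩
  obtain ⟨a, ha, h⟩ := exists_preimage_of_algebraicIndependent hcard' hind
    (b := sliceHom S t b) (by rintro h; simp [h] at hb')
  refine ⟨a, ha, fun y hy => ?_⟩
  obtain ⟨z, hz1, hz2⟩ := h y hy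
  simp only [eval_sliceHom] at hz1 hz2
  exact ⟨_, fun s hs => sliceExtend_mem S t z hs, hz1, hz2⟩

/-- The point `x` serves only to show that `f` does not vanish identically on the slice. -/
theorem exists_eval_eq_zero_on_slice [Finite σ] [Finite τ]
    (hcard : Nat.card S + Nat.card τ = Nat.card σ) (ψ : τ → MvPolynomial σ k)
    (f : MvPolynomial σ k) (x : σ → k) (hx : ∀ s ∈ S, x s = t s) (hf : eval x f ≠ 0) :
    ∃ a : MvPolynomial τ k, a ≠ 0 ∧ ∀ z : σ → k, (∀ s ∈ S, z s = t s) → eval z f = 0 →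
      eval (fun i => eval z (ψ i)) a = 0 := by
  have hcard' := card_slice S hcard
  obtain ⟨a, ha, h⟩ := exists_eval_eq_zero_of_eval_eq_zero hcard' (fun i => sliceHom S t (ψ i))
    (f := sliceHom S t f) (by
      intro h
      have := eval_sliceHom S t (fun s => x s) f
      rw [h, sliceExtend_restrict S t hx, map_zero] at this
      exact hf this.symm)
  refine ⟨a, ha, fun z hz hz0 => ?_⟩
  have := h (fun s => z s)
  simp only [eval_sliceHom, sliceExtend_restrict S t hz] at this
  exact this hz0

end Slices

/-! ### Binary forms and the affine Veronese map. -/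

section BinaryForms

/-- The exponent of the monomial `s ^ k * t ^ (n - k)`. -/
noncomputable def binExp (n k : ℕ) : Fin 2 →₀ ℕ := Finsupp.single 0 k + Finsupp.single 1 (n - k)

@[simp] theorem binExp_zero (n k : ℕ) : binExp n k 0 = k := by simp [binExp]

@[simp] theorem binExp_one (n k : ℕ) : binExp n k 1 = n - k := by simp [binExp]

theorem degree_fin_two (d : Fin 2 →₀ ℕ) : d.degree = d 0 + d 1 := by
  rw [Finsupp.degree_eq_sum, Fin.sum_univ_two]

theorem eq_binExp {n : ℕ} {d : Fin 2 →₀ ℕ} (hd : d.degree = n) : d = binExp n (d 0) := by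
  rw [degree_fin_two] at hd
  ext i
  fin_cases i
  · simp
  · simp; omega

/-- The coefficients of a binary form of degree `n`. -/
noncomputable def formCoeff {R : Type*} [CommSemiring R] (n : ℕ) (F : MvPolynomial (Fin 2) R)
    (k : Fin (n + 1)) : R :=
  coeff (binExp n k) F

/-- The values of the monomials of degree `n`: the affine Veronese map. -/
def ver {R : Type*} [CommSemiring R] (n : ℕ) (u : Fin 2 → R) (k : Fin (n + 1)) : R :=
  u 0 ^ (k : ℕ) * u 1 ^ (n - k)

/-- The binary form with given coefficients. -/
noncomputable def binForm {R : Type*} [CommSemiring R] {n : ℕ} (c : Fin (n + 1) → R) :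
    MvPolynomial (Fin 2) R :=
  ∑ k : Fin (n + 1), monomial (binExp n k) (c k)

variable {R : Type*} [CommRing R] {n : ℕ}

theorem isHomogeneous_binForm (c : Fin (n + 1) → R) : (binForm c).IsHomogeneous n := by
  refine IsHomogeneous.sum _ _ _ fun k _ => isHomogeneous_monomial _ ?_
  rw [degree_fin_two]
  have := k.2
  simp; omega

theorem formCoeff_binForm (c : Fin (n + 1) → R) : formCoeff n (binForm c) = c := by
  classical
  ext k
  rw [formCoeff, binForm, coeff_sum, Finset.sum_eq_single k]
  · simp
  · intro j _ hj
    rw [coeff_monomial, if_neg]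
    intro h
    have := DFunLike.congr_fun h 0
    simp only [binExp_zero] at this
    exact hj (Fin.ext this)
  · simp

theorem binForm_formCoeff {F : MvPolynomial (Fin 2) R} (hF : F.IsHomogeneous n) :
    binForm (formCoeff n F) = F := by
  classical
  ext d
  by_cases hd : d.degree = n
  · have hk : d 0 < n + 1 := by rw [degree_fin_two] at hd; omega
    have h := congrFun (formCoeff_binForm (formCoeff n F)) ⟨d 0, hk⟩
    simp only [formCoeff] at h
    rw [← eq_binExp hd] at h
    exact h
  · rw [hF.coeff_eq_zero hd, (isHomogeneous_binForm _).coeff_eq_zero hd]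

theorem eval_binForm (c : Fin (n + 1) → R) (u : Fin 2 → R) :
    eval u (binForm c) = c ⬝ᵥ ver n u := by
  rw [binForm, map_sum, dotProduct]
  refine Finset.sum_congr rfl fun k _ => ?_
  rw [eval_monomial, Finsupp.prod_fintype _ _ (by simp), Fin.prod_univ_two]
  simp [ver]

theorem eval_eq_formCoeff {F : MvPolynomial (Fin 2) R} (hF : F.IsHomogeneous n) (u : Fin 2 → R) :
    eval u F = formCoeff n F ⬝ᵥ ver n u := by
  rw [← eval_binForm, binForm_formCoeff hF]

theorem eq_of_dotProduct_ver {c d : Fin (n + 1) → ℂ} (h : ∀ u, c ⬝ᵥ ver n u = d ⬝ᵥ ver n u) :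
    c = d := by
  rw [← formCoeff_binForm c, ← formCoeff_binForm d]
  congr 1
  exact MvPolynomial.funext fun u => by rw [eval_binForm, eval_binForm, h]

theorem eq_of_mulVec_ver {m : Type*} {A B : Matrix m (Fin (n + 1)) ℂ}
    (h : ∀ u, A.mulVec (ver n u) = B.mulVec (ver n u)) : A = B := by
  ext i j
  exact congrFun (eq_of_dotProduct_ver (c := A i) (d := B i) fun u => congrFun (h u) i) j

/-- Binary forms of degree `n` correspond to their coefficients. -/
noncomputable def binFormEquiv (n : ℕ) : (Fin (n + 1) → ℂ) ≃ₗ[ℂ] BinaryForm n where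
  toFun c := ⟨binForm c, isHomogeneous_binForm c⟩
  invFun F := formCoeff n F.1
  map_add' c d := Subtype.ext (by simp [binForm, Finset.sum_add_distrib])
  map_smul' a c := Subtype.ext (by simp [binForm, Finset.smul_sum, smul_monomial])
  left_inv c := formCoeff_binForm c
  right_inv F := Subtype.ext (binForm_formCoeff F.2)

theorem finrank_binaryForm (n : ℕ) : Module.finrank ℂ (BinaryForm n) = n + 1 := by
  rw [← (binFormEquiv n).finrank_eq]; simp

instance (n : ℕ) : FiniteDimensional ℂ (BinaryForm n) :=
  (binFormEquiv n).finiteDimensional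

theorem ver_smul (c : R) (u : Fin 2 → R) : ver n (c • u) = c ^ n • ver n u := by
  ext k
  obtain ⟨k, hk⟩ := k
  have : c ^ n = c ^ k * c ^ (n - k) := by rw [← pow_add]; congr 1; omega
  simp only [ver, Pi.smul_apply, smul_eq_mul, this]
  ring

theorem ver_ne_zero {u : Fin 2 → ℂ} (hu : u ≠ 0) : ver n u ≠ 0 := by
  intro h
  have h0 : u 1 ^ n = 0 := by simpa [ver] using congrFun h 0
  have h1 : u 0 ^ n = 0 := by simpa [ver] using congrFun h (Fin.last n)
  have h2 := eq_zero_of_pow_eq_zero h0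
  have h3 := eq_zero_of_pow_eq_zero h1
  exact hu (by ext i; fin_cases i <;> simp [h2, h3])

/-- The Veronese map is injective on the projective line. -/
theorem det_eq_zero_of_ver_eq_smul (hn : 1 ≤ n) {u v : Fin 2 → ℂ} (hu : u ≠ 0) {c : ℂ}
    (h : ver n u = c • ver n v) : u 0 * v 1 = u 1 * v 0 := by
  have hc : c ≠ 0 := by
    rintro rfl
    exact ver_ne_zero hu (by simpa using h)
  have h1 : u 0 ^ n = c * v 0 ^ n := by simpa [ver] using congrFun h (Fin.last n)
  have h2 : u 0 ^ (n - 1) * u 1 = c * (v 0 ^ (n - 1) * v 1) := by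
    have := congrFun h ⟨n - 1, by omega⟩
    simpa [ver, show n - (n - 1) = 1 by omega] using this
  obtain ⟨m, rfl⟩ : ∃ m, n = m + 1 := ⟨n - 1, by omega⟩
  simp only [Nat.add_sub_cancel, pow_succ] at h1 h2
  by_cases hu0 : u 0 = 0
  · have : v 0 = 0 := by
      rw [hu0, mul_zero] at h1
      have := (mul_eq_zero.1 h1.symm).resolve_left hc
      rw [← pow_succ] at this
      exact eq_zero_of_pow_eq_zero this
    simp [hu0, this]
  · have hm : u 0 ^ m ≠ 0 := pow_ne_zero _ hu0
    have hv : c * v 0 ^ m * u 0 ^ m ≠ 0 := by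
      refine mul_ne_zero ?_ hm
      intro h0
      have : u 0 ^ m * u 0 = 0 := by rw [h1, ← mul_assoc, h0, zero_mul]
      exact mul_ne_zero hm hu0 this
    -- The two top coordinates of the Veronese vector, `u₀ⁿ` and `u₀ⁿ⁻¹u₁`, already determine the
    -- ratio `u₁ / u₀`.
    apply mul_left_cancel₀ hv
    linear_combination (c * v 0 ^ m * v 1) * h1 - (c * v 0 ^ m * v 0) * h2

theorem isHomogeneous_linear (a b : R) :
    (C a * X 0 + C b * X 1 : MvPolynomial (Fin 2) R).IsHomogeneous 1 :=
  (isHomogeneous_C_mul_X a 0).add (isHomogeneous_C_mul_X b 1)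

/-- Linear substitutions act linearly on the monomials of degree `n`. -/
theorem exists_mulVec_ver (γ : Matrix (Fin 2) (Fin 2) ℂ) :
    ∃ S : Matrix (Fin (n + 1)) (Fin (n + 1)) ℂ,
      ∀ u, S.mulVec (ver n u) = ver n (γ.mulVec u) := by
  let ℓ : Fin 2 → MvPolynomial (Fin 2) ℂ := fun i => C (γ i 0) * X 0 + C (γ i 1) * X 1
  refine ⟨Matrix.of fun k => formCoeff n (ℓ 0 ^ (k : ℕ) * ℓ 1 ^ (n - k)), fun u => ?_⟩
  ext k
  have hℓ : ∀ i, (ℓ i).IsHomogeneous 1 := fun i => isHomogeneous_linear _ _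
  have h : (ℓ 0 ^ (k : ℕ) * ℓ 1 ^ (n - k)).IsHomogeneous n := by
    have := ((hℓ 0).pow k).mul ((hℓ 1).pow (n - k))
    have hk := k.2
    rwa [show 1 * (k : ℕ) + 1 * (n - k) = n by omega] at this
  have he := eval_eq_formCoeff h u
  simp only [Matrix.mulVec, Matrix.of_apply, ← he]
  simp [ℓ, ver]

/-- A divisor of a nonzero homogeneous polynomial is homogeneous. -/
theorem isHomogeneous_of_mul {σ k : Type*} [Field k] {P Q : MvPolynomial σ k} {n : ℕ}
    (h : (P * Q).IsHomogeneous n) (h0 : P * Q ≠ 0) : P.IsHomogeneous P.totalDegree := by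
  -- Scaling every variable by a new variable turns homogeneous components into coefficients. Degree
  -- and trailing degree in it are additive and agree on the product, so they agree on each factor.
  let Φ : MvPolynomial σ k →ₐ[k] Polynomial (MvPolynomial σ k) :=
    aeval fun s => Polynomial.C (X s) * Polynomial.X
  have hmon : ∀ (d : σ →₀ ℕ) (c : k),
      Φ (monomial d c) = Polynomial.C (monomial d c) * Polynomial.X ^ d.degree := by
    intro d c
    have h1 : algebraMap k (Polynomial (MvPolynomial σ k)) c = Polynomial.C (C c) := rfl
    have h2 : (d.prod fun s e => (Polynomial.C (X s) * Polynomial.X : Polynomial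
        (MvPolynomial σ k)) ^ e) = Polynomial.C (d.prod fun s e => X s ^ e) *
          Polynomial.X ^ d.degree := by
      simp only [Finsupp.prod, mul_pow, Finset.prod_mul_distrib, map_prod, map_pow]
      rw [Finset.prod_pow_eq_pow_sum]
      rfl
    rw [aeval_monomial, h1, h2, monomial_eq, Polynomial.C_mul, mul_assoc]
  have hcoeff : ∀ (F : MvPolynomial σ k) (m : ℕ), (Φ F).coeff m = homogeneousComponent m F := by
    intro F m
    induction F using MvPolynomial.induction_on' with
    | monomial d c =>
      rw [hmon, Polynomial.coeff_C_mul, Polynomial.coeff_X_pow]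
      rw [homogeneousComponent_of_mem (n := d.degree) (isHomogeneous_monomial c rfl)]
      split_ifs <;> simp
    | add F G hF hG => simp [hF, hG]
  have hP : P ≠ 0 := left_ne_zero_of_mul h0
  have hQ : Q ≠ 0 := right_ne_zero_of_mul h0
  have hinj : ∀ F, F ≠ 0 → Φ F ≠ 0 := by
    intro F hF hΦ
    apply hF
    rw [← sum_homogeneousComponent F]
    refine Finset.sum_eq_zero fun m _ => ?_
    rw [← hcoeff, hΦ, Polynomial.coeff_zero]
  have hprod : Φ P * Φ Q = Polynomial.monomial n (P * Q) := by
    rw [← map_mul]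
    ext1 m
    rw [hcoeff, homogeneousComponent_of_mem h, Polynomial.coeff_monomial]
    simp [eq_comm]
  have h1 : (Φ P).natDegree + (Φ Q).natDegree = n := by
    rw [← Polynomial.natDegree_mul (hinj P hP) (hinj Q hQ), hprod,
      Polynomial.natDegree_monomial_eq _ h0]
  have h2 : (Φ P).natTrailingDegree + (Φ Q).natTrailingDegree = n := by
    rw [← Polynomial.natTrailingDegree_mul (hinj P hP) (hinj Q hQ), hprod,
      Polynomial.natTrailingDegree_monomial h0]
  have h3 := Polynomial.natTrailingDegree_le_natDegree (Φ P)
  have h4 := Polynomial.natTrailingDegree_le_natDegree (Φ Q)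
  have hhom : P.IsHomogeneous (Φ P).natDegree := by
    have : P = homogeneousComponent (Φ P).natDegree P := by
      conv_lhs => rw [← sum_homogeneousComponent P]
      have hz : ∀ m, m ≠ (Φ P).natDegree → homogeneousComponent m P = 0 := by
        intro m hm
        rw [← hcoeff]
        rcases lt_or_gt_of_ne hm with hm | hm
        · exact Polynomial.coeff_eq_zero_of_lt_natTrailingDegree (by omega)
        · exact Polynomial.coeff_eq_zero_of_natDegree_lt hm
      by_cases hmem : (Φ P).natDegree ∈ Finset.range (P.totalDegree + 1)
      · exact Finset.sum_eq_single_of_mem _ hmem fun m _ hm => hz m hm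
      · rw [Finset.mem_range, not_lt, Nat.add_one_le_iff] at hmem
        have hzero : homogeneousComponent (Φ P).natDegree P = 0 := by
          apply homogeneousComponent_eq_zero
          exact hmem
        rw [hzero]
        exact Finset.sum_eq_zero fun m hm => hz m (by rw [Finset.mem_range] at hm; omega)
    have h5 : (homogeneousComponent (Φ P).natDegree P).IsHomogeneous (Φ P).natDegree :=
      homogeneousComponent_isHomogeneous _ _
    rwa [← this] at h5
  rwa [hhom.totalDegree hP]

/-- The linear form vanishing at `v`. -/
noncomputable def linForm (v : Fin 2 → R) : MvPolynomial (Fin 2) R := C (v 1) * X 0 - C (v 0) * X 1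

theorem isHomogeneous_linForm (v : Fin 2 → R) : (linForm v).IsHomogeneous 1 :=
  (isHomogeneous_C_mul_X _ 0).sub (isHomogeneous_C_mul_X _ 1)

theorem eval_linForm (v u : Fin 2 → R) : eval u (linForm v) = v 1 * u 0 - v 0 * u 1 := by
  simp [linForm]

/-- Modulo `linForm v` one has `v₁X₀ = v₀X₁`, hence `vᵢⁿ F = F(v) Xᵢⁿ = 0`, and some `vᵢ` is a unit.
-/
theorem linForm_dvd {F : MvPolynomial (Fin 2) ℂ} (hF : F.IsHomogeneous n) {v : Fin 2 → ℂ}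
    (hv : v ≠ 0) (h : eval v F = 0) : linForm v ∣ F := by
  let I := Ideal.span {linForm v}
  have hrel : Ideal.Quotient.mk I (C (v 1) * X 0) = Ideal.Quotient.mk I (C (v 0) * X 1) :=
    Ideal.Quotient.eq.2 (Ideal.mem_span_singleton_self _)
  rw [eval_eq_formCoeff hF] at h
  have key : ∀ i : Fin 2, C (v i) ^ n * F ∈ I := by
    intro i
    rw [← Ideal.Quotient.eq_zero_iff_mem, ← binForm_formCoeff hF, binForm, Finset.mul_sum, map_sum]
    have : ∀ k : Fin (n + 1), Ideal.Quotient.mk I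
        (C (v i) ^ n * monomial (binExp n k) (formCoeff n F k)) =
        Ideal.Quotient.mk I (X i ^ n * C (formCoeff n F k * ver n v k)) := by
      intro k
      have hk : n = k + (n - k) := by omega
      rw [monomial_eq, Finsupp.prod_fintype _ _ (by simp), Fin.prod_univ_two]
      have hpow : ∀ x : MvPolynomial (Fin 2) ℂ, x ^ n = x ^ (k : ℕ) * x ^ (n - k) := by
        intro x; rw [← pow_add, ← hk]
      rw [hpow (C (v i)), hpow (X i)]
      simp only [binExp_zero, binExp_one, ver, map_mul, map_pow]
      fin_cases i
      · simp only [Fin.zero_eta]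
        have := congrArg (· ^ (n - (k : ℕ))) hrel
        simp only [map_mul, mul_pow] at this
        linear_combination -(Ideal.Quotient.mk I (C (v 0)) ^ (k : ℕ) *
          Ideal.Quotient.mk I (C (formCoeff n F k)) * Ideal.Quotient.mk I (X 0) ^ (k : ℕ)) * this
      · simp only [Fin.mk_one]
        have := congrArg (· ^ (k : ℕ)) hrel
        simp only [map_mul, mul_pow] at this
        linear_combination (Ideal.Quotient.mk I (C (v 1)) ^ (n - (k : ℕ)) *
          Ideal.Quotient.mk I (C (formCoeff n F k)) * Ideal.Quotient.mk I (X 1) ^ (n - (k : ℕ))) *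
          this
    rw [Finset.sum_congr rfl fun k _ => this k, ← map_sum, ← Finset.mul_sum, ← map_sum]
    change Ideal.Quotient.mk I (X i ^ n * C (formCoeff n F ⬝ᵥ ver n v)) = 0
    rw [h, map_zero, mul_zero, map_zero]
  obtain ⟨i, hi⟩ := Function.ne_iff.1 hv
  have hu : IsUnit (C (v i) ^ n : MvPolynomial (Fin 2) ℂ) :=
    ((isUnit_iff_ne_zero.2 hi).map C).pow n
  exact Ideal.mem_span_singleton.1 ((Ideal.unit_mul_mem_iff_mem I hu).1 (key i))

/-- If `(1, 0)` is not a root, then `F(X, 1)` has nonzero coefficient `F(1, 0)` in degree `n`, so it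
is nonconstant and has a complex root. -/
theorem exists_root {F : MvPolynomial (Fin 2) ℂ} (hF : F.IsHomogeneous n) (hn : n ≠ 0) :
    ∃ v : Fin 2 → ℂ, v ≠ 0 ∧ eval v F = 0 := by
  by_cases h : eval ![1, 0] F = 0
  · exact ⟨![1, 0], fun h => one_ne_zero (congrFun h 0), h⟩
  · let p : Polynomial ℂ := aeval (![Polynomial.X, 1] : Fin 2 → Polynomial ℂ) F
    have hp : p = ∑ k : Fin (n + 1), Polynomial.monomial k (formCoeff n F k) := by
      simp only [p]
      conv_lhs => rw [← binForm_formCoeff hF, binForm, map_sum]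
      refine Finset.sum_congr rfl fun k _ => ?_
      rw [aeval_monomial, Finsupp.prod_fintype _ _ (by simp), Fin.prod_univ_two]
      simp [Polynomial.C_mul_X_pow_eq_monomial]
    have hpn : p.coeff n ≠ 0 := by
      rw [eval_eq_formCoeff hF, dotProduct, Fin.sum_univ_castSucc] at h
      rw [hp, Polynomial.finsetSum_coeff, Fin.sum_univ_castSucc]
      simp only [Polynomial.coeff_monomial, Fin.val_castSucc, Fin.val_last, if_true]
      rw [Finset.sum_eq_zero] at h ⊢
      · simpa [ver] using h
      · intro k _
        rw [if_neg k.2.ne]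
      · intro k _
        have := k.2
        simp [ver, show n - (k : ℕ) ≠ 0 by omega]
    obtain ⟨z, hz⟩ := IsAlgClosed.exists_root p (by
      intro hd
      have hd0 := Polynomial.natDegree_eq_of_degree_eq_some (n := 0) hd
      exact hn (Nat.le_zero.1 (hd0 ▸ Polynomial.le_natDegree_of_ne_zero hpn)))
    refine ⟨![z, 1], fun h => one_ne_zero (congrFun h 1), ?_⟩
    have : (Polynomial.aeval z).comp (aeval (![Polynomial.X, 1] : Fin 2 → Polynomial ℂ)) =
        (aeval ![z, 1] : MvPolynomial (Fin 2) ℂ →ₐ[ℂ] ℂ) := by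
      ext i; fin_cases i <;> simp
    have h2 := DFunLike.congr_fun this F
    rw [AlgHom.comp_apply, aeval_eq_eval] at h2
    rw [← show _ = eval ![z, 1] F from h2, Polynomial.coe_aeval_eq_eval]
    exact hz

theorem linForm_ne_zero {v : Fin 2 → ℂ} (hv : v ≠ 0) : linForm v ≠ 0 := by
  intro h
  apply hv
  have h1 := congrArg (eval ![1, 0]) h
  have h2 := congrArg (eval ![0, 1]) h
  rw [eval_linForm] at h1 h2
  ext i; fin_cases i
  · simpa using h2
  · simpa using h1

/-- Complex binary forms are products of linear forms. -/
theorem exists_eq_prod_linForm {F : MvPolynomial (Fin 2) ℂ} (hF : F.IsHomogeneous n)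
    (h0 : F ≠ 0) : ∃ (c : ℂ) (v : Fin n → Fin 2 → ℂ), (∀ k, v k ≠ 0) ∧
      F = C c * ∏ k, linForm (v k) := by
  induction n generalizing F with
  | zero =>
    rw [← totalDegree_zero_iff_isHomogeneous, totalDegree_eq_zero_iff_eq_C] at hF
    exact ⟨_, Fin.elim0, fun k => k.elim0, by simpa using hF⟩
  | succ n ih =>
    obtain ⟨v, hv, hv0⟩ := exists_root hF (Nat.succ_ne_zero n)
    obtain ⟨G, rfl⟩ := linForm_dvd hF hv hv0
    have hG := isHomogeneous_of_mul (P := G) (Q := linForm v) (by rwa [mul_comm])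
      (by rwa [mul_comm])
    have hG0 : G ≠ 0 := right_ne_zero_of_mul h0
    have hdeg := ((isHomogeneous_linForm v).mul hG).inj_right hF h0
    obtain rfl : n = G.totalDegree := by omega
    obtain ⟨c, w, hw, hGw⟩ := ih hG hG0
    refine ⟨c, Fin.cons v w, ?_, ?_⟩
    · intro k
      refine Fin.cases hv hw k
    · rw [Fin.prod_univ_succ]
      simp only [Fin.cons_zero, Fin.cons_succ]
      conv_lhs => rw [hGw]
      ring

end BinaryForms

/-! ### Automorphisms of the rational normal curve. -/

section Reparametrization

variable {n : ℕ}

theorem ver_zero_vec (hn : 1 ≤ n) : ver n (0 : Fin 2 → ℂ) = 0 := by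
  have := ver_smul (n := n) (0 : ℂ) (0 : Fin 2 → ℂ)
  rwa [zero_pow (by omega), zero_smul, zero_smul] at this

theorem det_ne_zero_of_mulVec_ver (hn : 1 ≤ n) {M : Matrix (Fin (n + 1)) (Fin (n + 1)) ℂ}
    (hM : M.det ≠ 0) {γ : Matrix (Fin 2) (Fin 2) ℂ}
    (h : ∀ u, M.mulVec (ver n u) = ver n (γ.mulVec u)) : γ.det ≠ 0 := by
  intro hγ
  obtain ⟨u, hu, hu0⟩ := Matrix.exists_mulVec_eq_zero_iff.2 hγ
  refine hM (Matrix.exists_mulVec_eq_zero_iff.1 ⟨ver n u, ver_ne_zero hu, ?_⟩)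
  rw [h, hu0, ver_zero_vec hn]

theorem det_ne_zero_of_mulVec_ver' {M : Matrix (Fin (n + 1)) (Fin (n + 1)) ℂ}
    {γ : Matrix (Fin 2) (Fin 2) ℂ} (hγ : γ.det ≠ 0)
    (h : ∀ u, M.mulVec (ver n u) = ver n (γ.mulVec u)) : M.det ≠ 0 := by
  obtain ⟨N, hN⟩ := exists_mulVec_ver (n := n) γ⁻¹
  have : M * N = 1 := eq_of_mulVec_ver fun u => by
    rw [← Matrix.mulVec_mulVec, hN, h, Matrix.mulVec_mulVec,
      Matrix.mul_nonsing_inv _ (isUnit_iff_ne_zero.2 hγ), Matrix.one_mulVec, Matrix.one_mulVec]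
  intro h0
  have := congrArg Matrix.det this
  rw [Matrix.det_mul, h0, zero_mul, Matrix.det_one] at this
  exact zero_ne_one this

/-- Forms of degree `n` satisfying the equations of the rational normal curve are the monomials
of degree `n` in two linear forms. -/
theorem exists_reparametrization (hn : 1 ≤ n) {M : Matrix (Fin (n + 1)) (Fin (n + 1)) ℂ}
    (hM : M.det ≠ 0)
    (hrel : ∀ (u : Fin 2 → ℂ) (k : Fin (n + 1)),
      M.mulVec (ver n u) k * M.mulVec (ver n u) 0 ^ (k : ℕ) =
        M.mulVec (ver n u) 0 * M.mulVec (ver n u) ⟨1, by omega⟩ ^ (k : ℕ)) :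
    ∃ γ : Matrix (Fin 2) (Fin 2) ℂ, γ.det ≠ 0 ∧
      ∀ u, M.mulVec (ver n u) = ver n (γ.mulVec u) := by
  suffices ∃ γ : Matrix (Fin 2) (Fin 2) ℂ, ∀ u, M.mulVec (ver n u) = ver n (γ.mulVec u) by
    obtain ⟨γ, hγ⟩ := this
    exact ⟨γ, det_ne_zero_of_mulVec_ver hn hM hγ, hγ⟩
  let i1 : Fin (n + 1) := ⟨1, by omega⟩
  let W : Fin (n + 1) → MvPolynomial (Fin 2) ℂ := fun k => binForm (M k)
  have hWe : ∀ u k, eval u (W k) = M.mulVec (ver n u) k := fun u k => eval_binForm _ _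
  have hWh : ∀ k, (W k).IsHomogeneous n := fun k => isHomogeneous_binForm _
  have hW : ∀ k, W k * W 0 ^ (k : ℕ) = W 0 * W i1 ^ (k : ℕ) := fun k =>
    MvPolynomial.funext fun u => by simp only [map_mul, map_pow, hWe, hrel, i1]
  have hrow : ∀ c : Fin (n + 1) → ℂ, Matrix.vecMul c M = 0 → c = 0 :=
    fun c hc => by
      by_contra hne
      exact hM (Matrix.exists_vecMul_eq_zero_iff.1 ⟨c, hne, hc⟩)
  have hW0 : ∀ k, W k ≠ 0 := by
    intro k hk
    have hMk : M k = 0 := by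
      rw [← formCoeff_binForm (M k)]
      change formCoeff n (W k) = 0
      rw [hk]
      ext
      simp [formCoeff]
    have h1 := hrow (Pi.single k 1) (by rw [Matrix.single_vecMul, one_smul]; exact hMk)
    simpa using congrFun h1 k
  -- Write `W₀ = dp` and `W₁ = dq` with `p`, `q` coprime. The relations say `Wₖ / W₀ = (q / p)ᵏ`,
  -- and the case `k = n` forces `pⁿ⁻¹` to divide `d`. Thus `Wₖ = qᵏ pⁿ⁻ᵏ e`, and degrees leave only
  -- linear `p`, `q` and constant `e`.
  obtain ⟨p, q, d, hpq, hp, hq⟩ :=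
    UniqueFactorizationMonoid.exists_reduced_factors (W 0) (hW0 0) (W i1)
  have hd0 : d ≠ 0 := by rintro rfl; exact hW0 0 (by rw [← hp, zero_mul])
  have hp0 : p ≠ 0 := by rintro rfl; exact hW0 0 (by rw [← hp, mul_zero])
  have hq0 : q ≠ 0 := by rintro rfl; exact hW0 i1 (by rw [← hq, mul_zero])
  have hWp : ∀ k : Fin (n + 1), W k * p ^ (k : ℕ) = W 0 * q ^ (k : ℕ) := by
    intro k
    have := hW k
    rw [← hp, ← hq] at this
    refine mul_left_cancel₀ (pow_ne_zero k hd0) ?_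
    rw [← hp]
    linear_combination this
  obtain ⟨m, rfl⟩ : ∃ m, n = m + 1 := ⟨n - 1, by omega⟩
  obtain ⟨e, he⟩ : p ^ m ∣ d := by
    have h1 := hWp (Fin.last _)
    rw [← hp] at h1
    simp only [Fin.val_last] at h1
    have h2 : p ^ m * W (Fin.last _) = d * q ^ (m + 1) := by
      refine mul_left_cancel₀ hp0 ?_
      linear_combination h1
    have h3 : IsRelPrime (p ^ m) (q ^ (m + 1)) := hpq.pow_left.pow_right
    exact h3.dvd_of_dvd_mul_right (Dvd.intro _ h2)
  have he0 : e ≠ 0 := by rintro rfl; exact hd0 (by rw [he, mul_zero])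
  have hW0e : W 0 = p ^ (m + 1) * e := by rw [← hp, he]; ring
  have hWk : ∀ k : Fin (m + 1 + 1), W k = q ^ (k : ℕ) * p ^ (m + 1 - k) * e := by
    intro k
    refine mul_right_cancel₀ (pow_ne_zero k hp0) ?_
    rw [hWp, hW0e]
    have : p ^ (m + 1) = p ^ (m + 1 - k) * p ^ (k : ℕ) := by
      rw [← pow_add]; congr 1; omega
    rw [this]; ring
  have hph : p.IsHomogeneous p.totalDegree :=
    isHomogeneous_of_mul (Q := d) (by rw [mul_comm, hp]; exact hWh 0)
      (by rw [mul_comm, hp]; exact hW0 0)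
  have hqh : q.IsHomogeneous q.totalDegree :=
    isHomogeneous_of_mul (Q := d) (by rw [mul_comm, hq]; exact hWh i1)
      (by rw [mul_comm, hq]; exact hW0 i1)
  have heh : e.IsHomogeneous e.totalDegree :=
    isHomogeneous_of_mul (Q := p ^ (m + 1)) (by rw [mul_comm, ← hW0e]; exact hWh 0)
      (by rw [mul_comm, ← hW0e]; exact hW0 0)
  have hdeg0 : p.totalDegree * (m + 1) + e.totalDegree = m + 1 :=
    ((hph.pow (m + 1)).mul heh).inj_right (hW0e ▸ hWh 0) (hW0e ▸ hW0 0)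
  have hWi1 : W i1 = q * p ^ m * e := by
    have := hWk i1
    simpa [i1] using this
  have hdeg1 : q.totalDegree + p.totalDegree * m + e.totalDegree = m + 1 :=
    ((hqh.mul (hph.pow m)).mul heh).inj_right (hWi1 ▸ hWh i1) (hWi1 ▸ hW0 i1)
  -- Degree at most one follows from `deg p * n + deg e = n`. If `p` were constant, so would be `q`,
  -- and the first two rows of `M` would be proportional.
  have hpd : p.totalDegree = 1 := by
    rcases Nat.lt_or_ge p.totalDegree 1 with h | h
    · exfalso
      have hp1 : p.totalDegree = 0 := by omega
      rw [hp1] at hdeg0 hdeg1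
      have hq1 : q.totalDegree = 0 := by omega
      rw [totalDegree_eq_zero_iff_eq_C] at hp1 hq1
      have hlin : W i1 * p = W 0 * q := by simpa [i1] using hWp i1
      rw [hp1, hq1] at hlin
      set a := coeff 0 p
      set b := coeff 0 q
      have hM' : a • M i1 = b • M 0 := by
        refine eq_of_dotProduct_ver fun u => ?_
        have := congrArg (eval u) hlin
        simp only [map_mul, hWe, eval_C] at this
        rw [smul_dotProduct, smul_dotProduct]
        simp only [smul_eq_mul]
        rw [mul_comm a, mul_comm b]
        exact this
      have h2 := hrow (Pi.single i1 a - Pi.single 0 b) (by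
        rw [Matrix.sub_vecMul, Matrix.single_vecMul, Matrix.single_vecMul]
        exact sub_eq_zero.2 hM')
      have h3 := congrFun h2 i1
      have h4 : i1 ≠ 0 := by simp [i1]
      simp only [Pi.sub_apply, Pi.single_eq_same, Pi.single_eq_of_ne h4, sub_zero,
        Pi.zero_apply] at h3
      exact hp0 (by rw [hp1, h3, map_zero])
    · have : p.totalDegree * (m + 1) ≤ 1 * (m + 1) := by omega
      have := Nat.le_of_mul_le_mul_right this (by omega)
      omega
  rw [hpd] at hdeg0 hdeg1 hph
  have hed : e.totalDegree = 0 := by omega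
  have hqd : q.totalDegree = 1 := by omega
  rw [hqd] at hqh
  rw [totalDegree_eq_zero_iff_eq_C] at hed
  set c := coeff 0 e
  obtain ⟨z, hz⟩ := IsAlgClosed.exists_pow_nat_eq c (n := m + 1) (by omega)
  -- The constant `e` is absorbed by an `n`-th root `z`. Index `1` of `formCoeff 1` is the
  -- coefficient of `X 0`, whence the reversed columns.
  refine ⟨z • !![formCoeff 1 q 1, formCoeff 1 q 0; formCoeff 1 p 1, formCoeff 1 p 0], fun u => ?_⟩
  rw [Matrix.smul_mulVec, ver_smul, hz]
  ext k
  rw [← hWe, hWk, hed]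
  simp only [map_mul, map_pow, eval_C, eval_eq_formCoeff hph, eval_eq_formCoeff hqh]
  simp [ver, dotProduct, Fin.sum_univ_two]
  ring

end Reparametrization

/-! ### The homogeneous ideal of a rational normal curve and projective normality. -/

section Curves

variable {n : ℕ}

/-- The rational normal curve `u ↦ A * (uⁿ)`. -/
def curveSet (A : Matrix (Fin (n + 1)) (Fin (n + 1)) ℂ) : Set (ProjSpace n) :=
  {P | ∃ u : Fin 2 → ℂ, u ≠ 0 ∧ P.submodule = Submodule.span ℂ {A.mulVec (ver n u)}}

/-- The restriction of polynomials to the affine cone over a rational normal curve. -/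
noncomputable def pullback (A : Matrix (Fin (n + 1)) (Fin (n + 1)) ℂ) :
    MvPolynomial (Fin (n + 1)) ℂ →ₐ[ℂ] MvPolynomial (Fin 2) ℂ :=
  aeval fun i => binForm (A i)

variable (A : Matrix (Fin (n + 1)) (Fin (n + 1)) ℂ)

theorem eval_pullback (F : MvPolynomial (Fin (n + 1)) ℂ) (u : Fin 2 → ℂ) :
    eval u (pullback A F) = eval (A.mulVec (ver n u)) F := by
  have : (aeval u : MvPolynomial (Fin 2) ℂ →ₐ[ℂ] ℂ).comp (pullback A) =
      aeval (A.mulVec (ver n u)) := by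
    ext i
    simp only [pullback, AlgHom.comp_apply, aeval_X, aeval_eq_eval]
    exact eval_binForm _ _
  simpa [aeval_eq_eval] using DFunLike.congr_fun this F

theorem mulVec_ne_zero {A : Matrix (Fin (n + 1)) (Fin (n + 1)) ℂ} (hA : A.det ≠ 0)
    {v : Fin (n + 1) → ℂ} (hv : v ≠ 0) : A.mulVec v ≠ 0 :=
  fun h => hA (Matrix.exists_mulVec_eq_zero_iff.1 ⟨v, hv, h⟩)

theorem exists_ver_eq_smul (hn : 1 ≤ n) (c : ℂ) (u : Fin 2 → ℂ) :
    ∃ z : ℂ, ver n (z • u) = c • ver n u := by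
  obtain ⟨z, hz⟩ := IsAlgClosed.exists_pow_nat_eq c (n := n) (by omega)
  exact ⟨z, by rw [ver_smul, hz]⟩

/-- The affine cone over the curve is exactly the image of ℂ², because every scalar is an `n`-th
power and can be moved into the parameter. A polynomial vanishes on the cone if and only if its
pullback vanishes. -/
theorem curveIdeal_curveSet (hn : 1 ≤ n) :
    curveIdeal (curveSet A) = RingHom.ker (pullback A) := by
  ext F
  rw [curveIdeal, mem_vanishingIdeal_iff, RingHom.mem_ker]
  constructor
  · intro h
    refine MvPolynomial.funext fun u => ?_
    rw [eval_pullback, map_zero, ← aeval_eq_eval]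
    refine h _ fun hv => ⟨u, ?_, ?_⟩
    · rintro rfl
      rw [ver_zero_vec hn, Matrix.mulVec_zero] at hv
      exact hv rfl
    · rw [Projectivization.submodule_mk]
  · intro h v hv
    have hcone : ∃ u, v = A.mulVec (ver n u) := by
      by_cases hv0 : v = 0
      · exact ⟨0, by rw [ver_zero_vec hn, Matrix.mulVec_zero, hv0]⟩
      · obtain ⟨u, -, hu⟩ := hv hv0
        rw [Projectivization.submodule_mk] at hu
        have : v ∈ Submodule.span ℂ {A.mulVec (ver n u)} :=
          hu ▸ Submodule.mem_span_singleton_self v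
        obtain ⟨c, rfl⟩ := Submodule.mem_span_singleton.1 this
        obtain ⟨z, hz⟩ := exists_ver_eq_smul hn c u
        exact ⟨z • u, by rw [hz, Matrix.mulVec_smul]⟩
    obtain ⟨u, rfl⟩ := hcone
    rw [aeval_eq_eval]
    change eval (A.mulVec (ver n u)) F = 0
    rw [← eval_pullback, h, map_zero]

/-- The linear form with given coefficients. -/
noncomputable def lin (y : Fin (n + 1) → ℂ) : MvPolynomial (Fin (n + 1)) ℂ :=
  ∑ m, C (y m) * X m

theorem isHomogeneous_lin (y : Fin (n + 1) → ℂ) : (lin y).IsHomogeneous 1 :=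
  IsHomogeneous.sum _ _ _ fun _ _ => isHomogeneous_C_mul_X _ _

theorem eval_lin (y v : Fin (n + 1) → ℂ) : eval v (lin y) = y ⬝ᵥ v := by
  simp [lin, dotProduct]

theorem pullback_lin (y : Fin (n + 1) → ℂ) : pullback A (lin y) = binForm (Matrix.vecMul y A) :=
  MvPolynomial.funext fun u => by
    rw [eval_pullback, eval_lin, eval_binForm, Matrix.dotProduct_mulVec]

theorem isHomogeneous_pullback {F : MvPolynomial (Fin (n + 1)) ℂ} {d : ℕ}
    (hF : F.IsHomogeneous d) : (pullback A F).IsHomogeneous (n * d) :=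
  hF.aeval _ fun i => isHomogeneous_binForm (A i)

variable {A}

/-- Rational normal curves are projectively normal. -/
theorem map_pullback_homogeneousSubmodule (hA : A.det ≠ 0) (d : ℕ) :
    (homogeneousSubmodule (Fin (n + 1)) ℂ d).map (pullback A).toLinearMap =
      homogeneousSubmodule (Fin 2) ℂ (n * d) := by
  apply le_antisymm
  · rintro _ ⟨F, hF, rfl⟩
    exact isHomogeneous_pullback A hF
  · have hone : ∀ c : Fin (n + 1) → ℂ, ∃ L : MvPolynomial (Fin (n + 1)) ℂ,
        L.IsHomogeneous 1 ∧ pullback A L = binForm c := by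
      intro c
      refine ⟨lin (Matrix.vecMul c A⁻¹), isHomogeneous_lin _, ?_⟩
      rw [pullback_lin, Matrix.vecMul_vecMul, Matrix.nonsing_inv_mul _ (isUnit_iff_ne_zero.2 hA),
        Matrix.vecMul_one]
    induction d with
    | zero =>
      intro F hF
      have hF' : F.totalDegree = 0 := (totalDegree_zero_iff_isHomogeneous _).2 hF
      rw [totalDegree_eq_zero_iff_eq_C] at hF'
      refine ⟨C (coeff 0 F), isHomogeneous_C _ _, ?_⟩
      rw [hF']
      simp [pullback, MvPolynomial.algebraMap_eq]
    | succ d ih =>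
      intro F hF
      have hF' : F.IsHomogeneous (n * (d + 1)) := hF
      rw [← binForm_formCoeff hF', binForm]
      refine Submodule.sum_mem _ fun k _ => ?_
      have hk : (k : ℕ) < n * d + n + 1 := k.2
      -- Split off a monomial of degree `n` containing as many factors of the first variable as
      -- possible. The complementary exponents are then nonnegative and have sum `n * d`.
      let a : Fin (n + 1) := ⟨min k n, by omega⟩
      have hsplit : monomial (binExp (n * (d + 1)) k) (formCoeff (n * (d + 1)) F k) =
          binForm (Pi.single a 1) *
            monomial (binExp (n * d) (k - a)) (formCoeff (n * (d + 1)) F k) := by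
        have : binForm (Pi.single a 1) = monomial (binExp n a) (1 : ℂ) := by
          rw [binForm, Finset.sum_eq_single a]
          · simp
          · intro b _ hb; simp [hb]
          · simp
        have hmul : n * (d + 1) = n * d + n := by ring
        have hexp : binExp (n * (d + 1)) k = binExp n a + binExp (n * d) (k - a) := by
          ext i
          fin_cases i
          · simp [a]
          · simp [a, hmul]; omega
        rw [this, monomial_mul, one_mul, hexp]
      rw [hsplit]
      obtain ⟨L, hL, hLa⟩ := hone (Pi.single a 1)
      have hmon : monomial (binExp (n * d) (k - a)) (formCoeff (n * (d + 1)) F k) ∈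
          homogeneousSubmodule (Fin 2) ℂ (n * d) := by
        refine isHomogeneous_monomial _ ?_
        rw [degree_fin_two]
        simp [a]; omega
      obtain ⟨G, hG, hGm⟩ := ih hmon
      refine ⟨L * G, ?_, ?_⟩
      · have := hL.mul hG
        rwa [add_comm 1 d] at this
      · have hGm' : pullback A G = _ := hGm
        change pullback A (L * G) = _
        rw [map_mul, hLa, hGm']

end Curves

/-! ### Linear spaces of codimension two and their equations. -/

section LinearSpaces

variable {n : ℕ}

/-- The rows of `y` are two linear forms cutting out `Λ`. -/
def Defines (y : Fin 2 → Fin (n + 1) → ℂ) (Λ : CodimTwo n) : Prop :=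
  ∀ v : Fin (n + 1) → ℂ, v ∈ Λ.toSubmodule ↔ ∀ k, y k ⬝ᵥ v = 0

theorem finrank_quotient_codimTwo (Λ : CodimTwo n) :
    Module.finrank ℂ ((Fin (n + 1) → ℂ) ⧸ Λ.toSubmodule) = 2 := by
  have h := Λ.rankAtStalk_eq ⟨⊥, Ideal.isPrime_bot⟩
  rw [Module.rankAtStalk_eq_finrank_of_free] at h
  simpa using h

theorem Defines.ker_eq {y : Fin 2 → Fin (n + 1) → ℂ} {Λ : CodimTwo n} (h : Defines y Λ) :
    LinearMap.ker (Matrix.mulVecLin (Matrix.of y)) = Λ.toSubmodule := by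
  ext v
  rw [h v, LinearMap.mem_ker, funext_iff]
  rfl

theorem Defines.surjective {y : Fin 2 → Fin (n + 1) → ℂ} {Λ : CodimTwo n} (h : Defines y Λ) :
    Function.Surjective (Matrix.mulVecLin (Matrix.of y)) := by
  rw [← LinearMap.range_eq_top]
  apply Submodule.eq_top_of_finrank_eq
  rw [← (LinearMap.quotKerEquivRange _).finrank_eq, h.ker_eq, finrank_quotient_codimTwo]
  simp

theorem exists_defines {y : Fin 2 → Fin (n + 1) → ℂ}
    (h : Function.Surjective (Matrix.mulVecLin (Matrix.of y))) : ∃ Λ : CodimTwo n, Defines y Λ := by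
  let e := LinearMap.quotKerEquivOfSurjective _ h
  refine ⟨⟨LinearMap.ker (Matrix.mulVecLin (Matrix.of y)), inferInstance, inferInstance, ?_⟩, ?_⟩
  · intro p
    rw [Module.rankAtStalk_eq_finrank_of_free]
    simp [e.finrank_eq]
  · intro v
    change v ∈ LinearMap.ker (Matrix.mulVecLin (Matrix.of y)) ↔ _
    rw [LinearMap.mem_ker, funext_iff]
    rfl

/-- The ideal of a linear space of codimension two is generated by two linear forms. -/
theorem Defines.spaceIdeal_eq {y : Fin 2 → Fin (n + 1) → ℂ} {Λ : CodimTwo n} (h : Defines y Λ) :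
    spaceIdeal Λ = Ideal.span {lin (y 0), lin (y 1)} := by
  apply le_antisymm
  · obtain ⟨w, hw⟩ : ∃ w : Fin 2 → Fin (n + 1) → ℂ, ∀ k j, y j ⬝ᵥ w k = if j = k then 1 else 0 := by
      choose w hw using fun k : Fin 2 => h.surjective (Pi.single k 1)
      refine ⟨w, fun k j => ?_⟩
      have := congrFun (hw k) j
      rw [Pi.single_apply] at this
      exact this
    intro F hF
    -- Composition with the linear projection onto `Λ` along the dual vectors `w`. It kills
    -- polynomials vanishing on `Λ` and is the identity modulo the two linear forms.
    let ρ : MvPolynomial (Fin (n + 1)) ℂ →ₐ[ℂ] MvPolynomial (Fin (n + 1)) ℂ :=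
      aeval fun m => X m - ∑ k, C (w k m) * lin (y k)
    have hρ : ρ F = 0 := by
      refine MvPolynomial.funext fun v => ?_
      have h1 : (aeval v : MvPolynomial (Fin (n + 1)) ℂ →ₐ[ℂ] ℂ).comp ρ =
          aeval (v - ∑ k, (y k ⬝ᵥ v) • w k) := by
        ext m
        simp [ρ, aeval_eq_eval, eval_lin, mul_comm]
      have h2 : aeval (v - ∑ k, (y k ⬝ᵥ v) • w k) F = 0 := by
        refine mem_vanishingIdeal_iff.1 hF _ ?_
        refine (h _).2 fun j => ?_
        rw [dotProduct_sub, dotProduct_sum]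
        simp [dotProduct_smul, hw]
      rw [map_zero, ← h2, ← h1, AlgHom.comp_apply, aeval_eq_eval]
    have hmod : (Ideal.Quotient.mkₐ ℂ (Ideal.span {lin (y 0), lin (y 1)})).comp ρ =
        Ideal.Quotient.mkₐ ℂ _ := by
      ext m
      simp only [ρ, AlgHom.comp_apply, aeval_X, Ideal.Quotient.mkₐ_eq_mk]
      refine Ideal.Quotient.eq.2 ?_
      rw [sub_sub_cancel_left, neg_mem_iff, Fin.sum_univ_two]
      exact Ideal.add_mem _ (Ideal.mul_mem_left _ _ (Ideal.subset_span (by simp)))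
        (Ideal.mul_mem_left _ _ (Ideal.subset_span (by simp)))
    have := DFunLike.congr_fun hmod F
    rw [AlgHom.comp_apply, hρ, map_zero] at this
    exact Ideal.Quotient.eq_zero_iff_mem.1 this.symm
  · rw [Ideal.span_le]
    have : ∀ k, lin (y k) ∈ spaceIdeal Λ := fun k => mem_vanishingIdeal_iff.2 fun v hv => by
      rw [aeval_eq_eval]
      change eval v (lin (y k)) = 0
      rw [eval_lin]; exact (h v).1 hv k
    rintro _ (rfl | rfl)
    · exact this 0
    · exact this 1

end LinearSpaces

/-! ### The degree of the intersection of a curve with a linear space. -/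

section HilbertFunction

variable {n : ℕ}

theorem finrank_map_add_finrank_inf_ker {K V W : Type*} [Field K] [AddCommGroup V] [Module K V]
    [AddCommGroup W] [Module K W] (f : V →ₗ[K] W) (S : Submodule K V) [FiniteDimensional K S] :
    Module.finrank K (S.map f) + Module.finrank K (S ⊓ LinearMap.ker f : Submodule K V) =
      Module.finrank K S := by
  rw [← LinearMap.finrank_range_add_finrank_ker (f.domRestrict S), LinearMap.range_domRestrict]
  congr 1
  have : S ⊓ LinearMap.ker f = (LinearMap.ker (f.domRestrict S)).map S.subtype := by
    ext v
    simp [LinearMap.mem_ker, and_comm]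
  rw [this]
  exact (Submodule.equivMapOfInjective S.subtype Subtype.val_injective _).finrank_eq.symm

theorem finrank_map_mulLeft {q : MvPolynomial (Fin 2) ℂ} (hq : q ≠ 0) (m : ℕ) :
    Module.finrank ℂ ((homogeneousSubmodule (Fin 2) ℂ m).map (LinearMap.mulLeft ℂ q)) = m + 1 := by
  rw [← finrank_binaryForm m]
  exact (Submodule.equivMapOfInjective (LinearMap.mulLeft ℂ q)
    (fun _ _ h => mul_left_cancel₀ hq h) _).finrank_eq.symm

theorem homogeneousComponent_mul_of_isHomogeneous {σ R : Type*} [CommSemiring R]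
    {q : MvPolynomial σ R} {n : ℕ} (hq : q.IsHomogeneous n) (F : MvPolynomial σ R) (m : ℕ) :
    homogeneousComponent (m + n) (F * q) = homogeneousComponent m F * q := by
  induction F using MvPolynomial.induction_on' with
  | monomial d c =>
    have h := isHomogeneous_monomial c (d := d) rfl
    rw [homogeneousComponent_of_mem h, homogeneousComponent_of_mem (h.mul hq)]
    simp only [Nat.add_right_cancel_iff]
    split_ifs <;> simp
  | add F G hF hG => rw [add_mul, map_add, hF, hG, map_add, add_mul]

variable {A : Matrix (Fin (n + 1)) (Fin (n + 1)) ℂ} {y : Fin 2 → Fin (n + 1) → ℂ} {Λ : CodimTwo n}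

/-- The Hilbert function of the intersection of a rational normal curve with a linear space of
codimension two is eventually the degree of the common factor of the pencil that the linear
space cuts out on the curve. -/
theorem hilbertFun_eq (hn : 1 ≤ n) (hA : A.det ≠ 0) (hy : Defines y Λ)
    {g h₀ h₁ : MvPolynomial (Fin 2) ℂ} {e f : ℕ} (hef : e + f = n)
    (hg : g.IsHomogeneous e) (hh₀ : h₀.IsHomogeneous f) (hh₁ : h₁.IsHomogeneous f)
    (hg0 : g ≠ 0) (hh₀0 : h₀ ≠ 0) (hh₁0 : h₁ ≠ 0) (hrel : IsRelPrime h₀ h₁)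
    (hq₀ : binForm (Matrix.vecMul (y 0) A) = g * h₀)
    (hq₁ : binForm (Matrix.vecMul (y 1) A) = g * h₁) {d : ℕ} (hd : 1 ≤ d) :
    hilbertFun (curveIdeal (curveSet A) ⊔ spaceIdeal Λ) (d + 1) = e := by
  set I := curveIdeal (curveSet A) ⊔ spaceIdeal Λ with hI
  let Sd := homogeneousSubmodule (Fin (n + 1)) ℂ (d + 1)
  let V := homogeneousSubmodule (Fin 2) ℂ
  let Φ := (pullback A).toLinearMap
  set m := n * d with hm
  have hfm : f ≤ m := by
    calc f ≤ n * 1 := by omega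
      _ ≤ n * d := Nat.mul_le_mul_left n hd
  have hkerI : LinearMap.ker Φ ≤ I.restrictScalars ℂ := by
    intro F hF
    refine Ideal.mem_sup_left ?_
    rw [curveIdeal_curveSet A hn]
    exact hF
  have hgh₀ : g * h₀ ≠ 0 := mul_ne_zero hg0 hh₀0
  have hgh₁ : g * h₁ ≠ 0 := mul_ne_zero hg0 hh₁0
  have hdeg₀ : (g * h₀).IsHomogeneous n := hef ▸ hg.mul hh₀
  have hdeg₁ : (g * h₁).IsHomogeneous n := hef ▸ hg.mul hh₁
  have hL₀ : pullback A (lin (y 0)) = g * h₀ := by rw [pullback_lin, hq₀]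
  have hL₁ : pullback A (lin (y 1)) = g * h₁ := by rw [pullback_lin, hq₁]
  have hmapI : (Sd ⊓ I.restrictScalars ℂ).map Φ =
      (V m).map (LinearMap.mulLeft ℂ (g * h₀)) ⊔ (V m).map (LinearMap.mulLeft ℂ (g * h₁)) := by
    apply le_antisymm
    · rintro _ ⟨F, ⟨hF, hFI⟩, rfl⟩
      have hFI' : F ∈ curveIdeal (curveSet A) ⊔ spaceIdeal Λ := hFI
      obtain ⟨G, hG, H, hH, rfl⟩ := Submodule.mem_sup.1 hFI'
      rw [curveIdeal_curveSet A hn] at hG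
      rw [hy.spaceIdeal_eq, Ideal.mem_span_pair] at hH
      obtain ⟨a, b, rfl⟩ := hH
      have hG' : pullback A G = 0 := hG
      have h1 := isHomogeneous_pullback A (show IsHomogeneous _ (d + 1) from hF)
      have h2 := homogeneousComponent_eq_self h1
      simp only [map_add, map_mul, hG', hL₀, hL₁, zero_add] at h2
      rw [Nat.mul_succ, homogeneousComponent_mul_of_isHomogeneous hdeg₀,
        homogeneousComponent_mul_of_isHomogeneous hdeg₁] at h2
      change pullback A _ ∈ _
      simp only [map_add, map_mul, hG', hL₀, hL₁, zero_add]
      rw [← h2]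
      exact Submodule.add_mem_sup ⟨_, homogeneousComponent_isHomogeneous _ _, mul_comm _ _⟩
        ⟨_, homogeneousComponent_isHomogeneous _ _, mul_comm _ _⟩
    · have key : ∀ (k : Fin 2) (q : MvPolynomial (Fin 2) ℂ), pullback A (lin (y k)) = q →
          (V m).map (LinearMap.mulLeft ℂ q) ≤ (Sd ⊓ I.restrictScalars ℂ).map Φ := by
        rintro k q hq _ ⟨a, ha, rfl⟩
        have ha' : a ∈ homogeneousSubmodule (Fin 2) ℂ (n * d) := ha
        rw [← map_pullback_homogeneousSubmodule hA] at ha'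
        obtain ⟨b, hb, rfl⟩ := ha'
        refine ⟨lin (y k) * b, ⟨?_, ?_⟩, ?_⟩
        · have := (isHomogeneous_lin (y k)).mul hb
          rwa [add_comm 1 d] at this
        · refine Ideal.mul_mem_right _ _ (Ideal.mem_sup_right ?_)
          rw [hy.spaceIdeal_eq]
          fin_cases k
          · exact Ideal.subset_span (by simp)
          · exact Ideal.subset_span (by simp)
        · change pullback A (lin (y k) * b) = _
          rw [map_mul, hq]
          rfl
      exact sup_le (key 0 _ hL₀) (key 1 _ hL₁)
  -- The only syzygy of the coprime pair `h₀`, `h₁` is the Koszul one, so common multiples are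
  -- multiples of `g * h₀ * h₁`.
  have hinf : (V m).map (LinearMap.mulLeft ℂ (g * h₀)) ⊓ (V m).map (LinearMap.mulLeft ℂ (g * h₁)) =
      (V (m - f)).map (LinearMap.mulLeft ℂ (g * h₀ * h₁)) := by
    apply le_antisymm
    · rintro _ ⟨⟨a, ha, rfl⟩, ⟨b, hb, hab⟩⟩
      have hab' : g * h₁ * b = g * h₀ * a := hab
      have h1 : h₁ * b = h₀ * a := by
        refine mul_left_cancel₀ hg0 ?_
        rw [← mul_assoc, hab', mul_assoc]
      obtain ⟨c, rfl⟩ : h₁ ∣ a := hrel.symm.dvd_of_dvd_mul_left ⟨b, h1.symm⟩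
      refine ⟨homogeneousComponent (m - f) c, homogeneousComponent_isHomogeneous _ _, ?_⟩
      have h2 : homogeneousComponent (m - f + f) (c * h₁) = c * h₁ := by
        rw [Nat.sub_add_cancel hfm, mul_comm]
        exact homogeneousComponent_eq_self ha
      rw [homogeneousComponent_mul_of_isHomogeneous hh₁] at h2
      simp only [LinearMap.mulLeft_apply]
      rw [mul_comm h₁ c, ← h2]
      ring
    · rintro _ ⟨c, hc, rfl⟩
      have hmul : ∀ h : MvPolynomial (Fin 2) ℂ, h.IsHomogeneous f → h * c ∈ V m := by
        intro h hh
        have := hh.mul hc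
        rwa [show f + (m - f) = m by omega] at this
      refine ⟨⟨h₁ * c, hmul _ hh₁, ?_⟩, ⟨h₀ * c, hmul _ hh₀, ?_⟩⟩
      · simp only [LinearMap.mulLeft_apply]; ring
      · simp only [LinearMap.mulLeft_apply]; ring
  have hfinV : ∀ i, FiniteDimensional ℂ (V i) := fun i =>
    inferInstanceAs (FiniteDimensional ℂ (BinaryForm i))
  have hfinS : FiniteDimensional ℂ Sd :=
    Module.Finite.iff_fg.2 (homogeneousSubmodule_fg _ _ _)
  have hfinSI : FiniteDimensional ℂ (Sd ⊓ I.restrictScalars ℂ : Submodule ℂ _) :=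
    Submodule.finiteDimensional_of_le inf_le_left
  -- With `m = n * d`, all forms of degree `n * (d + 1)` make up dimension `m + n + 1`. The two
  -- images span `2(m + 1) - (m - f + 1) = m + f + 1` of it, leaving `n - f = e`.
  have e1 := finrank_map_add_finrank_inf_ker (Ideal.Quotient.mkₐ ℂ I).toLinearMap Sd
  have hkmk : LinearMap.ker (Ideal.Quotient.mkₐ ℂ I).toLinearMap = I.restrictScalars ℂ := by
    ext F
    exact Ideal.Quotient.eq_zero_iff_mem
  rw [hkmk] at e1
  have e2 := finrank_map_add_finrank_inf_ker Φ Sd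
  have hmapS : Sd.map Φ = V (n * (d + 1)) := map_pullback_homogeneousSubmodule hA (d + 1)
  rw [hmapS, finrank_binaryForm] at e2
  have e3 := finrank_map_add_finrank_inf_ker Φ (Sd ⊓ I.restrictScalars ℂ)
  rw [inf_assoc, inf_eq_right.2 hkerI, hmapI] at e3
  have e4 := Submodule.finrank_sup_add_finrank_inf_eq
    ((V m).map (LinearMap.mulLeft ℂ (g * h₀))) ((V m).map (LinearMap.mulLeft ℂ (g * h₁)))
  rw [hinf, finrank_map_mulLeft hgh₀, finrank_map_mulLeft hgh₁,
    finrank_map_mulLeft (mul_ne_zero hgh₀ hh₁0)] at e4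
  change Module.finrank ℂ (Sd.map (Ideal.Quotient.mkₐ ℂ I).toLinearMap) = e
  rw [Nat.mul_succ, ← hm] at e2
  omega

/-- A linear space of codimension two meets a rational normal curve in degree `n - 1` if and only
if the pencil it cuts out on the curve is a pencil of linear forms times a product of `n - 1`
linear forms. -/
theorem eventually_hilbertFun_eq_iff (hn : 1 ≤ n) (hA : A.det ≠ 0) (hy : Defines y Λ) :
    (∀ᶠ d in Filter.atTop, hilbertFun (curveIdeal (curveSet A) ⊔ spaceIdeal Λ) d = n - 1) ↔
      ∃ (v : Fin (n - 1) → Fin 2 → ℂ) (h : Fin 2 → Fin 2 → ℂ), (∀ i, v i ≠ 0) ∧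
        ∀ k, binForm (Matrix.vecMul (y k) A) =
          (∏ i, linForm (v i)) * (C (h k 0) * X 0 + C (h k 1) * X 1) := by
  -- The defining linear forms are independent, and no nonzero linear form vanishes on the curve.
  have hq0 : ∀ c : Fin 2 → ℂ, c ≠ 0 → binForm (Matrix.vecMul (c 0 • y 0 + c 1 • y 1) A) ≠ 0 := by
    intro c hc h0
    obtain ⟨k, hk⟩ := Function.ne_iff.1 hc
    obtain ⟨v, hv⟩ := hy.surjective (Pi.single k 1)
    have h1 : Matrix.vecMul (c 0 • y 0 + c 1 • y 1) A = 0 := by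
      rw [← formCoeff_binForm (Matrix.vecMul _ A), h0]; ext; simp [formCoeff]
    have h2 : c 0 • y 0 + c 1 • y 1 = 0 := by
      by_contra hne
      exact hA (Matrix.exists_vecMul_eq_zero_iff.1 ⟨_, hne, h1⟩)
    have h4 : ∀ j, y j ⬝ᵥ v = (Pi.single k 1 : Fin 2 → ℂ) j := fun j => congrFun hv j
    have h5 := congrArg (· ⬝ᵥ v) h2
    simp only [add_dotProduct, smul_dotProduct, zero_dotProduct, h4, smul_eq_mul] at h5
    rw [← Fin.sum_univ_two (fun j => c j * (Pi.single k 1 : Fin 2 → ℂ) j)] at h5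
    exact hk (by simpa [Pi.single_apply] using h5)
  have hqk : ∀ k, binForm (Matrix.vecMul (y k) A) ≠ 0 := by
    intro k
    have := hq0 (Pi.single k 1) (by simp)
    fin_cases k <;> simpa using this
  have hdeg : ∀ k, (binForm (Matrix.vecMul (y k) A)).IsHomogeneous n :=
    fun k => isHomogeneous_binForm _
  constructor
  · intro hev
    obtain ⟨h₀, h₁, g, hrel, hg₀, hg₁⟩ :=
      UniqueFactorizationMonoid.exists_reduced_factors _ (hqk 0) (binForm (Matrix.vecMul (y 1) A))
    have hd₀ := hdeg 0
    have hd₁ := hdeg 1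
    have hz₀ := hqk 0
    have hz₁ := hqk 1
    rw [← hg₀] at hd₀ hz₀
    rw [← hg₁] at hd₁ hz₁
    have hgh := isHomogeneous_of_mul hd₀ hz₀
    have hh₀ := isHomogeneous_of_mul (P := h₀) (Q := g) (by rwa [mul_comm]) (by rwa [mul_comm])
    have hh₁ := isHomogeneous_of_mul (P := h₁) (Q := g) (by rwa [mul_comm]) (by rwa [mul_comm])
    have hs₀ := (hgh.mul hh₀).inj_right hd₀ hz₀
    have hs₁ := (hgh.mul hh₁).inj_right hd₁ hz₁
    have heq : h₁.totalDegree = h₀.totalDegree := by omega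
    rw [heq] at hh₁
    -- A single large degree suffices: there the Hilbert function is the degree of the common
    -- divisor `g`, which must be `n - 1`, leaving linear cofactors.
    obtain ⟨d, hd, hd1⟩ := (hev.and (Filter.eventually_ge_atTop 2)).exists
    obtain ⟨d, rfl⟩ : ∃ d', d = d' + 1 := ⟨d - 1, by omega⟩
    have hg0 := left_ne_zero_of_mul hz₀
    rw [hilbertFun_eq hn hA hy hs₀ hgh hh₀ hh₁ hg0 (right_ne_zero_of_mul hz₀)
      (right_ne_zero_of_mul hz₁) hrel hg₀.symm hg₁.symm (by omega)] at hd
    rw [hd] at hgh hs₀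
    have h1 : h₀.totalDegree = 1 := by omega
    rw [h1] at hh₀ hh₁
    obtain ⟨c, v, hv, hgv⟩ := exists_eq_prod_linForm hgh hg0
    have hlin : ∀ h : MvPolynomial (Fin 2) ℂ, h.IsHomogeneous 1 →
        h = C (formCoeff 1 h 1) * X 0 + C (formCoeff 1 h 0) * X 1 := by
      intro h hh
      refine MvPolynomial.funext fun u => ?_
      rw [eval_eq_formCoeff hh]
      simp [dotProduct, Fin.sum_univ_two, ver]
      ring
    refine ⟨v, ![![c * formCoeff 1 h₀ 1, c * formCoeff 1 h₀ 0],
      ![c * formCoeff 1 h₁ 1, c * formCoeff 1 h₁ 0]], hv, ?_⟩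
    intro k
    fin_cases k
    · simp only [Fin.zero_eta]
      rw [← hg₀, hgv]
      conv_lhs => rw [hlin h₀ hh₀]
      simp
      ring
    · simp only [Fin.mk_one]
      rw [← hg₁, hgv]
      conv_lhs => rw [hlin h₁ hh₁]
      simp
      ring
  · rintro ⟨v, h, hv, hvh⟩
    have hdet : h 0 0 * h 1 1 - h 0 1 * h 1 0 ≠ 0 := by
      intro h0
      -- If the determinant vanishes, these coefficients annihilate the pencil. When they are both
      -- zero, the coefficients of `X 1` are used instead, and if those vanish too, the first form
      -- is zero.
      by_cases hc : ![h 1 0, - h 0 0] = 0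
      · have h1 := congrFun hc 0
        have h2 := congrFun hc 1
        simp at h1 h2
        by_cases hc' : ![h 1 1, - h 0 1] = 0
        · have h3 := congrFun hc' 1
          simp at h3
          exact hqk 0 (by rw [hvh, h2, h3]; simp)
        · apply hq0 _ hc'
          have : binForm (Matrix.vecMul ((![h 1 1, - h 0 1] : Fin 2 → ℂ) 0 • y 0 +
              (![h 1 1, - h 0 1] : Fin 2 → ℂ) 1 • y 1) A) =
              C (h 1 1) * binForm (Matrix.vecMul (y 0) A) -
                C (h 0 1) * binForm (Matrix.vecMul (y 1) A) := by
            refine MvPolynomial.funext fun u => ?_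
            simp [eval_binForm, Matrix.add_vecMul, Matrix.smul_vecMul, Matrix.neg_vecMul]
            ring
          rw [this, hvh, hvh, h1, h2]
          simp
          ring
      · apply hq0 _ hc
        have : binForm (Matrix.vecMul ((![h 1 0, - h 0 0] : Fin 2 → ℂ) 0 • y 0 +
            (![h 1 0, - h 0 0] : Fin 2 → ℂ) 1 • y 1) A) =
            C (h 1 0) * binForm (Matrix.vecMul (y 0) A) -
              C (h 0 0) * binForm (Matrix.vecMul (y 1) A) := by
          refine MvPolynomial.funext fun u => ?_
          simp [eval_binForm, Matrix.add_vecMul, Matrix.smul_vecMul, Matrix.neg_vecMul]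
          ring
        rw [this, hvh, hvh]
        have h0' : (C (h 0 0) * C (h 1 1) - C (h 0 1) * C (h 1 0) :
            MvPolynomial (Fin 2) ℂ) = 0 := by
          rw [← C_mul, ← C_mul, ← C_sub, h0, C_0]
        linear_combination (-(∏ i, linForm (v i)) * X 1) * h0'
    have hrel : IsRelPrime (C (h 0 0) * X 0 + C (h 0 1) * X 1 : MvPolynomial (Fin 2) ℂ)
        (C (h 1 0) * X 0 + C (h 1 1) * X 1) := by
      intro p hp₀ hp₁
      have hu : IsUnit (C (h 0 0 * h 1 1 - h 0 1 * h 1 0) : MvPolynomial (Fin 2) ℂ) :=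
        (isUnit_iff_ne_zero.2 hdet).map C
      have hX0 : p ∣ X 0 := by
        rw [← hu.dvd_mul_left]
        have := (hp₀.mul_left (C (h 1 1))).sub (hp₁.mul_left (C (h 0 1)))
        convert this using 1
        simp only [C_sub, C_mul]
        ring
      have hX1 : p ∣ X 1 := by
        rw [← hu.dvd_mul_left]
        have := (hp₁.mul_left (C (h 0 0))).sub (hp₀.mul_left (C (h 1 0)))
        convert this using 1
        simp only [C_sub, C_mul]
        ring
      have hirr : Irreducible (X 0 : MvPolynomial (Fin 2) ℂ) := X_prime.irreducible
      rcases hirr.dvd_iff.1 hX0 with hp | hp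
      · exact hp
      · exfalso
        obtain ⟨q, hq⟩ := hp.dvd.trans hX1
        have := congrArg (eval ![0, 1]) hq
        simp at this
    have hgdeg : (∏ i, linForm (v i)).IsHomogeneous (n - 1) := by
      have := IsHomogeneous.prod Finset.univ (fun i => linForm (v i)) (fun _ => 1)
        fun i _ => isHomogeneous_linForm (v i)
      simpa using this
    have hz₀ := hqk 0
    have hz₁ := hqk 1
    rw [hvh] at hz₀ hz₁
    filter_upwards [Filter.eventually_ge_atTop 2] with d hd
    obtain ⟨d, rfl⟩ : ∃ d', d = d' + 1 := ⟨d - 1, by omega⟩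
    exact hilbertFun_eq hn hA hy (e := n - 1) (f := 1) (by omega) hgdeg
      (isHomogeneous_linear _ _) (isHomogeneous_linear _ _) (left_ne_zero_of_mul hz₀)
      (right_ne_zero_of_mul hz₀) (right_ne_zero_of_mul hz₁) hrel (hvh 0) (hvh 1) (by omega)

end HilbertFunction

/-! ### Matrices of a rational normal curve and their normal form. -/

section RationalNormalCurves

variable {n : ℕ}

theorem veroneseImage_eq_curveSet (f : Module.Basis (Fin (n + 1)) ℂ (BinaryForm n)) :
    veroneseImage f = curveSet (Matrix.of fun i => formCoeff n (f i : MvPolynomial (Fin 2) ℂ)) := by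
  have h : ∀ (u : Fin 2 → ℂ) (i : Fin (n + 1)), eval u (f i : MvPolynomial (Fin 2) ℂ) =
      formCoeff n (f i : MvPolynomial (Fin 2) ℂ) ⬝ᵥ ver n u := by
    intro u i
    have hi : (f i : MvPolynomial (Fin 2) ℂ).IsHomogeneous n :=
      (mem_homogeneousSubmodule n _).1 (f i).2
    exact eval_eq_formCoeff hi u
  simp only [veroneseImage, curveSet, h]
  rfl

theorem RNC.exists_matrix (C : RNC n) :
    ∃ A : Matrix (Fin (n + 1)) (Fin (n + 1)) ℂ, A.det ≠ 0 ∧ C.1 = curveSet A := by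
  obtain ⟨C, f, rfl⟩ := C
  refine ⟨_, ?_, veroneseImage_eq_curveSet f⟩
  rw [← isUnit_iff_ne_zero, ← Matrix.isUnit_iff_isUnit_det,
    ← Matrix.linearIndependent_rows_iff_isUnit]
  exact (f.map (binFormEquiv n).symm).linearIndependent

theorem exists_RNC_of_det_ne_zero {A : Matrix (Fin (n + 1)) (Fin (n + 1)) ℂ} (hA : A.det ≠ 0) :
    ∃ C : RNC n, C.1 = curveSet A := by
  rw [← isUnit_iff_ne_zero, ← Matrix.isUnit_iff_isUnit_det,
    ← Matrix.linearIndependent_rows_iff_isUnit] at hA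
  let b := basisOfLinearIndependentOfCardEqFinrank hA (by simp)
  refine ⟨⟨_, b.map (binFormEquiv n), rfl⟩, ?_⟩
  change veroneseImage _ = _
  rw [veroneseImage_eq_curveSet]
  congr 1
  ext i k
  have : (binFormEquiv n).symm ((b.map (binFormEquiv n)) i) = A i := by
    rw [Module.Basis.map_apply, LinearEquiv.symm_apply_apply]
    exact congrFun (coe_basisOfLinearIndependentOfCardEqFinrank hA _) i
  exact congrFun this k

theorem curveSet_eq_of_reparametrization {A B : Matrix (Fin (n + 1)) (Fin (n + 1)) ℂ}
    {γ : Matrix (Fin 2) (Fin 2) ℂ} (hγ : γ.det ≠ 0)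
    (h : ∀ u, A.mulVec (ver n u) = B.mulVec (ver n (γ.mulVec u))) : curveSet A = curveSet B := by
  ext P
  constructor
  · rintro ⟨u, hu, hP⟩
    refine ⟨γ.mulVec u, fun h0 => hγ (Matrix.exists_mulVec_eq_zero_iff.1 ⟨u, hu, h0⟩), ?_⟩
    rw [← h, hP]
  · rintro ⟨u, hu, hP⟩
    have hinv : γ.mulVec (γ⁻¹.mulVec u) = u := by
      rw [Matrix.mulVec_mulVec, Matrix.mul_nonsing_inv _ (isUnit_iff_ne_zero.2 hγ),
        Matrix.one_mulVec]
    refine ⟨γ⁻¹.mulVec u, fun h0 => hu ?_, ?_⟩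
    · rw [← hinv, h0, Matrix.mulVec_zero]
    · rw [h, hinv, hP]

/-- Points of the curve `B` satisfy its equations. -/
theorem relations_of_curveSet_subset (hn : 1 ≤ n) {A B : Matrix (Fin (n + 1)) (Fin (n + 1)) ℂ}
    (hA : A.det ≠ 0) (hB : B.det ≠ 0) (h : curveSet A ⊆ curveSet B) (u : Fin 2 → ℂ)
    (k : Fin (n + 1)) :
    (B⁻¹ * A).mulVec (ver n u) k * (B⁻¹ * A).mulVec (ver n u) 0 ^ (k : ℕ) =
      (B⁻¹ * A).mulVec (ver n u) 0 * (B⁻¹ * A).mulVec (ver n u) ⟨1, by omega⟩ ^ (k : ℕ) := by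
  by_cases hu : u = 0
  · simp [hu, ver_zero_vec hn]
  have hne := mulVec_ne_zero hA (ver_ne_zero (n := n) hu)
  obtain ⟨w, -, hw⟩ := h (a := Projectivization.mk ℂ _ hne)
    ⟨u, hu, Projectivization.submodule_mk _ _⟩
  rw [Projectivization.submodule_mk] at hw
  have hmem : A.mulVec (ver n u) ∈ Submodule.span ℂ {B.mulVec (ver n w)} :=
    hw ▸ Submodule.mem_span_singleton_self _
  obtain ⟨c, hc⟩ := Submodule.mem_span_singleton.1 hmem
  have hval : (B⁻¹ * A).mulVec (ver n u) = c • ver n w := by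
    rw [← Matrix.mulVec_mulVec, ← hc, Matrix.mulVec_smul, Matrix.mulVec_mulVec,
      Matrix.nonsing_inv_mul _ (isUnit_iff_ne_zero.2 hB), Matrix.one_mulVec]
  rw [hval]
  have hk : (k : ℕ) ≤ n := by omega
  simp only [Pi.smul_apply, smul_eq_mul, ver, Fin.val_zero, pow_zero, one_mul, pow_one,
    Nat.sub_zero, mul_pow]
  have h1 : w 1 ^ n * (w 1 ^ (n - 1)) ^ (k : ℕ) = w 1 ^ (n - (k : ℕ)) * (w 1 ^ n) ^ (k : ℕ) := by
    rw [← pow_mul, ← pow_mul, ← pow_add, ← pow_add]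
    congr 1
    zify [hk, hn]
    ring
  linear_combination (-(c * c ^ (k : ℕ) * w 0 ^ (k : ℕ))) * h1

/-- With `relations_of_curveSet_subset` this shows that a curve contained in another is equal to it.
The hypothesis is the equations rather than the inclusion because equations are polynomial in `A`,
as `exists_separating_polynomial` needs. -/
theorem exists_reparametrization_of_relations (hn : 1 ≤ n)
    {A B : Matrix (Fin (n + 1)) (Fin (n + 1)) ℂ} (hA : A.det ≠ 0) (hB : B.det ≠ 0)
    (hrel : ∀ (u : Fin 2 → ℂ) (k : Fin (n + 1)),
      (B⁻¹ * A).mulVec (ver n u) k * (B⁻¹ * A).mulVec (ver n u) 0 ^ (k : ℕ) =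
        (B⁻¹ * A).mulVec (ver n u) 0 * (B⁻¹ * A).mulVec (ver n u) ⟨1, by omega⟩ ^ (k : ℕ)) :
    ∃ γ : Matrix (Fin 2) (Fin 2) ℂ, γ.det ≠ 0 ∧
      ∀ u, A.mulVec (ver n u) = B.mulVec (ver n (γ.mulVec u)) := by
  have hdet : (B⁻¹ * A).det ≠ 0 := by
    rw [Matrix.det_mul, Matrix.det_nonsing_inv, Ring.inverse_eq_inv']
    exact mul_ne_zero (inv_ne_zero hB) hA
  obtain ⟨γ, hγ, h⟩ := exists_reparametrization hn hdet hrel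
  refine ⟨γ, hγ, fun u => ?_⟩
  rw [← h, Matrix.mulVec_mulVec, ← mul_assoc, Matrix.mul_nonsing_inv _ (isUnit_iff_ne_zero.2 hB),
    one_mul]

theorem ver_single_zero : ver n (Pi.single 0 1 : Fin 2 → ℂ) = Pi.single (Fin.last n) 1 := by
  ext k
  rw [Pi.single_apply]
  split_ifs with h
  · simp [ver, h]
  · have : n - (k : ℕ) ≠ 0 := by
      have := k.2
      have h' : (k : ℕ) ≠ n := fun hk => h (Fin.ext hk)
      omega
    simp [ver, this]

theorem ver_single_one : ver n (Pi.single 1 1 : Fin 2 → ℂ) = Pi.single 0 1 := by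
  ext k
  rw [Pi.single_apply]
  split_ifs with h
  · simp [ver, h]
  · have : (k : ℕ) ≠ 0 := fun hk => h (Fin.ext hk)
    simp [ver, this]

theorem linForm_smul (c : ℂ) (v : Fin 2 → ℂ) : linForm (c • v) = C c * linForm v := by
  simp only [linForm, Pi.smul_apply, smul_eq_mul, C_mul]
  ring

theorem eq_smul_of_det_eq_zero {v w : Fin 2 → ℂ} (hw : w ≠ 0) (h : v 0 * w 1 = v 1 * w 0) :
    ∃ c : ℂ, v = c • w := by
  by_cases h0 : w 0 = 0
  · have h1 : w 1 ≠ 0 := fun h1 => hw (by ext i; fin_cases i <;> simp [h0, h1])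
    refine ⟨v 1 / w 1, ?_⟩
    have : v 0 = 0 := by simpa [h0, h1] using h
    ext i; fin_cases i <;> simp [h0, h1, this]
  · refine ⟨v 0 / w 0, ?_⟩
    ext i; fin_cases i
    · simp [h0]
    · simp; field_simp; linear_combination -h

/-- Two linearly independent binary forms of positive degree have distinct roots. -/
theorem exists_roots_det_ne_zero (hn : 1 ≤ n) {F G : MvPolynomial (Fin 2) ℂ}
    (hF : F.IsHomogeneous n) (hG : G.IsHomogeneous n) (hF0 : F ≠ 0)
    (hG0 : G ≠ 0) (hind : ∀ c : ℂ, F ≠ C c * G) :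
    ∃ v w : Fin 2 → ℂ, v 0 * w 1 ≠ v 1 * w 0 ∧ eval v F = 0 ∧ eval w G = 0 := by
  obtain ⟨c, v, hv, hFv⟩ := exists_eq_prod_linForm hF hF0
  obtain ⟨d, w, hw, hGw⟩ := exists_eq_prod_linForm hG hG0
  -- Otherwise every root of `F` is proportional to every root of `G`, so both forms are scalar
  -- multiples of the `n`-th power of one linear form.
  by_contra! hcon
  have hvr : ∀ k, eval (v k) F = 0 := fun k => by
    rw [hFv, map_mul, map_prod, Finset.prod_eq_zero (Finset.mem_univ k), mul_zero]
    rw [eval_linForm]; ring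
  have hwr : ∀ k, eval (w k) G = 0 := fun k => by
    rw [hGw, map_mul, map_prod, Finset.prod_eq_zero (Finset.mem_univ k), mul_zero]
    rw [eval_linForm]; ring
  have hdet : ∀ i j, v i 0 * w j 1 = v i 1 * w j 0 := fun i j => by
    by_contra h
    exact hcon _ _ h (hvr i) (hwr j)
  let o : Fin n := ⟨0, by omega⟩
  choose a ha using fun i => eq_smul_of_det_eq_zero (hw o) (hdet i o)
  choose b hb using fun j => eq_smul_of_det_eq_zero (hv o) (v := w j) (by
    linear_combination -hdet o j)
  have hao : a o ≠ 0 := by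
    intro h; apply hv o; rw [ha o, h, zero_smul]
  have hF' : F = C (c * ∏ i, a i) * linForm (w o) ^ n := by
    rw [hFv]
    have : ∀ i, linForm (v i) = C (a i) * linForm (w o) := fun i => by
      conv_lhs => rw [ha i, linForm_smul]
    rw [Finset.prod_congr rfl fun i _ => this i]
    simp only [Finset.prod_mul_distrib, Finset.prod_const, Finset.card_univ,
      Fintype.card_fin, C_mul, map_prod]
    ring
  have hG' : G = C (d * ∏ i, (b i * a o)) * linForm (w o) ^ n := by
    rw [hGw]
    have : ∀ i, linForm (w i) = C (b i * a o) * linForm (w o) := fun i => by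
      conv_lhs => rw [hb i, ha o, smul_smul, linForm_smul]
    rw [Finset.prod_congr rfl fun i _ => this i]
    simp only [Finset.prod_mul_distrib, Finset.prod_const, Finset.card_univ,
      Fintype.card_fin, C_mul, map_prod, C_pow]
    ring
  have hne : d * ∏ i, (b i * a o) ≠ 0 := by
    intro h; apply hG0; rw [hG', h, C_0, zero_mul]
  apply hind ((c * ∏ i, a i) / (d * ∏ i, (b i * a o)))
  conv_rhs => rw [hG', ← mul_assoc, ← C_mul, div_mul_cancel₀ _ hne]
  exact hF'

/-- Every rational normal curve has a parametrization in normal form. -/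
theorem exists_normal_form (hn : 1 ≤ n) {A : Matrix (Fin (n + 1)) (Fin (n + 1)) ℂ}
    (hA : A.det ≠ 0) : ∃ (B : Matrix (Fin (n + 1)) (Fin (n + 1)) ℂ) (i j : Fin (n + 1)),
      B.det ≠ 0 ∧ curveSet B = curveSet A ∧ B 0 (Fin.last n) = 0 ∧ B (Fin.last n) 0 = 0 ∧
        B i (Fin.last n) = 1 ∧ B j 0 = 1 := by
  have hrow : ∀ c : Fin (n + 1) → ℂ, Matrix.vecMul c A = 0 → c = 0 :=
    fun c hc => by
      by_contra hne
      exact hA (Matrix.exists_vecMul_eq_zero_iff.1 ⟨c, hne, hc⟩)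
  have hform : ∀ k, binForm (A k) ≠ 0 := by
    intro k hk
    have hAk : A k = 0 := by
      rw [← formCoeff_binForm (A k), hk]
      ext
      simp [formCoeff]
    have h1 := hrow (Pi.single k 1) (by rw [Matrix.single_vecMul, one_smul]; exact hAk)
    simpa using congrFun h1 k
  let i1 : Fin (n + 1) := Fin.last n
  obtain ⟨v, w, hvw, hv, hw⟩ := exists_roots_det_ne_zero hn (isHomogeneous_binForm (A 0))
    (isHomogeneous_binForm (A i1)) (hform 0) (hform i1) (by
      intro c hc
      have h1 : A 0 = c • A i1 := eq_of_dotProduct_ver fun u => by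
        rw [smul_dotProduct, ← eval_binForm, ← eval_binForm, hc, map_mul, eval_C, smul_eq_mul]
      have h2 := hrow (Pi.single 0 1 - Pi.single i1 c) (by
        rw [Matrix.sub_vecMul, Matrix.single_vecMul, Matrix.single_vecMul, one_smul]
        exact sub_eq_zero.2 h1)
      have h3 := congrFun h2 0
      have h4 : (0 : Fin (n + 1)) ≠ i1 := by
        rw [Ne, Fin.ext_iff]; simp [i1]; omega
      simp [Pi.single_eq_of_ne h4] at h3)
  have hv0 : v ≠ 0 := by rintro rfl; simp at hvw
  have hw0 : w ≠ 0 := by rintro rfl; simp at hvw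
  -- Some coordinate of the image point is nonzero. Scaling the parameter by an `n`-th root makes it
  -- `1`; which coordinate this is depends on the curve, hence the indices `i` and `j`.
  have hscale : ∀ v : Fin 2 → ℂ, v ≠ 0 → ∃ (z : ℂ) (i : Fin (n + 1)),
      z ≠ 0 ∧ A.mulVec (ver n (z • v)) i = 1 := by
    intro v hv
    obtain ⟨i, hi⟩ := Function.ne_iff.1 (mulVec_ne_zero hA (ver_ne_zero (n := n) hv))
    rw [Pi.zero_apply] at hi
    obtain ⟨z, hz⟩ := IsAlgClosed.exists_pow_nat_eq (A.mulVec (ver n v) i)⁻¹ (n := n) (by omega)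
    refine ⟨z, i, ?_, ?_⟩
    · rintro rfl
      rw [zero_pow (by omega)] at hz
      exact inv_ne_zero hi hz.symm
    · rw [ver_smul, Matrix.mulVec_smul, Pi.smul_apply, hz, smul_eq_mul, inv_mul_cancel₀ hi]
  obtain ⟨z, i, hz, hi⟩ := hscale v hv0
  obtain ⟨z', j, hz', hj⟩ := hscale w hw0
  -- The substitution takes the basis vectors to the scaled `v` and `w`. Their images under the
  -- curve are the last and the first column of the new matrix, and these lie in the hyperplanes
  -- where coordinate `0`, respectively `n`, vanishes.
  let γ : Matrix (Fin 2) (Fin 2) ℂ := !![z * v 0, z' * w 0; z * v 1, z' * w 1]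
  have hγ : γ.det ≠ 0 := by
    rw [Matrix.det_fin_two_of]
    intro h
    apply hvw
    refine mul_left_cancel₀ (mul_ne_zero hz hz') ?_
    linear_combination h
  have hγ0 : γ.mulVec (Pi.single 0 1) = z • v := by
    ext a; fin_cases a <;> simp [γ]
  have hγ1 : γ.mulVec (Pi.single 1 1) = z' • w := by
    ext a; fin_cases a <;> simp [γ]
  obtain ⟨S, hS⟩ := exists_mulVec_ver (n := n) γ
  have hAS : ∀ u, (A * S).mulVec (ver n u) = A.mulVec (ver n (γ.mulVec u)) := fun u => by
    rw [← Matrix.mulVec_mulVec, hS]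
  have hlast : ∀ k, (A * S) k (Fin.last n) = A.mulVec (ver n (z • v)) k := fun k => by
    have := congrFun (hAS (Pi.single 0 1)) k
    rw [ver_single_zero, hγ0] at this
    simpa using this
  have hzero : ∀ k, (A * S) k 0 = A.mulVec (ver n (z' • w)) k := fun k => by
    have := congrFun (hAS (Pi.single 1 1)) k
    rw [ver_single_one, hγ1] at this
    simpa using this
  have hz0 : A.mulVec (ver n (z • v)) 0 = 0 := by
    rw [ver_smul, Matrix.mulVec_smul, Pi.smul_apply]
    have : A.mulVec (ver n v) 0 = 0 := by rw [← hv]; exact (eval_binForm _ _).symm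
    rw [this, smul_zero]
  have hw1 : A.mulVec (ver n (z' • w)) i1 = 0 := by
    rw [ver_smul, Matrix.mulVec_smul, Pi.smul_apply]
    have : A.mulVec (ver n w) i1 = 0 := by rw [← hw]; exact (eval_binForm _ _).symm
    rw [this, smul_zero]
  refine ⟨A * S, i, j, ?_, curveSet_eq_of_reparametrization hγ hAS, ?_, ?_, ?_, ?_⟩
  · rw [Matrix.det_mul]
    exact mul_ne_zero hA (det_ne_zero_of_mulVec_ver' hγ hS)
  · rw [hlast, hz0]
  · rw [hzero]; exact hw1
  · rw [hlast, hi]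
  · rw [hzero, hj]

end RationalNormalCurves

/-! ### Polynomial parametrization of curves with their data. -/

section Parametrization

variable {n p l : ℕ}

/-- Indices of the parameters of a rational normal curve with `p` of its points and `l` linear
spaces of codimension two that meet it in degree `n - 1`: the matrix of the curve, the parameters
of the points, the roots of the base locus of the pencil cut out by each linear space, and the
linear forms spanning the moving part of each pencil. -/
abbrev ParamIdx (n p l : ℕ) : Type :=
  (Fin (n + 1) × Fin (n + 1)) ⊕ (Fin p × Fin 2) ⊕ (Fin l × Fin (n - 1) × Fin 2) ⊕
    (Fin l × Fin 2 × Fin 2)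

section

variable {R : Type*} [CommRing R]

def paramMatrix (x : ParamIdx n p l → R) : Matrix (Fin (n + 1)) (Fin (n + 1)) R :=
  Matrix.of fun i k => x (Sum.inl (i, k))

def paramPoint (x : ParamIdx n p l → R) (j : Fin p) (e : Fin 2) : R :=
  x (Sum.inr (Sum.inl (j, e)))

def paramRoot (x : ParamIdx n p l → R) (i : Fin l) (a : Fin (n - 1)) (e : Fin 2) : R :=
  x (Sum.inr (Sum.inr (Sum.inl (i, a, e))))

def paramLin (x : ParamIdx n p l → R) (i : Fin l) (k e : Fin 2) : R :=
  x (Sum.inr (Sum.inr (Sum.inr (i, k, e))))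

/-- The forms spanning the pencil cut out by the `i`-th linear space on the curve. -/
noncomputable def paramForm (x : ParamIdx n p l → R) (i : Fin l) (k : Fin 2) :
    MvPolynomial (Fin 2) R :=
  (∏ a, linForm (paramRoot x i a)) * (C (paramLin x i k 0) * X 0 + C (paramLin x i k 1) * X 1)

/-- The coordinates of the datum with given parameters. -/
noncomputable def paramCoord (x : ParamIdx n p l → R) : CoordIdx n p l → R
  | Sum.inl (i, k, m) =>
    -- The linear form pulling back to `paramForm` would need the inverse matrix. The adjugate keeps
    -- the coordinates polynomial, at the cost of the factor `det` in `binForm_paramCoord`.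
    Matrix.vecMul (formCoeff n (paramForm x i k)) (paramMatrix x).adjugate m
  | Sum.inr (j, m) => (paramMatrix x).mulVec (ver n (paramPoint x j)) m

/-- The product of the determinants of pairs of roots of the base loci. -/
def paramDisc (x : ParamIdx n p l → R) : R :=
  ∏ i, ∏ ab ∈ (Finset.univ : Finset (Fin (n - 1))).offDiag,
    (paramRoot x i ab.1 0 * paramRoot x i ab.2 1 - paramRoot x i ab.1 1 * paramRoot x i ab.2 0)

variable {S : Type*} [CommRing S] (f : R →+* S) (x : ParamIdx n p l → R)

/-- Naturality in the ring identifies the numerical coordinates with the values of the polynomials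
obtained by substituting the variables `X` for the parameters. -/
theorem paramMatrix_comp : paramMatrix (f ∘ x) = f.mapMatrix (paramMatrix x) := rfl

theorem paramForm_comp (i : Fin l) (k : Fin 2) :
    paramForm (f ∘ x) i k = map f (paramForm x i k) := by
  simp [paramForm, linForm, paramRoot, paramLin]

theorem paramCoord_comp (c : CoordIdx n p l) : paramCoord (f ∘ x) c = f (paramCoord x c) := by
  obtain ⟨i, k, m⟩ | ⟨j, m⟩ := c
  · simp only [paramCoord, paramForm_comp, paramMatrix_comp, ← RingHom.map_adjugate]
    simp [Matrix.vecMul, dotProduct, formCoeff, coeff_map]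
  · simp only [paramCoord, paramMatrix_comp]
    simp [Matrix.mulVec, dotProduct, ver, paramPoint]

theorem paramDisc_comp : paramDisc (f ∘ x) = f (paramDisc x) := by
  simp [paramDisc, paramRoot]

end

/-- The coordinates of the datum as polynomials in the parameters. -/
noncomputable def coordPoly (c : CoordIdx n p l) : MvPolynomial (ParamIdx n p l) ℂ :=
  paramCoord X c

theorem eval_coordPoly (x : ParamIdx n p l → ℂ) (c : CoordIdx n p l) :
    eval x (coordPoly c) = paramCoord x c := by
  rw [coordPoly, ← paramCoord_comp]
  congr 1
  ext s
  simp

theorem eval_paramDisc (x : ParamIdx n p l → ℂ) :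
    eval x (paramDisc (X : ParamIdx n p l → MvPolynomial (ParamIdx n p l) ℂ)) = paramDisc x := by
  rw [← paramDisc_comp]
  congr 1
  ext s
  simp

theorem isHomogeneous_paramForm (hn : 1 ≤ n) (x : ParamIdx n p l → ℂ) (i : Fin l) (k : Fin 2) :
    (paramForm x i k).IsHomogeneous n := by
  have h := IsHomogeneous.prod Finset.univ (fun a => linForm (paramRoot x i a)) (fun _ => 1)
    fun a _ => isHomogeneous_linForm _
  have := h.mul (isHomogeneous_linear (paramLin x i k 0) (paramLin x i k 1))
  simp only [Finset.sum_const, Finset.card_univ, Fintype.card_fin, smul_eq_mul, mul_one] at this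
  rwa [Nat.sub_add_cancel hn] at this

theorem binForm_smul {n : ℕ} (c : ℂ) (v : Fin (n + 1) → ℂ) : binForm (c • v) = C c * binForm v :=
  MvPolynomial.funext fun u => by
    simp [eval_binForm, smul_dotProduct]

/-- The pullback to the curve of the linear forms defining a linear space. -/
theorem binForm_paramCoord (hn : 1 ≤ n) (x : ParamIdx n p l → ℂ) (i : Fin l) (k : Fin 2) :
    binForm (Matrix.vecMul (fun m => paramCoord x (Sum.inl (i, k, m))) (paramMatrix x)) =
      C (paramMatrix x).det * paramForm x i k := by
  have : (fun m => paramCoord x (Sum.inl (i, k, m))) =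
      Matrix.vecMul (formCoeff n (paramForm x i k)) (paramMatrix x).adjugate := rfl
  rw [this, Matrix.vecMul_vecMul, Matrix.adjugate_mul, Matrix.vecMul_smul, Matrix.vecMul_one,
    binForm_smul, binForm_formCoeff (isHomogeneous_paramForm hn x i k)]

theorem isCoord_iff {x : CoordIdx n p l → ℂ} {δ : Datum n p l} : IsCoord x δ ↔
    (∀ i, Defines (fun k m => x (Sum.inl (i, k, m))) (δ.space i)) ∧
      ∀ j, (δ.point j).submodule = Submodule.span ℂ {fun m => x (Sum.inr (j, m))} :=
  Iff.rfl

theorem satisfies_of_isCoord (hn : 1 ≤ n) {x : ParamIdx n p l → ℂ}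
    (hdet : (paramMatrix x).det ≠ 0) (hroot : ∀ i a, paramRoot x i a ≠ 0) {δ : Datum n p l}
    (hδ : IsCoord (paramCoord x) δ) {Y : RNC n} (hY : Y.1 = curveSet (paramMatrix x)) :
    Satisfies Y δ := by
  rw [isCoord_iff] at hδ
  constructor
  · intro j
    rw [hY]
    refine ⟨paramPoint x j, fun h0 => ?_, hδ.2 j⟩
    have h1 := (δ.point j).finrank_submodule
    have h2 : (fun m => paramCoord x (Sum.inr (j, m))) = 0 := by
      change (paramMatrix x).mulVec (ver n (paramPoint x j)) = 0
      rw [h0, ver_zero_vec hn, Matrix.mulVec_zero]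
    rw [hδ.2 j, h2] at h1
    rw [Submodule.span_zero_singleton, finrank_bot] at h1
    exact zero_ne_one h1
  · intro i
    unfold MeetsInDegree
    rw [hY, eventually_hilbertFun_eq_iff hn hdet (hδ.1 i)]
    refine ⟨paramRoot x i, fun k e => (paramMatrix x).det * paramLin x i k e, hroot i, fun k => ?_⟩
    rw [binForm_paramCoord hn, paramForm]
    simp only [C_mul]
    ring

/-- Either coordinate of a root may vanish, so the normalized one must be chosen. There are finitely
many choices for all the roots together. -/
theorem exists_normalized_root {v : Fin 2 → ℂ} (hv : v ≠ 0) :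
    ∃ (ε : Fin 2) (c : ℂ) (w : Fin 2 → ℂ), w ε = 1 ∧ v = c • w := by
  obtain ⟨ε, hε⟩ := Function.ne_iff.1 hv
  rw [Pi.zero_apply] at hε
  exact ⟨ε, v ε, (v ε)⁻¹ • v, by simp [hε], by rw [smul_smul, mul_inv_cancel₀ hε, one_smul]⟩

/-- A datum satisfied by a rational normal curve arises from the parametrization, with any given
matrix of the curve and any given coordinates of the datum. -/
theorem exists_param_of_satisfies (hn : 1 ≤ n) {A : Matrix (Fin (n + 1)) (Fin (n + 1)) ℂ}
    (hA : A.det ≠ 0) {Y : RNC n} (hY : Y.1 = curveSet A) {δ : Datum n p l} (hsat : Satisfies Y δ)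
    {y : CoordIdx n p l → ℂ} (hy : IsCoord y δ) :
    ∃ (x : ParamIdx n p l → ℂ) (ε : Fin l → Fin (n - 1) → Fin 2), paramMatrix x = A ∧
      (∀ i a, paramRoot x i a (ε i a) = 1) ∧ paramCoord x = y := by
  rw [isCoord_iff] at hy
  have hpt : ∀ j, ∃ u : Fin 2 → ℂ, A.mulVec (ver n u) = fun m => y (Sum.inr (j, m)) := by
    intro j
    obtain ⟨u, -, hu⟩ := hY ▸ hsat.1 j
    rw [hy.2 j] at hu
    have hmem := hu ▸ Submodule.mem_span_singleton_self (R := ℂ) (fun m => y (Sum.inr (j, m)))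
    obtain ⟨c, hc⟩ := Submodule.mem_span_singleton.1 hmem
    obtain ⟨z, hz⟩ := exists_ver_eq_smul hn c u
    exact ⟨z • u, by rw [hz, Matrix.mulVec_smul, hc]⟩
  have hsp : ∀ i, ∃ (ε : Fin (n - 1) → Fin 2) (v : Fin (n - 1) → Fin 2 → ℂ)
      (h : Fin 2 → Fin 2 → ℂ), (∀ a, v a (ε a) = 1) ∧
        ∀ k, binForm (Matrix.vecMul (fun m => y (Sum.inl (i, k, m))) A) =
          (∏ a, linForm (v a)) * (C (h k 0) * X 0 + C (h k 1) * X 1) := by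
    intro i
    have h := hsat.2 i
    unfold MeetsInDegree at h
    rw [hY, eventually_hilbertFun_eq_iff hn hA (hy.1 i)] at h
    obtain ⟨v, h, hv, hvh⟩ := h
    choose ε c w hw hvw using fun a => exists_normalized_root (hv a)
    -- The scalars removed from the roots are moved into the linear factors.
    refine ⟨ε, w, fun k e => (∏ a, c a) * h k e, hw, fun k => ?_⟩
    rw [hvh]
    have : ∏ a, linForm (v a) = C (∏ a, c a) * ∏ a, linForm (w a) := by
      rw [map_prod, ← Finset.prod_mul_distrib]
      exact Finset.prod_congr rfl fun a _ => by rw [hvw a, linForm_smul]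
    rw [this]
    simp only [C_mul]
    ring
  choose u hu using hpt
  choose ε v h hv hvh using hsp
  -- The factor `A.det⁻¹` on the linear forms compensates for the adjugate.
  let x : ParamIdx n p l → ℂ := Sum.elim (fun ik => A ik.1 ik.2) (Sum.elim (fun je => u je.1 je.2)
    (Sum.elim (fun t => v t.1 t.2.1 t.2.2) fun t => A.det⁻¹ * h t.1 t.2.1 t.2.2))
  have hxA : paramMatrix x = A := rfl
  refine ⟨x, ε, hxA, hv, ?_⟩
  ext c
  obtain ⟨i, k, m⟩ | ⟨j, m⟩ := c
  · have h1 := binForm_paramCoord hn x i k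
    have h2 : C (paramMatrix x).det * paramForm x i k =
        binForm (Matrix.vecMul (fun m => y (Sum.inl (i, k, m))) A) := by
      rw [hvh, hxA]
      have h3 : ∀ e, paramLin x i k e = A.det⁻¹ * h i k e := fun _ => rfl
      have h4 : ∀ a, paramRoot x i a = v i a := fun _ => rfl
      have h5 : (C A.det * C A.det⁻¹ : MvPolynomial (Fin 2) ℂ) = 1 := by
        rw [← C_mul, mul_inv_cancel₀ hA, C_1]
      simp only [paramForm, h3, h4, C_mul]
      linear_combination (∏ a, linForm (v i a)) * (C (h i k 0) * X 0 + C (h i k 1) * X 1) * h5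
    rw [h2, hxA] at h1
    have h6 := congrArg (formCoeff n) h1
    rw [formCoeff_binForm, formCoeff_binForm] at h6
    have h7 := congrArg (fun w => Matrix.vecMul w A⁻¹) h6
    simp only [Matrix.vecMul_vecMul, Matrix.mul_nonsing_inv _ (isUnit_iff_ne_zero.2 hA),
      Matrix.vecMul_one] at h7
    exact congrFun h7 m
  · exact congrFun (hu j) m

/-- If the base locus of the pencil is reduced, then the linear space is secant. -/
theorem isSecant_of_paramDisc_ne_zero (hn : 1 ≤ n) {x : ParamIdx n p l → ℂ}
    (hdet : (paramMatrix x).det ≠ 0) (hroot : ∀ i a, paramRoot x i a ≠ 0)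
    (hdisc : paramDisc x ≠ 0) {δ : Datum n p l} (hδ : IsCoord (paramCoord x) δ) {Y : RNC n}
    (hY : Y.1 = curveSet (paramMatrix x)) (i : Fin l) : IsSecant Y (δ.space i) := by
  rw [isCoord_iff] at hδ
  set A := paramMatrix x with hAdef
  have hpair : ∀ a b : Fin (n - 1), a ≠ b →
      paramRoot x i a 0 * paramRoot x i b 1 ≠ paramRoot x i a 1 * paramRoot x i b 0 := by
    intro a b hab
    rw [paramDisc, Finset.prod_ne_zero_iff] at hdisc
    have := Finset.prod_ne_zero_iff.1 (hdisc i (Finset.mem_univ _)) (a, b) (by simp [hab])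
    exact sub_ne_zero.1 this
  have hform : ∀ k (u : Fin 2 → ℂ), (fun m => paramCoord x (Sum.inl (i, k, m))) ⬝ᵥ
      A.mulVec (ver n u) = A.det * eval u (paramForm x i k) := by
    intro k u
    rw [Matrix.dotProduct_mulVec, ← eval_binForm, binForm_paramCoord hn, map_mul, eval_C]
  have hmem : ∀ u, A.mulVec (ver n u) ∈ (δ.space i).toSubmodule ↔
      ∀ k, eval u (paramForm x i k) = 0 := by
    intro u
    rw [hδ.1 i]
    simp only [hform, mul_eq_zero, hdet, false_or]
  -- The moving part has no common zero: a dependency would make a nontrivial combination of the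
  -- defining linear forms vanish on the curve. The intersection is therefore given by the roots
  -- alone.
  have hlinear : paramLin x i 0 0 * paramLin x i 1 1 ≠ paramLin x i 0 1 * paramLin x i 1 0 := by
    intro h0
    have hM : (Matrix.of (paramLin x i)).det = 0 := by
      rw [Matrix.det_fin_two]; simp [h0]
    obtain ⟨c, hc, hc0⟩ := Matrix.exists_vecMul_eq_zero_iff.2 hM
    have hc0' : ∀ e, c 0 * paramLin x i 0 e + c 1 * paramLin x i 1 e = 0 := by
      intro e
      have := congrFun hc0 e
      simpa [Matrix.vecMul, dotProduct, Fin.sum_univ_two] using this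
    obtain ⟨k, hk⟩ := Function.ne_iff.1 hc
    obtain ⟨v, hv⟩ := (hδ.1 i).surjective (Pi.single k 1)
    have hv' : ∀ j, (fun m => paramCoord x (Sum.inl (i, j, m))) ⬝ᵥ v =
        (Pi.single k 1 : Fin 2 → ℂ) j := fun j => congrFun hv j
    have hcomb : ∀ u, (c 0 • (fun m => paramCoord x (Sum.inl (i, 0, m))) +
        c 1 • (fun m => paramCoord x (Sum.inl (i, 1, m)))) ⬝ᵥ A.mulVec (ver n u) = 0 := by
      intro u
      rw [add_dotProduct, smul_dotProduct, smul_dotProduct, hform, hform]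
      simp only [paramForm, map_mul, map_add, eval_C, eval_X, smul_eq_mul]
      linear_combination (A.det * eval u (∏ a, linForm (paramRoot x i a)) * u 0) * hc0' 0 +
        (A.det * eval u (∏ a, linForm (paramRoot x i a)) * u 1) * hc0' 1
    have hzero : Matrix.vecMul (c 0 • (fun m => paramCoord x (Sum.inl (i, 0, m))) +
        c 1 • (fun m => paramCoord x (Sum.inl (i, 1, m)))) A = 0 :=
      eq_of_dotProduct_ver fun u => by
        rw [← Matrix.dotProduct_mulVec, hcomb, zero_dotProduct]
    have hzero' : c 0 • (fun m => paramCoord x (Sum.inl (i, 0, m))) +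
        c 1 • (fun m => paramCoord x (Sum.inl (i, 1, m))) = 0 := by
      by_contra hne
      exact hdet (Matrix.exists_vecMul_eq_zero_iff.1 ⟨_, hne, hzero⟩)
    have h5 := congrArg (· ⬝ᵥ v) hzero'
    simp only [add_dotProduct, smul_dotProduct, zero_dotProduct, hv', smul_eq_mul] at h5
    rw [← Fin.sum_univ_two (fun j => c j * (Pi.single k 1 : Fin 2 → ℂ) j)] at h5
    exact hk (by simpa [Pi.single_apply] using h5)
  have hzero : ∀ u : Fin 2 → ℂ, u ≠ 0 → ((∀ k, eval u (paramForm x i k) = 0) ↔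
      ∃ a, u 0 * paramRoot x i a 1 = u 1 * paramRoot x i a 0) := by
    intro u hu
    simp only [paramForm, map_mul, map_prod, map_add, eval_C, eval_X, eval_linForm]
    constructor
    · intro h
      by_contra! hcon
      have hprod : ∏ a, (paramRoot x i a 1 * u 0 - paramRoot x i a 0 * u 1) ≠ 0 :=
        Finset.prod_ne_zero_iff.2 fun a _ h0 => hcon a (by linear_combination h0)
      have h0 := (mul_eq_zero.1 (h 0)).resolve_left hprod
      have h1 := (mul_eq_zero.1 (h 1)).resolve_left hprod
      have hd := sub_ne_zero.2 hlinear
      apply hu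
      ext e
      fin_cases e
      · refine (mul_eq_zero.1 ?_).resolve_left hd
        simp only [Fin.zero_eta]
        linear_combination paramLin x i 1 1 * h0 - paramLin x i 0 1 * h1
      · refine (mul_eq_zero.1 ?_).resolve_left hd
        simp only [Fin.mk_one]
        linear_combination paramLin x i 0 0 * h1 - paramLin x i 1 0 * h0
    · rintro ⟨a, ha⟩ k
      rw [Finset.prod_eq_zero (Finset.mem_univ a) (by linear_combination ha), zero_mul]
  let P : Fin (n - 1) → ProjSpace n := fun a =>
    Projectivization.mk ℂ _ (mulVec_ne_zero hdet (ver_ne_zero (n := n) (hroot i a)))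
  have hPsub : ∀ a, (P a).submodule = Submodule.span ℂ {A.mulVec (ver n (paramRoot x i a))} :=
    fun a => Projectivization.submodule_mk _ _
  have hset : {Q : ProjSpace n | Q ∈ Y.1 ∧ Lies Q (δ.space i)} = Set.range P := by
    ext Q
    rw [hY]
    constructor
    · rintro ⟨⟨u, hu, hQ⟩, hlies⟩
      rw [Lies, hQ, Submodule.span_singleton_le_iff_mem, hmem, hzero u hu] at hlies
      obtain ⟨a, ha⟩ := hlies
      obtain ⟨c, rfl⟩ := eq_smul_of_det_eq_zero (hroot i a) ha
      have hc : c ≠ 0 := by rintro rfl; simp at hu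
      refine ⟨a, Projectivization.submodule_injective ?_⟩
      rw [hPsub, hQ, ver_smul, Matrix.mulVec_smul,
        Submodule.span_singleton_smul_eq (isUnit_iff_ne_zero.2 (pow_ne_zero n hc))]
    · rintro ⟨a, rfl⟩
      refine ⟨⟨_, hroot i a, hPsub a⟩, ?_⟩
      rw [Lies, hPsub, Submodule.span_singleton_le_iff_mem, hmem, hzero _ (hroot i a)]
      exact ⟨a, mul_comm _ _⟩
  have hinj : Function.Injective P := by
    intro a b hab
    by_contra hne
    have h1 := congrArg Projectivization.submodule hab
    rw [hPsub, hPsub] at h1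
    have h2 := h1 ▸ Submodule.mem_span_singleton_self (R := ℂ)
      (A.mulVec (ver n (paramRoot x i a)))
    obtain ⟨c, hc⟩ := Submodule.mem_span_singleton.1 h2
    have h3 : ver n (paramRoot x i a) = c • ver n (paramRoot x i b) := by
      apply sub_eq_zero.1
      by_contra h4
      refine mulVec_ne_zero hdet h4 ?_
      rw [Matrix.mulVec_sub, Matrix.mulVec_smul, ← hc, sub_self]
    exact hpair a b hne (det_eq_zero_of_ver_eq_smul hn (hroot i a) h3)
  rw [IsSecant, hset, ← Set.image_univ, hinj.encard_image, Set.encard_univ]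
  simp

end Parametrization

/-! ### Normal form slices and finiteness of their fibres. -/

section FiniteFibers

variable {n p l : ℕ}

/-- The parameters that are fixed in a normal form. -/
def sliceSlot (n p : ℕ) {l : ℕ} (i j : Fin (n + 1)) (ε : Fin l → Fin (n - 1) → Fin 2) :
    Fin 4 ⊕ (Fin l × Fin (n - 1)) → ParamIdx n p l :=
  Sum.elim ![Sum.inl (0, Fin.last n), Sum.inl (Fin.last n, 0), Sum.inl (i, Fin.last n),
    Sum.inl (j, 0)] fun ia => Sum.inr (Sum.inr (Sum.inl (ia.1, ia.2, ε ia.1 ia.2)))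

open scoped Classical in
/-- The values of the parameters that are fixed in a normal form. -/
noncomputable def sliceBase (n p l : ℕ) (s : ParamIdx n p l) : ℂ :=
  if s = Sum.inl (0, Fin.last n) ∨ s = Sum.inl (Fin.last n, 0) then 0 else 1

theorem last_ne_zero (hn : 1 ≤ n) : Fin.last n ≠ 0 := by
  rw [Ne, Fin.ext_iff]; simp; omega

/-- The conditions on `i` and `j` keep the entries normalized to `1` apart from those normalized to
`0` in the same column. -/
theorem sliceSlot_injective (hn : 1 ≤ n) {i j : Fin (n + 1)} (hi : i ≠ 0) (hj : j ≠ Fin.last n)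
    (ε : Fin l → Fin (n - 1) → Fin 2) : Function.Injective (sliceSlot n p i j ε) := by
  have hl := last_ne_zero hn
  rintro (a | ⟨a, b⟩) (c | ⟨c, d⟩) h
  · fin_cases a <;> fin_cases c <;> simp_all [sliceSlot, eq_comm]
  · fin_cases a <;> simp [sliceSlot] at h
  · fin_cases c <;> simp [sliceSlot] at h
  · simp only [sliceSlot, Sum.elim_inr, Sum.inr.injEq, Sum.inl.injEq, Prod.mk.injEq] at h
    simp [h.1, h.2.1]

/-- The dimension of the slice minus the number of coordinates is `(n - 1)(n + 3 - p - l)`. This is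
where the number of conditions enters. -/
theorem card_sliceSlot (hn : 1 ≤ n) (hpl : p + l = n + 3) {i j : Fin (n + 1)} (hi : i ≠ 0)
    (hj : j ≠ Fin.last n) (ε : Fin l → Fin (n - 1) → Fin 2) :
    Nat.card (Set.range (sliceSlot n p i j ε)) + Nat.card (CoordIdx n p l) =
      Nat.card (ParamIdx n p l) := by
  rw [Nat.card_range_of_injective (sliceSlot_injective hn hi hj ε)]
  simp only [Nat.card_eq_fintype_card, Fintype.card_sum, Fintype.card_prod, Fintype.card_fin]
  obtain ⟨m, rfl⟩ : ∃ m, n = m + 1 := ⟨n - 1, by omega⟩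
  obtain rfl : m = p + l - 4 := by omega
  obtain ⟨k, hk⟩ : ∃ k, p + l = k + 4 := ⟨p + l - 4, by omega⟩
  rw [hk]
  simp only [Nat.add_sub_cancel]
  have hp : (p : ℤ) = k + 4 - l := by omega
  zify
  rw [hp]
  ring

theorem mem_slice_iff (hn : 1 ≤ n) {i j : Fin (n + 1)} (hi : i ≠ 0) (hj : j ≠ Fin.last n)
    {ε : Fin l → Fin (n - 1) → Fin 2} {x : ParamIdx n p l → ℂ} :
    (∀ s ∈ Set.range (sliceSlot n p i j ε), x s = sliceBase n p l s) ↔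
      (paramMatrix x 0 (Fin.last n) = 0 ∧ paramMatrix x (Fin.last n) 0 = 0 ∧
        paramMatrix x i (Fin.last n) = 1 ∧ paramMatrix x j 0 = 1) ∧
          ∀ a b, paramRoot x a b (ε a b) = 1 := by
  have hl := last_ne_zero hn
  simp only [paramMatrix, paramRoot, Matrix.of_apply]
  rw [Set.forall_mem_range]
  constructor
  · intro h
    refine ⟨⟨?_, ?_, ?_, ?_⟩, fun a b => ?_⟩
    · simpa [sliceSlot, sliceBase] using h (Sum.inl 0)
    · simpa [sliceSlot, sliceBase] using h (Sum.inl 1)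
    · simpa [sliceSlot, sliceBase, hi, hl] using h (Sum.inl 2)
    · simpa [sliceSlot, sliceBase, hj, hl.symm] using h (Sum.inl 3)
    · simpa [sliceSlot, sliceBase] using h (Sum.inr (a, b))
  · rintro ⟨⟨h0, h1, h2, h3⟩, h4⟩ (a | ⟨a, b⟩)
    · fin_cases a
      · simpa [sliceSlot, sliceBase] using h0
      · simpa [sliceSlot, sliceBase] using h1
      · simpa [sliceSlot, sliceBase, hi, hl] using h2
      · simpa [sliceSlot, sliceBase, hj, hl.symm] using h3
    · simpa [sliceSlot, sliceBase] using h4 a b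

theorem exists_mem_slice_paramDisc_ne_zero (ε : Fin l → Fin (n - 1) → Fin 2) (i j : Fin (n + 1)) :
    ∃ x : ParamIdx n p l → ℂ,
      (∀ s ∈ Set.range (sliceSlot n p i j ε), x s = sliceBase n p l s) ∧ paramDisc x ≠ 0 := by
  -- Root `b` has the normalized coordinate `1` and the other one `b + 2`. Two roots normalized in
  -- the same coordinate differ since `b ≠ c`; in different coordinates, since `(b + 2)(c + 2) ≠ 1`.
  let v : Fin l → Fin (n - 1) → Fin 2 → ℂ := fun a b e => if e = ε a b then 1 else ((b : ℕ) : ℂ) + 2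
  refine ⟨Sum.elim (fun s => sliceBase n p l (Sum.inl s)) (Sum.elim 0
    (Sum.elim (fun t => v t.1 t.2.1 t.2.2) 0)), ?_, ?_⟩
  · rintro _ ⟨a | ⟨a, b⟩, rfl⟩
    · fin_cases a <;> rfl
    · simp [sliceSlot, sliceBase, v]
  · refine Finset.prod_ne_zero_iff.2 fun a _ => Finset.prod_ne_zero_iff.2 ?_
    rintro ⟨b, c⟩ hbc
    have hne : (b : ℕ) ≠ (c : ℕ) := by simpa [Fin.ext_iff] using hbc
    change v a b 0 * v a c 1 - v a b 1 * v a c 0 ≠ 0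
    have h1 : (((b : ℕ) : ℂ) + 2) * (((c : ℕ) : ℂ) + 2) ≠ 1 := by
      have : ((b : ℕ) + 2) * ((c : ℕ) + 2) ≠ 1 := by
        intro h
        have := Nat.eq_one_of_mul_eq_one_right h
        omega
      exact_mod_cast this
    have h2 : ((b : ℕ) : ℂ) ≠ ((c : ℕ) : ℂ) := by exact_mod_cast hne
    simp only [v]
    generalize ε a b = e
    generalize ε a c = f
    fin_cases e <;> fin_cases f
    · simpa [sub_eq_zero] using h2.symm
    · simpa [sub_eq_zero] using h1.symm
    · simpa [sub_eq_zero] using h1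
    · simpa [sub_eq_zero] using h2

theorem finite_setOf_pow_eq {m : ℕ} (hm : 1 ≤ m) (c : ℂ) : {z : ℂ | z ^ m = c}.Finite := by
  refine (Polynomial.nthRoots m c).toFinset.finite_toSet.subset fun z hz => ?_
  simpa [Polynomial.mem_nthRoots (show 0 < m by omega)] using hz

/-- The zeros of a binary form at which another form has value `1` are finite in number. -/
theorem finite_setOf_eval_eq {m : ℕ} (hm : 1 ≤ m) {F G : MvPolynomial (Fin 2) ℂ}
    (hF : F.IsHomogeneous n) (hF0 : F ≠ 0) (hG : G.IsHomogeneous m) :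
    {v : Fin 2 → ℂ | eval v F = 0 ∧ eval v G = 1}.Finite := by
  obtain ⟨c, w, hw, rfl⟩ := exists_eq_prod_linForm hF hF0
  have hc : c ≠ 0 := by rintro rfl; simp at hF0
  refine (Set.finite_iUnion fun k => (finite_setOf_pow_eq hm (eval (w k) G)⁻¹).image
    fun z => z • w k).subset ?_
  rintro v ⟨hvF, hvG⟩
  rw [map_mul, eval_C, map_prod] at hvF
  obtain ⟨k, -, hk⟩ := Finset.prod_eq_zero_iff.1 ((mul_eq_zero.1 hvF).resolve_left hc)
  rw [eval_linForm] at hk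
  obtain ⟨z, rfl⟩ := eq_smul_of_det_eq_zero (hw k) (v := v) (by linear_combination hk)
  refine Set.mem_iUnion.2 ⟨k, z, ?_, rfl⟩
  rw [eval_eq_formCoeff hG, ver_smul, dotProduct_smul, ← eval_eq_formCoeff hG, smul_eq_mul] at hvG
  exact eq_inv_of_mul_eq_one_left hvG

theorem finite_setOf_mulVec_ver_eq (hn : 1 ≤ n) {A : Matrix (Fin (n + 1)) (Fin (n + 1)) ℂ}
    (hA : A.det ≠ 0) (y : Fin (n + 1) → ℂ) :
    {u : Fin 2 → ℂ | A.mulVec (ver n u) = y}.Finite := by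
  let z := A⁻¹.mulVec y
  have hpi : (Set.univ.pi fun e : Fin 2 =>
      {t : ℂ | t ^ n = (![z (Fin.last n), z 0] : Fin 2 → ℂ) e}).Finite :=
    Set.Finite.pi fun e => finite_setOf_pow_eq hn _
  refine hpi.subset fun u hu e _ => ?_
  have hver : ver n u = z := by
    change ver n u = A⁻¹.mulVec y
    rw [← show A.mulVec (ver n u) = y from hu, Matrix.mulVec_mulVec,
      Matrix.nonsing_inv_mul _ (isUnit_iff_ne_zero.2 hA), Matrix.one_mulVec]
  fin_cases e
  · simp [← hver, ver]
  · simp [← hver, ver]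

/-- A rational normal curve has finitely many parametrizations in normal form. -/
theorem finite_normal_forms (hn : 1 ≤ n) {A : Matrix (Fin (n + 1)) (Fin (n + 1)) ℂ}
    (hA : A.det ≠ 0) (i j : Fin (n + 1)) :
    {B : Matrix (Fin (n + 1)) (Fin (n + 1)) ℂ | B.det ≠ 0 ∧ curveSet B = curveSet A ∧
      B 0 (Fin.last n) = 0 ∧ B (Fin.last n) 0 = 0 ∧ B i (Fin.last n) = 1 ∧ B j 0 = 1}.Finite := by
  have hform : ∀ k, binForm (A k) ≠ 0 := by
    intro k hk
    have hAk : A k = 0 := by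
      rw [← formCoeff_binForm (A k), hk]
      ext
      simp [formCoeff]
    exact hA (Matrix.det_eq_zero_of_row_eq_zero k fun m => congrFun hAk m)
  have hV := finite_setOf_eval_eq hn (isHomogeneous_binForm (A 0)) (hform 0)
    (isHomogeneous_binForm (A i))
  have hW := finite_setOf_eval_eq hn (isHomogeneous_binForm (A (Fin.last n))) (hform _)
    (isHomogeneous_binForm (A j))
  choose S hS using fun γ : Matrix (Fin 2) (Fin 2) ℂ => exists_mulVec_ver (n := n) γ
  refine ((hV.prod hW).image fun vw : (Fin 2 → ℂ) × (Fin 2 → ℂ) =>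
    A * S (Matrix.of fun a => ![vw.1 a, vw.2 a])).subset ?_
  rintro B ⟨hB, hBA, h0, h1, h2, h3⟩
  -- The columns of `γ` determine `B`. Each is a zero of one row of `A` at which another row has
  -- value `1`, which leaves finitely many.
  obtain ⟨γ, -, hγ⟩ := exists_reparametrization_of_relations hn hB hA
    (relations_of_curveSet_subset hn hB hA hBA.subset)
  have hlast : ∀ k, B k (Fin.last n) = eval (fun a => γ a 0) (binForm (A k)) := fun k => by
    have h := congrFun (hγ (Pi.single 0 1)) k
    have hcol : γ.mulVec (Pi.single 0 1) = fun a => γ a 0 := by ext a; simp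
    rw [ver_single_zero, hcol, Matrix.mulVec_single_one] at h
    rw [eval_binForm]
    exact h
  have hzero : ∀ k, B k 0 = eval (fun a => γ a 1) (binForm (A k)) := fun k => by
    have h := congrFun (hγ (Pi.single 1 1)) k
    have hcol : γ.mulVec (Pi.single 1 1) = fun a => γ a 1 := by ext a; simp
    rw [ver_single_one, hcol, Matrix.mulVec_single_one] at h
    rw [eval_binForm]
    exact h
  refine ⟨(fun a => γ a 0, fun a => γ a 1), ⟨⟨?_, ?_⟩, ⟨?_, ?_⟩⟩, ?_⟩
  · rw [← hlast, h0]
  · rw [← hlast, h2]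
  · rw [← hzero, h1]
  · rw [← hzero, h3]
  · refine eq_of_mulVec_ver fun u => ?_
    have : (Matrix.of fun a => ![γ a 0, γ a 1]) = γ := by
      ext a b; fin_cases b <;> rfl
    simp only [this]
    rw [← Matrix.mulVec_mulVec, hS, hγ]

/-- Rational normal curves other than a given one are separated from it by a polynomial in the
parameters. -/
theorem exists_separating_polynomial (hn : 1 ≤ n) {x₀ : ParamIdx n p l → ℂ}
    (h₀ : (paramMatrix x₀).det ≠ 0) (Y : RNC n) (hY : Y.1 ≠ curveSet (paramMatrix x₀)) :
    ∃ F : MvPolynomial (ParamIdx n p l) ℂ, eval x₀ F ≠ 0 ∧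
      ∀ x, (paramMatrix x).det ≠ 0 → curveSet (paramMatrix x) = Y.1 → eval x F = 0 := by
  obtain ⟨B, hB, hYB⟩ := Y.exists_matrix
  by_contra! hcon
  apply hY
  -- The coordinates, in the frame of `B`, of the point with parameter `u` on the variable curve. If
  -- no equation of `Y` in these coordinates separated `x₀`, its curve would satisfy them all and
  -- equal `Y`.
  let W : (Fin 2 → ℂ) → Fin (n + 1) → MvPolynomial (ParamIdx n p l) ℂ := fun u k =>
    ∑ m, (∑ i, C (B⁻¹ k i) * X (Sum.inl (i, m))) * C (ver n u m)
  have hW : ∀ x u k, eval x (W u k) = (B⁻¹ * paramMatrix x).mulVec (ver n u) k := by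
    intro x u k
    simp [W, Matrix.mulVec, dotProduct, Matrix.mul_apply, paramMatrix]
  obtain ⟨γ, hγ, h⟩ := exists_reparametrization_of_relations hn h₀ hB fun u k => by
    by_contra hne
    obtain ⟨x, hx, hxY, hx0⟩ := hcon (W u k * W u 0 ^ (k : ℕ) - W u 0 * W u ⟨1, by omega⟩ ^ (k : ℕ))
      (by simpa [hW, sub_eq_zero] using hne)
    apply hx0
    have := relations_of_curveSet_subset hn hx hB (hxY.trans hYB).subset u k
    simpa [hW, sub_eq_zero] using this
  rw [hYB, curveSet_eq_of_reparametrization hγ h]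

theorem defines_ne_zero {y : Fin 2 → Fin (n + 1) → ℂ} {Λ : CodimTwo n} (h : Defines y Λ)
    (k : Fin 2) : y k ≠ 0 := by
  intro h0
  obtain ⟨v, hv⟩ := h.surjective (Pi.single k 1)
  have h1 : y k ⬝ᵥ v = (Pi.single k 1 : Fin 2 → ℂ) k := congrFun hv k
  rw [h0, zero_dotProduct, Pi.single_eq_same] at h1
  exact zero_ne_one h1

/-- If a datum is satisfied by finitely many rational normal curves, then the parameters in normal
form that yield it are isolated. -/
theorem finite_slice_fiber (hn : 1 ≤ n) {δ : Datum n p l}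
    (hfin : (dataProj n p l ⁻¹' {δ}).Finite) {i j : Fin (n + 1)} (hi : i ≠ 0)
    (hj : j ≠ Fin.last n) (ε : Fin l → Fin (n - 1) → Fin 2) {x₀ : ParamIdx n p l → ℂ}
    (hdet : (paramMatrix x₀).det ≠ 0) (hδ : IsCoord (paramCoord x₀) δ) :
    ∃ b : MvPolynomial (ParamIdx n p l) ℂ, eval x₀ b ≠ 0 ∧
      (∀ x, eval x b ≠ 0 → (paramMatrix x).det ≠ 0) ∧
      {x : ParamIdx n p l → ℂ |
        (∀ s ∈ Set.range (sliceSlot n p i j ε), x s = sliceBase n p l s) ∧ eval x b ≠ 0 ∧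
          ∀ c, eval x (coordPoly c) = eval x₀ (coordPoly c)}.Finite := by
  classical
  have hsep : ∀ t : Incidence n p l, ∃ F : MvPolynomial (ParamIdx n p l) ℂ, eval x₀ F ≠ 0 ∧
      (t.1.1.1 ≠ curveSet (paramMatrix x₀) → ∀ x, (paramMatrix x).det ≠ 0 →
        curveSet (paramMatrix x) = t.1.1.1 → eval x F = 0) := by
    intro t
    by_cases h : t.1.1.1 = curveSet (paramMatrix x₀)
    -- The curve of `x₀` itself must not be excluded, so its factor is trivial.
    · exact ⟨1, by simp, fun h' => absurd h h'⟩
    · obtain ⟨F, hF, hF'⟩ := exists_separating_polynomial hn hdet t.1.1 h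
      exact ⟨F, hF, fun _ => hF'⟩
  choose F hF hF' using hsep
  let D : MvPolynomial (ParamIdx n p l) ℂ := (paramMatrix X).det
  have hD : ∀ x, eval x D = (paramMatrix x).det := by
    intro x
    change eval x (paramMatrix X).det = _
    rw [RingHom.map_det, ← paramMatrix_comp]
    congr 2
    ext s
    simp
  -- Where this is nonzero, the matrix is invertible and the finitely many other curves satisfying
  -- `δ` are excluded. Only the curve of `x₀` remains in the fibre.
  refine ⟨D * ∏ t ∈ hfin.toFinset, F t, ?_, ?_, ?_⟩
  · rw [map_mul, map_prod, hD]
    exact mul_ne_zero hdet (Finset.prod_ne_zero_iff.2 fun t _ => hF t)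
  · intro x hx
    rw [map_mul, hD] at hx
    exact left_ne_zero_of_mul hx
  set T := {x : ParamIdx n p l → ℂ |
    (∀ s ∈ Set.range (sliceSlot n p i j ε), x s = sliceBase n p l s) ∧
      eval x (D * ∏ t ∈ hfin.toFinset, F t) ≠ 0 ∧
        ∀ c, eval x (coordPoly c) = eval x₀ (coordPoly c)} with hT
  set y := paramCoord x₀ with hy
  have hTdet : ∀ x ∈ T, (paramMatrix x).det ≠ 0 := by
    rintro x ⟨-, hx, -⟩
    rw [map_mul, hD] at hx
    exact left_ne_zero_of_mul hx
  have hTcoord : ∀ x ∈ T, paramCoord x = y := by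
    rintro x ⟨-, -, hx⟩
    ext c
    simpa [eval_coordPoly] using hx c
  have hTslice : ∀ x ∈ T, _ := fun x hx => (mem_slice_iff hn hi hj).1 hx.1
  have hTroot : ∀ x ∈ T, ∀ a b, paramRoot x a b ≠ 0 := by
    intro x hx a b h0
    have := (hTslice x hx).2 a b
    rw [h0] at this
    exact zero_ne_one this
  have hTcurve : ∀ x ∈ T, curveSet (paramMatrix x) = curveSet (paramMatrix x₀) := by
    intro x hx
    by_contra hne
    obtain ⟨Y, hY⟩ := exists_RNC_of_det_ne_zero (hTdet x hx)
    have hsat : Satisfies Y δ :=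
      satisfies_of_isCoord hn (hTdet x hx) (hTroot x hx) (by rwa [hTcoord x hx]) hY
    let t : Incidence n p l := ⟨(Y, δ), hsat⟩
    have ht : t ∈ hfin.toFinset := by
      rw [Set.Finite.mem_toFinset]; rfl
    have h0 := hF' t (fun h => hne (hY.symm.trans h)) x (hTdet x hx) hY.symm
    apply hx.2.1
    rw [map_mul, map_prod, Finset.prod_eq_zero ht h0, mul_zero]
  rw [isCoord_iff] at hδ
  set 𝒜 := paramMatrix '' T
  have h𝒜 : 𝒜.Finite := by
    refine (finite_normal_forms hn hdet i j).subset ?_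
    rintro _ ⟨x, hx, rfl⟩
    exact ⟨hTdet x hx, hTcurve x hx, (hTslice x hx).1⟩
  have h𝒜det : ∀ A ∈ 𝒜, A.det ≠ 0 := by
    rintro _ ⟨x, hx, rfl⟩
    exact hTdet x hx
  let q : Matrix (Fin (n + 1)) (Fin (n + 1)) ℂ → Fin l → Fin 2 → MvPolynomial (Fin 2) ℂ :=
    fun A a k => binForm (Matrix.vecMul (fun m => y (Sum.inl (a, k, m))) A)
  have hq : ∀ A ∈ 𝒜, ∀ a k, q A a k ≠ 0 := by
    intro A hA a k h0
    have h1 : Matrix.vecMul (fun m => y (Sum.inl (a, k, m))) A = 0 := by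
      rw [← formCoeff_binForm (Matrix.vecMul _ A)]
      change formCoeff n (q A a k) = 0
      rw [h0]
      ext
      simp [formCoeff]
    exact h𝒜det A hA (Matrix.exists_vecMul_eq_zero_iff.1 ⟨_, defines_ne_zero (hδ.1 a) k, h1⟩)
  have hTq : ∀ x ∈ T, ∀ a k, q (paramMatrix x) a k =
      C (paramMatrix x).det * paramForm x a k := by
    intro x hx a k
    rw [← binForm_paramCoord hn, hTcoord x hx]
  let U : Fin p → Set (Fin 2 → ℂ) := fun c =>
    ⋃ A ∈ 𝒜, {u | A.mulVec (ver n u) = fun m => y (Sum.inr (c, m))}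
  let V : Fin l → Fin (n - 1) → Set (Fin 2 → ℂ) := fun a b =>
    ⋃ A ∈ 𝒜, {v | eval v (q A a 0) = 0 ∧ eval v (X (ε a b)) = 1}
  have hU : ∀ c, (U c).Finite := fun c =>
    h𝒜.biUnion fun A hA => finite_setOf_mulVec_ver_eq hn (h𝒜det A hA) _
  have hV : ∀ a b, (V a b).Finite := fun a b =>
    h𝒜.biUnion fun A hA => finite_setOf_eval_eq le_rfl (isHomogeneous_binForm _) (hq A hA a 0)
      (isHomogeneous_X _ _)
  -- The matrix, point parameters and roots each range over finite sets, and they determine the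
  -- linear factors by cancelling the base locus.
  refine Set.Finite.of_finite_image
    (f := fun x => (paramMatrix x, paramPoint x, paramRoot x)) ?_ ?_
  · refine (h𝒜.prod ((Set.Finite.pi hU).prod
      (Set.Finite.pi fun a => Set.Finite.pi (hV a)))).subset ?_
    rintro _ ⟨x, hx, rfl⟩
    have hxA : paramMatrix x ∈ 𝒜 := ⟨x, hx, rfl⟩
    refine ⟨hxA, fun c _ => ?_, fun a _ b _ => ?_⟩
    · refine Set.mem_biUnion hxA ?_
      rw [← hTcoord x hx]
      rfl
    · refine Set.mem_biUnion hxA ⟨?_, ?_⟩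
      · rw [hTq x hx, paramForm, map_mul, map_mul, map_prod,
          Finset.prod_eq_zero (Finset.mem_univ b), zero_mul, mul_zero]
        rw [eval_linForm]
        ring
      · rw [eval_X]
        exact (hTslice x hx).2 a b
  · intro x hx x' hx' heq
    simp only [Prod.mk.injEq] at heq
    obtain ⟨hA, hpt, hroot⟩ := heq
    have hlin : ∀ a k e, paramLin x a k e = paramLin x' a k e := by
      intro a k
      have h1 := hTq x hx a k
      rw [hA, hTq x' hx'] at h1
      have h2 := mul_left_cancel₀ (by simpa using hTdet x' hx') h1
      simp only [paramForm, hroot] at h2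
      have hprod : ∏ b, linForm (paramRoot x' a b) ≠ 0 :=
        Finset.prod_ne_zero_iff.2 fun b _ => linForm_ne_zero (hTroot x' hx' a b)
      have h3 := mul_left_cancel₀ hprod h2
      have h4 := congrArg (eval ![1, 0]) h3
      have h5 := congrArg (eval ![0, 1]) h3
      intro e
      fin_cases e
      · simpa using h4.symm
      · simpa using h5.symm
    ext s
    obtain ⟨a, k⟩ | ⟨c, e⟩ | ⟨a, b, e⟩ | ⟨a, k, e⟩ := s
    · exact congrFun (congrFun hA a) k
    · exact congrFun (congrFun hpt c) e
    · exact congrFun (congrFun (congrFun hroot a) b) e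
    · exact hlin a k e

end FiniteFibers

/-! ### Systems of coordinates and the Zariski topology on data. -/

section Coordinates

variable {n p l : ℕ}

theorem exists_defines_of_codimTwo (Λ : CodimTwo n) :
    ∃ y : Fin 2 → Fin (n + 1) → ℂ, Defines y Λ := by
  let e : ((Fin (n + 1) → ℂ) ⧸ Λ.toSubmodule) ≃ₗ[ℂ] (Fin 2 → ℂ) :=
    LinearEquiv.ofFinrankEq _ _ (by rw [finrank_quotient_codimTwo]; simp)
  let f := e.toLinearMap ∘ₗ Λ.toSubmodule.mkQ
  refine ⟨LinearMap.toMatrix' f, fun v => ?_⟩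
  have h : ∀ k, LinearMap.toMatrix' f k ⬝ᵥ v = f v k := fun k =>
    congrFun (LinearMap.toMatrix'_mulVec f v) k
  simp only [h]
  rw [← Submodule.Quotient.mk_eq_zero, ← e.map_eq_zero_iff]
  exact funext_iff

theorem exists_isCoord (δ : Datum n p l) : ∃ y, IsCoord y δ := by
  choose y hy using fun i => exists_defines_of_codimTwo (δ.space i)
  refine ⟨Sum.elim (fun t => y t.1 t.2.1 t.2.2) fun t => (δ.point t.1).rep t.2, ?_⟩
  rw [isCoord_iff]
  exact ⟨hy, fun j => Projectivization.submodule_eq _⟩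

theorem Defines.exists_mul_eq {y z : Matrix (Fin 2) (Fin (n + 1)) ℂ} {Λ : CodimTwo n}
    (hy : Defines y Λ) (hz : Defines z Λ) :
    ∃ M N : Matrix (Fin 2) (Fin 2) ℂ, N * M = 1 ∧ M * y = z := by
  have hright : ∀ {x : Matrix (Fin 2) (Fin (n + 1)) ℂ}, Defines x Λ →
      ∃ V : Matrix (Fin (n + 1)) (Fin 2) ℂ, x * V = 1 := fun {x} h =>
    Matrix.mulVec_surjective_iff_exists_right_inverse.1 h.surjective
  -- For a right inverse `V` of `x`, each `v - V x v` lies in `Λ` and is killed by `w`.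
  have hmul : ∀ {x w : Matrix (Fin 2) (Fin (n + 1)) ℂ} {V : Matrix (Fin (n + 1)) (Fin 2) ℂ},
      Defines x Λ → Defines w Λ → x * V = 1 → w * V * x = w := by
    intro x w V hx hw hV
    refine Matrix.ext_of_mulVec_single fun m => ?_
    set v : Fin (n + 1) → ℂ := Pi.single m 1
    have h1 : v - V.mulVec (x.mulVec v) ∈ Λ.toSubmodule := by
      refine (hx _).2 fun k => ?_
      change x.mulVec _ k = 0
      rw [Matrix.mulVec_sub, Matrix.mulVec_mulVec, hV, Matrix.one_mulVec, sub_self]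
      rfl
    have h2 : w.mulVec (v - V.mulVec (x.mulVec v)) = 0 := funext ((hw _).1 h1)
    rw [Matrix.mulVec_sub, sub_eq_zero] at h2
    rw [h2, Matrix.mulVec_mulVec, Matrix.mulVec_mulVec, Matrix.mul_assoc]
  obtain ⟨V, hV⟩ := hright hy
  obtain ⟨W, hW⟩ := hright hz
  refine ⟨z * V, y * W, ?_, hmul hy hz hV⟩
  rw [← Matrix.mul_assoc, hmul hz hy hW, hV]

theorem Defines.mul {y : Matrix (Fin 2) (Fin (n + 1)) ℂ} {Λ : CodimTwo n} (hy : Defines y Λ)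
    {M N : Matrix (Fin 2) (Fin 2) ℂ} (h : N * M = 1) : Defines (M * y) Λ := by
  intro v
  rw [hy v]
  change (∀ k, y.mulVec v k = 0) ↔ ∀ k, (M * y).mulVec v k = 0
  rw [← Matrix.mulVec_mulVec]
  constructor
  · intro h0
    have : y.mulVec v = 0 := funext h0
    rw [this, Matrix.mulVec_zero]
    exact fun _ => rfl
  · intro h0
    have h1 : M.mulVec (y.mulVec v) = 0 := funext h0
    have h2 : y.mulVec v = 0 := by
      rw [← Matrix.one_mulVec (y.mulVec v), ← h, ← Matrix.mulVec_mulVec, h1, Matrix.mulVec_zero]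
    exact congrFun h2

/-- Any two systems of coordinates of a datum are related by a polynomial substitution that
takes coordinates of any datum to coordinates of the same datum. -/
theorem exists_substitution {x y : CoordIdx n p l → ℂ} {δ : Datum n p l} (hx : IsCoord x δ)
    (hy : IsCoord y δ) : ∃ φ : CoordIdx n p l → MvPolynomial (CoordIdx n p l) ℂ,
      (∀ (δ' : Datum n p l) x', IsCoord x' δ' → IsCoord (fun c => eval x' (φ c)) δ') ∧
        ∀ c, eval x (φ c) = y c := by
  rw [isCoord_iff] at hx hy
  choose M N hNM hM using fun i => (hx.1 i).exists_mul_eq (hy.1 i)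
  have hpt : ∀ j, ∃ c : ℂˣ, c • (fun m => x (Sum.inr (j, m))) = fun m => y (Sum.inr (j, m)) :=
    fun j => Submodule.span_singleton_eq_span_singleton.1 ((hx.2 j).symm.trans (hy.2 j))
  choose c hc using hpt
  let φ : CoordIdx n p l → MvPolynomial (CoordIdx n p l) ℂ :=
    Sum.elim (fun t => ∑ k, C (M t.1 t.2.1 k) * X (Sum.inl (t.1, k, t.2.2)))
      fun t => C (c t.1 : ℂ) * X (Sum.inr t)
  have hl : ∀ (x' : CoordIdx n p l → ℂ) i, (fun k m => eval x' (φ (Sum.inl (i, k, m)))) =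
      M i * Matrix.of fun k m => x' (Sum.inl (i, k, m)) := by
    intro x' i
    ext k m
    simp [φ, Matrix.mul_apply]
  have hr : ∀ (x' : CoordIdx n p l → ℂ) j, (fun m => eval x' (φ (Sum.inr (j, m)))) =
      c j • fun m => x' (Sum.inr (j, m)) := by
    intro x' j
    ext m
    simp [φ, Units.smul_def]
  refine ⟨φ, fun δ' x' hx' => ?_, ?_⟩
  · rw [isCoord_iff] at hx' ⊢
    constructor
    · intro i
      rw [hl]
      exact Defines.mul (hx'.1 i) (hNM i)
    · intro j
      rw [hr, hx'.2 j, Submodule.span_singleton_group_smul_eq]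
  · rintro (⟨i, k, m⟩ | ⟨j, m⟩)
    · exact congrFun (congrFun ((hl x i).trans (hM i)) k) m
    · exact congrFun ((hr x j).trans (hc j)) m

/-- The data that have a system of coordinates at which a given polynomial does not vanish. -/
def nonvanishing (a : MvPolynomial (CoordIdx n p l) ℂ) : Set (Datum n p l) :=
  {δ | ∃ y, IsCoord y δ ∧ eval y a ≠ 0}

theorem isOpen_iff_isZariskiClosed_compl {W : Set (Datum n p l)} :
    IsOpen W ↔ IsZariskiClosed Wᶜ :=
  Iff.rfl

/-- The polynomial `a` need not be compatible with changes of coordinates. The complement is cut out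
by all its transforms under substitutions preserving data, and `exists_substitution` says these
reach every coordinate system. -/
theorem isOpen_nonvanishing (a : MvPolynomial (CoordIdx n p l) ℂ) : IsOpen (nonvanishing a) := by
  rw [isOpen_iff_isZariskiClosed_compl]
  refine ⟨{F | ∃ φ : CoordIdx n p l → MvPolynomial (CoordIdx n p l) ℂ,
    (∀ (δ : Datum n p l) x, IsCoord x δ → IsCoord (fun c => eval x (φ c)) δ) ∧ F = bind₁ φ a},
      fun δ x hx => ?_⟩
  have heval : ∀ φ : CoordIdx n p l → MvPolynomial (CoordIdx n p l) ℂ,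
      eval x (bind₁ φ a) = eval (fun c => eval x (φ c)) a := fun φ =>
    eval₂Hom_bind₁ (RingHom.id ℂ) x φ a
  constructor
  · rintro hδ _ ⟨φ, hφ, rfl⟩
    by_contra hne
    exact hδ ⟨_, hφ δ x hx, by rwa [← heval]⟩
  · rintro h ⟨y, hy, hya⟩
    obtain ⟨φ, hφ, hφy⟩ := exists_substitution hx hy
    apply hya
    rw [← funext hφy, ← heval]
    exact h _ ⟨φ, hφ, rfl⟩

/-- One nonvanishing minor makes the two forms independent; Cramer's rule on the first and last
columns gives surjectivity. -/
theorem exists_isCoord_of_ne_zero {y : CoordIdx n p l → ℂ}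
    (hsp : ∀ i, y (Sum.inl (i, 0, 0)) * y (Sum.inl (i, 1, Fin.last n)) -
      y (Sum.inl (i, 0, Fin.last n)) * y (Sum.inl (i, 1, 0)) ≠ 0)
    (hpt : ∀ j, y (Sum.inr (j, 0)) ≠ 0) : ∃ δ : Datum n p l, IsCoord y δ := by
  have hspace : ∀ i, ∃ Λ : CodimTwo n, Defines (fun k m => y (Sum.inl (i, k, m))) Λ := by
    intro i
    refine exists_defines fun w => ?_
    have hd := hsp i
    set d := y (Sum.inl (i, 0, 0)) * y (Sum.inl (i, 1, Fin.last n)) -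
      y (Sum.inl (i, 0, Fin.last n)) * y (Sum.inl (i, 1, 0)) with hd'
    refine ⟨Pi.single 0 ((y (Sum.inl (i, 1, Fin.last n)) * w 0 -
      y (Sum.inl (i, 0, Fin.last n)) * w 1) / d) + Pi.single (Fin.last n)
        ((y (Sum.inl (i, 0, 0)) * w 1 - y (Sum.inl (i, 1, 0)) * w 0) / d), ?_⟩
    ext k
    rw [Matrix.mulVecLin_apply, Matrix.mulVec_add, Matrix.mulVec_single, Matrix.mulVec_single]
    fin_cases k
    · simp
      field_simp
      rw [hd']
      ring
    · simp
      field_simp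
      rw [hd']
      ring
  choose Λ hΛ using hspace
  have hne : ∀ j, (fun m => y (Sum.inr (j, m))) ≠ 0 := fun j h => hpt j (congrFun h 0)
  refine ⟨⟨Λ, fun j => Projectivization.mk ℂ _ (hne j)⟩, ?_⟩
  rw [isCoord_iff]
  exact ⟨hΛ, fun j => Projectivization.submodule_mk _ _⟩

/-- Coordinate systems contain the complement of a hypersurface, so `a` is multiplied by the minors
and first point coordinates that define it. -/
theorem exists_isCoord_eval_ne_zero (hn : 1 ≤ n) {a : MvPolynomial (CoordIdx n p l) ℂ}
    (ha : a ≠ 0) : ∃ (y : CoordIdx n p l → ℂ) (δ : Datum n p l), IsCoord y δ ∧ eval y a ≠ 0 := by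
  have hl := last_ne_zero hn
  let D : Fin l → MvPolynomial (CoordIdx n p l) ℂ := fun i =>
    X (Sum.inl (i, 0, 0)) * X (Sum.inl (i, 1, Fin.last n)) -
      X (Sum.inl (i, 0, Fin.last n)) * X (Sum.inl (i, 1, 0))
  have hD : ∀ i, D i ≠ 0 := by
    intro i h
    have := congrArg (eval (Sum.elim
      (fun t => if t.2 = (0, 0) ∨ t.2 = (1, Fin.last n) then (1 : ℂ) else 0) 0)) h
    simp [D, hl] at this
  have hprod : a * ((∏ i, D i) * ∏ j : Fin p, X (Sum.inr (j, 0))) ≠ 0 :=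
    mul_ne_zero ha (mul_ne_zero (Finset.prod_ne_zero_iff.2 fun i _ => hD i)
      (Finset.prod_ne_zero_iff.2 fun j _ => X_ne_zero _))
  obtain ⟨y, hy⟩ : ∃ y, eval y (a * ((∏ i, D i) * ∏ j : Fin p, X (Sum.inr (j, 0)))) ≠ 0 := by
    by_contra! h
    exact hprod (MvPolynomial.funext fun y => by rw [h, map_zero])
  simp only [map_mul, map_prod, mul_ne_zero_iff, Finset.prod_ne_zero_iff, Finset.mem_univ,
    true_implies] at hy
  obtain ⟨δ, hδ⟩ := exists_isCoord_of_ne_zero (y := y)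
    (fun i => by simpa [D] using hy.2.1 i) (fun j => by simpa using hy.2.2 j)
  exact ⟨y, δ, hδ, hy.1⟩

/-- One of the equations of the complement fails at a point of `W`; its nonvanishing locus lies in
`W`. -/
theorem exists_ne_zero_of_isOpen {W : Set (Datum n p l)} (hW : IsOpen W) (hne : W.Nonempty) :
    ∃ a : MvPolynomial (CoordIdx n p l) ℂ, a ≠ 0 ∧
      ∀ δ y, IsCoord y δ → eval y a ≠ 0 → δ ∈ W := by
  obtain ⟨S, hS⟩ := isOpen_iff_isZariskiClosed_compl.1 hW
  obtain ⟨δ, hδ⟩ := hne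
  obtain ⟨y, hy⟩ := exists_isCoord δ
  have hF := mt (hS δ y hy).2 (fun h => h hδ)
  push Not at hF
  obtain ⟨F, hF, hFy⟩ := hF
  refine ⟨F, fun h => hFy (by rw [h, map_zero]), fun δ' y' hy' hF' => ?_⟩
  by_contra hmem
  exact hF' ((hS δ' y' hy').1 hmem F hF)

end Coordinates

/-! ### Existence and secancy for generic data. -/

section GenericData

variable {n p l : ℕ}

/-- A rational normal curve satisfying a datum has a parametrization in normal form that yields
given coordinates of the datum. -/
theorem exists_mem_slice_of_satisfies (hn : 1 ≤ n) {Y : RNC n} {δ : Datum n p l}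
    (hsat : Satisfies Y δ) {y : CoordIdx n p l → ℂ} (hy : IsCoord y δ) :
    ∃ (i j : Fin (n + 1)) (ε : Fin l → Fin (n - 1) → Fin 2) (x : ParamIdx n p l → ℂ),
      i ≠ 0 ∧ j ≠ Fin.last n ∧
        (∀ s ∈ Set.range (sliceSlot n p i j ε), x s = sliceBase n p l s) ∧
          (paramMatrix x).det ≠ 0 ∧ Y.1 = curveSet (paramMatrix x) ∧ paramCoord x = y := by
  obtain ⟨A, hA, hYA⟩ := Y.exists_matrix
  obtain ⟨B, i, j, hB, hBA, h0, h1, h2, h3⟩ := exists_normal_form hn hA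
  have hYB := hYA.trans hBA.symm
  obtain ⟨x, ε, rfl, hroot, hcoord⟩ := exists_param_of_satisfies hn hB hYB hsat hy
  have hi : i ≠ 0 := by
    rintro rfl
    exact zero_ne_one (h0.symm.trans h2)
  have hj : j ≠ Fin.last n := by
    rintro rfl
    exact zero_ne_one (h1.symm.trans h3)
  exact ⟨i, j, ε, x, hi, hj, (mem_slice_iff hn hi hj).2 ⟨⟨h0, h1, h2, h3⟩, hroot⟩, hB, hYB, hcoord⟩

theorem paramRoot_ne_zero (hn : 1 ≤ n) {i j : Fin (n + 1)} (hi : i ≠ 0) (hj : j ≠ Fin.last n)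
    {ε : Fin l → Fin (n - 1) → Fin 2} {x : ParamIdx n p l → ℂ}
    (hx : ∀ s ∈ Set.range (sliceSlot n p i j ε), x s = sliceBase n p l s) (a : Fin l)
    (b : Fin (n - 1)) : paramRoot x a b ≠ 0 := by
  intro h0
  have := ((mem_slice_iff hn hi hj).1 hx).2 a b
  rw [h0] at this
  exact zero_ne_one this

/-- If some fibre is finite and nonempty, then the generic datum is satisfied by some curve. -/
theorem exists_satisfies_of_eval_ne_zero (hn : 1 ≤ n) (hpl : p + l = n + 3) {δ : Datum n p l}
    (hfin : (dataProj n p l ⁻¹' {δ}).Finite) (hne : (dataProj n p l ⁻¹' {δ}).Nonempty) :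
    ∃ a : MvPolynomial (CoordIdx n p l) ℂ, a ≠ 0 ∧
      ∀ (δ' : Datum n p l) y, IsCoord y δ' → eval y a ≠ 0 → ∃ Y, Satisfies Y δ' := by
  obtain ⟨⟨⟨Y, δ₀⟩, hsat⟩, hδ₀⟩ := hne
  obtain rfl : δ₀ = δ := hδ₀
  obtain ⟨y, hy⟩ := exists_isCoord δ₀
  obtain ⟨i, j, ε, x, hi, hj, hx, hdet, -, rfl⟩ := exists_mem_slice_of_satisfies hn hsat hy
  obtain ⟨b, hbx, hb, hbfin⟩ := finite_slice_fiber hn hfin hi hj ε hdet hy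
  obtain ⟨a, ha, h⟩ := exists_preimage_in_slice (card_sliceSlot hn hpl hi hj ε) coordPoly b x hx
    hbx hbfin
  refine ⟨a, ha, fun δ' y' hy' hy'a => ?_⟩
  obtain ⟨z, hz, hzy, hzb⟩ := h y' hy'a
  obtain rfl : paramCoord z = y' := funext fun c => by rw [← eval_coordPoly, hzy]
  obtain ⟨Y', hY'⟩ := exists_RNC_of_det_ne_zero (hb z hzb)
  exact ⟨Y', satisfies_of_isCoord hn (hb z hzb) (paramRoot_ne_zero hn hi hj hz) hy' hY'⟩

/-- For the generic datum, all linear spaces are secant to every curve that satisfies it. -/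
theorem exists_isSecant_of_eval_ne_zero (hn : 1 ≤ n) (hpl : p + l = n + 3) :
    ∃ a : MvPolynomial (CoordIdx n p l) ℂ, a ≠ 0 ∧
      ∀ (δ : Datum n p l) y, IsCoord y δ → eval y a ≠ 0 →
        ∀ Y, Satisfies Y δ → ∀ i, IsSecant Y (δ.space i) := by
  classical
  have hslice : ∀ q : {q : Fin (n + 1) × Fin (n + 1) × (Fin l → Fin (n - 1) → Fin 2) //
      q.1 ≠ 0 ∧ q.2.1 ≠ Fin.last n}, ∃ a : MvPolynomial (CoordIdx n p l) ℂ, a ≠ 0 ∧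
        ∀ z : ParamIdx n p l → ℂ,
          (∀ s ∈ Set.range (sliceSlot n p q.1.1 q.1.2.1 q.1.2.2), z s = sliceBase n p l s) →
            paramDisc z = 0 → eval (paramCoord z) a = 0 := by
    rintro ⟨⟨i, j, ε⟩, hi, hj⟩
    obtain ⟨x, hx, hdisc⟩ := exists_mem_slice_paramDisc_ne_zero (p := p) ε i j
    obtain ⟨a, ha, h⟩ := exists_eval_eq_zero_on_slice (card_sliceSlot hn hpl hi hj ε) coordPoly
      (paramDisc X) x hx (by rwa [eval_paramDisc])
    refine ⟨a, ha, fun z hz hz0 => ?_⟩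
    have := h z hz (by rwa [eval_paramDisc])
    simpa only [eval_coordPoly] using this
  choose a ha h using hslice
  -- The slice in which a curve has a normal form is not known in advance, so all of them are
  -- excluded at once.
  refine ⟨∏ q, a q, Finset.prod_ne_zero_iff.2 fun q _ => ha q, fun δ y hy hya Y hsat => ?_⟩
  obtain ⟨i, j, ε, x, hi, hj, hx, hdet, hY, rfl⟩ := exists_mem_slice_of_satisfies hn hsat hy
  rw [map_prod, Finset.prod_ne_zero_iff] at hya
  have hdisc : paramDisc x ≠ 0 := fun h0 =>
    hya ⟨⟨i, j, ε⟩, hi, hj⟩ (Finset.mem_univ _) (h ⟨⟨i, j, ε⟩, hi, hj⟩ x hx h0)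
  exact isSecant_of_paramDisc_ne_zero hn hdet (paramRoot_ne_zero hn hi hj hx) hdisc hy hY

end GenericData

end RatNormal

theorem lemma2p2 (n p l : ℕ) (hn : 1 ≤ n) (hpl : p + l = n + 3)
    (δ : RatNormal.Datum n p l)
    (hfin : (RatNormal.dataProj n p l ⁻¹' {δ}).Finite)
    (hne : (RatNormal.dataProj n p l ⁻¹' {δ}).Nonempty) :
    DenseRange (RatNormal.dataProj n p l) ∧
    ((∃ x ∈ RatNormal.dataProj n p l ⁻¹' {δ},
        ∀ i : Fin l, RatNormal.IsSecant x.1.1 (δ.space i)) →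
      ∃ U : Set (RatNormal.Datum n p l), IsOpen U ∧ U.Nonempty ∧
        ∀ δ' ∈ U, (RatNormal.dataProj n p l ⁻¹' {δ'}).Nonempty ∧
          ∀ x ∈ RatNormal.dataProj n p l ⁻¹' {δ'},
            ∀ i : Fin l, RatNormal.IsSecant x.1.1 (δ'.space i)) := by
  obtain ⟨a, ha, hsat⟩ := RatNormal.exists_satisfies_of_eval_ne_zero hn hpl hfin hne
  obtain ⟨b, hb, hsec⟩ := RatNormal.exists_isSecant_of_eval_ne_zero (p := p) (l := l) hn hpl
  constructor
  · refine dense_iff_inter_open.2 fun W hW hWne => ?_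
    obtain ⟨c, hc, hcW⟩ := RatNormal.exists_ne_zero_of_isOpen hW hWne
    -- A nonempty open set contains the data off the hypersurface `c = 0`, and the image contains
    -- those off `a = 0`. The product is nonzero, so some datum avoids both.
    obtain ⟨y, δ', hδ', hy⟩ := RatNormal.exists_isCoord_eval_ne_zero hn (mul_ne_zero hc ha)
    rw [map_mul] at hy
    obtain ⟨Y, hY⟩ := hsat δ' y hδ' (right_ne_zero_of_mul hy)
    exact ⟨δ', hcW δ' y hδ' (left_ne_zero_of_mul hy), ⟨(Y, δ'), hY⟩, rfl⟩
  · intro _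
    obtain ⟨y, δ₁, hδ₁, hy⟩ := RatNormal.exists_isCoord_eval_ne_zero hn (mul_ne_zero ha hb)
    refine ⟨RatNormal.nonvanishing (a * b), RatNormal.isOpen_nonvanishing _, ⟨δ₁, y, hδ₁, hy⟩, ?_⟩
    rintro δ' ⟨z, hz, hzab⟩
    rw [map_mul] at hzab
    obtain ⟨Y, hY⟩ := hsat δ' z hz (left_ne_zero_of_mul hzab)
    refine ⟨⟨⟨(Y, δ'), hY⟩, rfl⟩, ?_⟩
    rintro ⟨⟨Y', δ''⟩, hY'⟩ hx
    obtain rfl : δ'' = δ' := hx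
    exact hsec δ'' z hz (right_ne_zero_of_mul hzab) Y' hY'
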